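/- Let $G$ be a finite connected simple undirected graph on $n$ vertices and let $s$ be a vertex of $G$. In the synchronous push&pull protocol started at $s$, initially only $s$ knows a rumour; in each round $1,2,\dots$ every vertex $x$ simultaneously calls a uniformly random neighbour $y$ (all calls being independent), and if exactly one of $x,y$ knew the rumour before the round, then the other one learns it in this round. Let $S(G,s)$ be the number of rounds until all vertices know the rumour. In the asynchronous push&pull protocol, each vertex carries an independent rate-$1$ Poisson clock; initially only $s$ knows the rumour, and whenever the clock of a vertex $x$ rings, $x$ calls a uniformly random neighbour $y$ (independently of everything else), and if exactly one of $x,y$ knows the rumour, then the other one learns it at that moment. Let $A(G,s)$ be the time at which all vertices first know the rumour. There is an absolute constant $C$ such that, for every such $n$, $G$ and $s$, the expectation $\mathbb{E}[A(G,s)]$ is finite and \[ \mathbb{E}[S(G,s)] \le C\, \mathbb{E}[A(G,s)]^{2/3}\, n^{1/3} \log n , \] where $\log$ is the natural logarithm (in particular $\mathbb{E}[S(G,s)]$ is finite). In the graph with $n=1$ both spread times are $0$. -/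

import Mathlib

open MeasureTheory ProbabilityTheory
open scoped ENNReal NNReal

namespace Rumour

noncomputable section

universe u

/-! ## The random choices -/

open Classical in
/-- The law of the vertex called by `x`: a uniformly random neighbour of `x` in `G`. A vertex
without neighbours (this occurs only in the one-vertex graph when `G` is connected) calls itself,
which has no effect. -/
def callLaw {V : Type u} [MeasurableSpace V] (G : SimpleGraph V) (x : V) : Measure V :=
  if (G.neighborSet x).Nonempty then uniformOn (G.neighborSet x) else Measure.dirac x

instance callLaw_isProbabilityMeasure {V : Type u} [Fintype V] [MeasurableSpace V]
    [MeasurableSingletonClass V] (G : SimpleGraph V) (x : V) :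
    IsProbabilityMeasure (callLaw G x) := by
  unfold callLaw
  split_ifs with h
  · exact isProbabilityMeasure_uniformOn (Set.toFinite _) h
  · infer_instance

/-! ## The synchronous protocol -/

/-- The randomness of the synchronous protocol: `c (r, x)` is the vertex called by `x` in round
`r + 1`. -/
abbrev SyncOutcome (V : Type u) : Type u := ℕ × V → V

/-- In the synchronous protocol all calls, over all rounds and all vertices, are independent, and
each is to a uniformly random neighbour of the caller. -/
def syncLaw {V : Type u} [MeasurableSpace V] (G : SimpleGraph V) : Measure (SyncOutcome V) :=
  Measure.infinitePi fun p : ℕ × V => callLaw G p.2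

/-- The set of vertices that know the rumour after `r` rounds of the synchronous protocol started
at `s`. In each round the rumour passes only from vertices that were informed before that round,
by a push (the informed vertex `x` calls `y`) or by a pull (`y` calls the informed vertex `x`). -/
def syncInformed {V : Type u} (s : V) (c : SyncOutcome V) : ℕ → Set V
  | 0 => {s}
  | r + 1 => syncInformed s c r ∪ {y | ∃ x ∈ syncInformed s c r, c (r, x) = y ∨ c (r, y) = x}

/-- The synchronous spread time `S(G,s)`: the first round after which everyone knows the rumour
(`∞` if there is none). -/
def syncSpreadTime {V : Type u} (s : V) (c : SyncOutcome V) : ℝ≥0∞ :=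
  ⨅ (r : ℕ) (_ : ∀ v, v ∈ syncInformed s c r), (r : ℝ≥0∞)

/-- The expected synchronous spread time `𝔼[S(G,s)]`. -/
def expectedSync {V : Type u} [MeasurableSpace V] (G : SimpleGraph V) (s : V) : ℝ≥0∞ :=
  ∫⁻ c, syncSpreadTime s c ∂(syncLaw G)

/-! ## The asynchronous protocol -/

/-- The randomness of the asynchronous protocol. The first component gives the waiting times of the
clocks: `ω.1 (x, k)` is the time between the `k`-th and the `k + 1`-st ring of the clock at `x` (the
`0`-th ring being the start of the clock). The second component gives the calls: `ω.2 (x, k)` is the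
vertex called by `x` at the `k + 1`-st ring of its clock. -/
abbrev AsyncOutcome (V : Type u) : Type u := (V × ℕ → ℝ) × (V × ℕ → V)

/-- The clocks ring at the times of independent Poisson processes of rate `1` (the waiting times
are independent exponential variables of rate `1`), and, independently, each call is to a uniformly
random neighbour of the caller. -/
def asyncLaw {V : Type u} [MeasurableSpace V] (G : SimpleGraph V) : Measure (AsyncOutcome V) :=
  (Measure.infinitePi fun _ : V × ℕ => expMeasure 1).prod
    (Measure.infinitePi fun p : V × ℕ => callLaw G p.1)

/-- The time of the `k + 1`-st ring of the clock at `x`. -/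
def ringTime {V : Type u} (ω : AsyncOutcome V) (x : V) (k : ℕ) : ℝ :=
  ∑ j ∈ Finset.range (k + 1), ω.1 (x, j)

/-- `AsyncKnows s ω v t`: in the asynchronous protocol started at `s`, the vertex `v` knows the
rumour at time `t` (calls made at time `t` included). -/
inductive AsyncKnows {V : Type u} (s : V) (ω : AsyncOutcome V) : V → ℝ → Prop
  /-- Initially `s` knows the rumour. -/
  | start : AsyncKnows s ω s 0
  /-- Once a vertex knows the rumour, it knows it forever. -/
  | stay (x : V) (t t' : ℝ) : AsyncKnows s ω x t → t ≤ t' → AsyncKnows s ω x t'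
  /-- If `x` knows the rumour before a ring of its clock, it pushes it to the vertex it calls. -/
  | push (x : V) (k : ℕ) (t : ℝ) : AsyncKnows s ω x t → t < ringTime ω x k →
      AsyncKnows s ω (ω.2 (x, k)) (ringTime ω x k)
  /-- If `x` calls a vertex that knows the rumour before that ring, then `x` pulls the rumour. -/
  | pull (x : V) (k : ℕ) (t : ℝ) : AsyncKnows s ω (ω.2 (x, k)) t → t < ringTime ω x k →
      AsyncKnows s ω x (ringTime ω x k)

/-- The asynchronous spread time `A(G,s)`: the first time at which everyone knows the rumour (`∞` if
there is none). -/
def asyncSpreadTime {V : Type u} (s : V) (ω : AsyncOutcome V) : ℝ≥0∞ :=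
  ⨅ (t : ℝ) (_ : ∀ v, AsyncKnows s ω v t), ENNReal.ofReal t

/-- The expected asynchronous spread time `𝔼[A(G,s)]`. -/
def expectedAsync {V : Type u} [MeasurableSpace V] (G : SimpleGraph V) (s : V) : ℝ≥0∞ :=
  ∫⁻ ω, asyncSpreadTime s ω ∂(asyncLaw G)

end

end Rumour

/-! The bridge between the two protocols is first-passage percolation on `G`: write `p x y` for the
probability that `x` calls `y`, and give each oriented edge `(x, y)` an independent exponential
passage time of rate `p x y + p y x`. Only the orientation leaving the reached set matters.
Conditioning on the first event shows that the percolation from a set covers the graph by time `t`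
at least as likely as the asynchronous protocol informs everyone by then
(`informedProb_le_coverProb`). By Markov's inequality the percolation from `s` covers by `t = 4
𝔼[A]` with probability at least `3/4`.

Cut time into windows of length `R ≈ 10 log n` and round passage times up to whole windows. During
one window a set `I` grows by the endpoints of edges of passage time at most `R`. The same random
set arises when every vertex makes a Poisson(`R`) number of calls (`poissonSyncLaw_subset`). Except
with probability `n * exp (-2R)` no vertex makes more than `4R` calls, and then `4R` synchronous
rounds inform at least that set (`sum_enlarge_le`). So `m` windows cost `4Rm` rounds
(`roundedProb_le_syncProb`).

Rounding costs at most one window per edge of a path, so it remains to see that fast paths have few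
edges: with probability at least `3/4` no self-avoiding path from `s` with at least `L ≈ 20 t^(2/3)
n^(1/3)` edges has cost at most `t` (unless `n < 2L`, when paths are short anyway). This is a
first-moment bound on the sum of `exp (-θ * cost)` over self-avoiding paths of length `L`. Its mean
is at most `θ^(-L)` times the sum over paths of the products of `p x y + p y x`. Push steps out of a
vertex have total weight at most 1. Pull steps may have large weight at a vertex that receives many
calls, but at most `n` calls per unit time are received altogether, and a self-avoiding path uses
each vertex once. A potential of total mass at most `n` makes this quantitative (`exists_potential`,
`pathWeight_le_min`): the weight is at most `μ^(L+1) * exp (κ n)` if `μ ≥ 2` and `μ² κ ≥ 2`. With `κ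
= L/n`, `μ² = 2n/L` and `θ = L/t` the bound is small once `L³` exceeds a constant times `t² n`,
which is the origin of the exponents `2/3` and `1/3`.

Finally `t` is capped at `2n(log n + 5)`, by which time the percolation covers anyway
(`coverProb_ge_of_le`); this keeps `t/R` below the order of `L`. Then `m ≈ t/R + 2L` windows
suffice, the synchronous protocol finishes within `4Rm` rounds with probability at least `1/4`, and
independent restarts give `𝔼[S] ≤ 16Rm`. -/

namespace Rumour

set_option linter.unusedSectionVars false

/-! ### Independence and memorylessness in infinite product measures -/

section ProductMeasures

variable {ι κ κ' α : Type*} [MeasurableSpace α]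

open Classical in
theorem measurable_piecewise_pair (S : Set ι) :
    Measurable (fun p : (ι → α) × (ι → α) => S.piecewise p.1 p.2) := by
  refine measurable_pi_iff.2 fun i => ?_
  by_cases hi : i ∈ S
  · simp only [Set.piecewise, hi, if_true]; fun_prop
  · simp only [Set.piecewise, hi, if_false]; fun_prop

open Classical in
/-- Resampling the coordinates outside `S` does not change a product measure. -/
theorem map_piecewise_infinitePi (μ : ι → Measure α) [∀ i, IsProbabilityMeasure (μ i)]
    (S : Set ι) :
    ((Measure.infinitePi μ).prod (Measure.infinitePi μ)).map
      (fun p => S.piecewise p.1 p.2) = Measure.infinitePi μ := by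
  refine Measure.eq_infinitePi _ fun s t ht => ?_
  rw [Measure.map_apply (measurable_piecewise_pair S) (.pi s.countable_toSet fun _ _ => ht _)]
  have : (fun p : (ι → α) × (ι → α) => S.piecewise p.1 p.2) ⁻¹' ((s : Set ι).pi t) =
      (Set.pi (s.filter (· ∈ S) : Finset ι) t) ×ˢ (Set.pi (s.filter (· ∉ S) : Finset ι) t) := by
    ext ⟨f, g⟩
    simp only [Set.mem_preimage, Set.mem_pi, Set.mem_prod, Finset.coe_filter, Set.mem_ofPred_eq,
      SetLike.mem_coe]
    constructor
    · intro h
      exact ⟨fun i hi => by simpa [Set.piecewise, hi.2] using h i hi.1,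
        fun i hi => by simpa [Set.piecewise, hi.2] using h i hi.1⟩
    · rintro ⟨h1, h2⟩ i hi
      by_cases hS : i ∈ S
      · simpa [Set.piecewise, hS] using h1 i ⟨hi, hS⟩
      · simpa [Set.piecewise, hS] using h2 i ⟨hi, hS⟩
  rw [this, Measure.prod_prod, Measure.infinitePi_pi _ fun i _ => ht i,
    Measure.infinitePi_pi _ fun i _ => ht i, Finset.prod_filter_mul_prod_filter_not]

open Classical in
theorem lintegral_infinitePi_piecewise (μ : ι → Measure α) [∀ i, IsProbabilityMeasure (μ i)]
    (S : Set ι) {Φ : (ι → α) → ℝ≥0∞} (hΦ : Measurable Φ) :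
    ∫⁻ ω, Φ ω ∂(Measure.infinitePi μ) =
      ∫⁻ f, ∫⁻ g, Φ (S.piecewise f g) ∂(Measure.infinitePi μ) ∂(Measure.infinitePi μ) := by
  conv_lhs => rw [← map_piecewise_infinitePi μ S]
  rw [lintegral_map hΦ (measurable_piecewise_pair S), lintegral_prod]
  exact (hΦ.comp (measurable_piecewise_pair S)).aemeasurable

theorem measurable_precomp (ρ : κ → ι) : Measurable (fun f : ι → α => f ∘ ρ) :=
  measurable_pi_iff.2 fun k => measurable_pi_apply (ρ k)

theorem map_comp_infinitePi (μ : ι → Measure α) [∀ i, IsProbabilityMeasure (μ i)]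
    {ρ : κ → ι} (hρ : Function.Injective ρ) :
    (Measure.infinitePi μ).map (fun f => f ∘ ρ) = Measure.infinitePi (fun k => μ (ρ k)) := by
  classical
  refine Measure.eq_infinitePi _ fun s t ht => ?_
  rw [Measure.map_apply (measurable_precomp ρ) (.pi s.countable_toSet fun _ _ => ht _)]
  have : (fun f : ι → α => f ∘ ρ) ⁻¹' ((s : Set κ).pi t) =
      Set.pi (s.map ⟨ρ, hρ⟩ : Finset ι) (Function.extend ρ t (fun _ => Set.univ)) := by
    ext f
    simp [Set.mem_pi, hρ.extend_apply]
  rw [this, Measure.infinitePi_pi, Finset.prod_map]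
  · simp [hρ.extend_apply]
  · intro i hi
    obtain ⟨k, _, rfl⟩ := Finset.mem_map.1 hi
    simpa [hρ.extend_apply] using ht k

/-- Disjoint families of coordinates of a product measure are independent. -/
theorem lintegral_infinitePi_comp_comp (μ : ι → Measure α) [∀ i, IsProbabilityMeasure (μ i)]
    {σ : κ → ι} {τ : κ' → ι} (hσ : Function.Injective σ) (hτ : Function.Injective τ)
    (hd : ∀ i j, σ i ≠ τ j) {Φ : (κ → α) → (κ' → α) → ℝ≥0∞}
    (hΦ : Measurable (Function.uncurry Φ)) :
    ∫⁻ ω, Φ (ω ∘ σ) (ω ∘ τ) ∂(Measure.infinitePi μ) =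
      ∫⁻ f, ∫⁻ g, Φ f g ∂(Measure.infinitePi fun j => μ (τ j))
        ∂(Measure.infinitePi fun i => μ (σ i)) := by
  classical
  have hm : Measurable fun ω : ι → α => Φ (ω ∘ σ) (ω ∘ τ) :=
    hΦ.comp ((measurable_precomp σ).prodMk (measurable_precomp τ))
  rw [lintegral_infinitePi_piecewise μ (Set.range σ) hm, ← map_comp_infinitePi μ hσ,
    ← map_comp_infinitePi μ hτ]
  have h1 (f g : ι → α) : (Set.range σ).piecewise f g ∘ σ = f ∘ σ := by
    ext i; simp [Set.piecewise]
  have h2 (f g : ι → α) : (Set.range σ).piecewise f g ∘ τ = g ∘ τ := by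
    ext i
    have : τ i ∉ Set.range σ := by rintro ⟨j, hj⟩; exact hd j i hj
    simp [Set.piecewise, this]
  simp only [h1, h2]
  refine Eq.trans ?_ (lintegral_map (Measurable.lintegral_prod_right' hΦ)
    (measurable_precomp σ)).symm
  refine lintegral_congr fun f => ?_
  simp only [Function.uncurry_apply_pair]
  rw [lintegral_map (f := fun g => Φ (f ∘ σ) g) _ (measurable_precomp τ)]
  exact hΦ.comp (measurable_const.prodMk measurable_id)

/-- Functions that depend on complementary sets of coordinates are independent. -/
theorem lintegral_infinitePi_mul (μ : ι → Measure α) [∀ i, IsProbabilityMeasure (μ i)]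
    (S : Set ι) {f g : (ι → α) → ℝ≥0∞} (hf : Measurable f) (hg : Measurable g)
    (hfS : ∀ ω ω', (∀ i ∈ S, ω i = ω' i) → f ω = f ω')
    (hgS : ∀ ω ω', (∀ i ∉ S, ω i = ω' i) → g ω = g ω') :
    ∫⁻ ω, f ω * g ω ∂(Measure.infinitePi μ) =
      (∫⁻ ω, f ω ∂(Measure.infinitePi μ)) * ∫⁻ ω, g ω ∂(Measure.infinitePi μ) := by
  classical
  refine (lintegral_infinitePi_piecewise μ S (hf.mul hg)).trans ?_
  have h1 (a b : ι → α) : (f * g) (S.piecewise a b) = f a * g b := by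
    rw [Pi.mul_apply, hfS (S.piecewise a b) a fun i hi => by simp [Set.piecewise, hi],
      hgS (S.piecewise a b) b fun i hi => by simp [Set.piecewise, hi]]
  simp only [h1]
  rw [← lintegral_mul_const _ hf]
  exact lintegral_congr fun a => lintegral_const_mul _ hg

open Classical in
/-- The shift of the coordinates in `B` by `u`. -/
noncomputable def shiftOn (B : Finset ι) (u : ℝ) (f : ι → ℝ) : ι → ℝ :=
  fun i => if i ∈ B then f i - u else f i

theorem measurable_shiftOn (B : Finset ι) :
    Measurable (fun p : ℝ × (ι → ℝ) => shiftOn B p.1 p.2) := by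
  refine measurable_pi_iff.2 fun i => ?_
  by_cases hi : i ∈ B
  · simp only [shiftOn, hi, if_true]; fun_prop
  · simp only [shiftOn, hi, if_false]; fun_prop

theorem measurable_shiftOn_right (B : Finset ι) (u : ℝ) : Measurable (shiftOn B u) :=
  (measurable_shiftOn B).comp (measurable_const.prodMk measurable_id)

theorem measurableSet_forall_lt (B : Finset ι) (u : ℝ) :
    MeasurableSet {f : ι → ℝ | ∀ i ∈ B, u < f i} := by
  have : {f : ι → ℝ | ∀ i ∈ B, u < f i} = Set.pi B fun _ => Set.Ioi u := by
    ext; simp [Set.mem_pi]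
  rw [this]
  exact .pi B.countable_toSet fun _ _ => measurableSet_Ioi

/-- Memorylessness for finitely many coordinates of a product measure at once. -/
theorem lintegral_infinitePi_shiftOn (μ : ι → Measure ℝ) [∀ i, IsProbabilityMeasure (μ i)]
    (B : Finset ι) (u : ℝ) (c : ι → ℝ≥0∞) (hc0 : ∀ i, c i ≠ 0) (hc : ∀ i, c i ≠ ∞)
    (hμ : ∀ i ∈ B, ∀ s, MeasurableSet s → μ i {w | u < w ∧ w - u ∈ s} = c i * μ i s)
    {Φ : (ι → ℝ) → ℝ≥0∞} (hΦ : Measurable Φ) :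
    ∫⁻ ω in {f | ∀ i ∈ B, u < f i}, Φ (shiftOn B u ω) ∂(Measure.infinitePi μ) =
      (∏ i ∈ B, c i) * ∫⁻ ω, Φ ω ∂(Measure.infinitePi μ) := by
  classical
  have hC0 : ∏ i ∈ B, c i ≠ 0 := Finset.prod_ne_zero_iff.2 fun i _ => hc0 i
  have hC : ∏ i ∈ B, c i ≠ ∞ := ENNReal.prod_ne_top fun i _ => hc i
  -- Given that all coordinates in `B` exceed `u`, the shifted point again has the original law. It
  -- suffices to check this on boxes, where both sides factorise.
  have key : (∏ i ∈ B, c i)⁻¹ • ((Measure.infinitePi μ).restrict {f | ∀ i ∈ B, u < f i}).map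
      (shiftOn B u) = Measure.infinitePi μ := by
    refine Measure.eq_infinitePi _ fun s t ht => ?_
    have hst : MeasurableSet ((s : Set ι).pi t) := .pi s.countable_toSet fun _ _ => ht _
    rw [Measure.smul_apply, Measure.map_apply (measurable_shiftOn_right B u) hst,
      Measure.restrict_apply (measurable_shiftOn_right B u hst)]
    have : shiftOn B u ⁻¹' ((s : Set ι).pi t) ∩ {f | ∀ i ∈ B, u < f i} =
        Set.pi (s ∪ B : Finset ι) fun i => if i ∈ B then {w | u < w ∧ w - u ∈
          (if i ∈ s then t i else Set.univ)} else t i := by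
      ext f
      simp only [Set.mem_inter_iff, Set.mem_preimage, Set.mem_pi, SetLike.mem_coe,
        Set.mem_ofPred_eq, Finset.coe_union, Set.mem_union]
      constructor
      · rintro ⟨h1, h2⟩ i hi
        by_cases hB : i ∈ B
        · simp only [hB, if_true, Set.mem_ofPred_eq]
          refine ⟨h2 i hB, ?_⟩
          split_ifs with hs
          · simpa [shiftOn, hB] using h1 i hs
          · trivial
        · have hs : i ∈ s := by tauto
          simpa [shiftOn, hB] using h1 i hs
      · intro h
        refine ⟨fun i hs => ?_, fun i hB => ?_⟩
        · have := h i (Or.inl hs)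
          by_cases hB : i ∈ B
          · simp only [hB, hs, if_true, Set.mem_ofPred_eq] at this
            simpa [shiftOn, hB] using this.2
          · simpa [shiftOn, hB] using this
        · have := h i (Or.inr hB)
          simp only [hB, if_true, Set.mem_ofPred_eq] at this
          exact this.1
    have hmeas : ∀ i ∈ B, MeasurableSet (if i ∈ s then t i else Set.univ) := fun i _ => by
      split_ifs
      exacts [ht i, .univ]
    rw [this, Measure.infinitePi_pi]
    · have : ∀ i ∈ s ∪ B, μ i (if i ∈ B then {w | u < w ∧ w - u ∈
          (if i ∈ s then t i else Set.univ)} else t i) =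
          (if i ∈ B then c i else 1) * (if i ∈ s then μ i (t i) else 1) := by
        intro i hi
        by_cases hB : i ∈ B
        · simp only [hB, if_true]
          rw [hμ i hB _ (hmeas i hB)]
          split_ifs <;> simp
        · have hs : i ∈ s := by simpa [hB] using hi
          simp [hB, hs]
      rw [Finset.prod_congr rfl this, Finset.prod_mul_distrib, Finset.prod_ite_mem,
        Finset.prod_ite_mem, Finset.union_inter_cancel_right, Finset.union_inter_cancel_left,
        smul_eq_mul, ← mul_assoc, ENNReal.inv_mul_cancel hC0 hC, one_mul]
    · intro i _
      by_cases hB : i ∈ B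
      · simp only [hB, if_true]
        exact measurableSet_Ioi.inter ((measurable_id.sub_const u) (hmeas i hB))
      · simpa [hB] using ht i
  rw [← lintegral_map hΦ (measurable_shiftOn_right B u)]
  conv_rhs => rw [← key]
  rw [lintegral_smul_measure, smul_eq_mul, ← mul_assoc, ENNReal.mul_inv_cancel hC0 hC, one_mul]

end ProductMeasures

/-! ### The exponential law -/

section Exponential

theorem lintegral_expMeasure {r : ℝ} (f : ℝ → ℝ≥0∞) (hf : Measurable f) :
    ∫⁻ x, f x ∂(expMeasure r) =
      ∫⁻ x in Set.Ioi 0, ENNReal.ofReal (r * Real.exp (-(r * x))) * f x := by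
  have h1 : Measurable (exponentialPDF r) := (measurable_exponentialPDFReal r).ennreal_ofReal
  change ∫⁻ x, f x ∂(volume.withDensity (exponentialPDF r)) = _
  rw [lintegral_withDensity_eq_lintegral_mul _ h1 hf, ← lintegral_indicator measurableSet_Ioi]
  refine lintegral_congr_ae ?_
  have : ∀ᵐ x : ℝ, x ≠ 0 := by simp [ae_iff]
  filter_upwards [this] with x hx
  simp only [Pi.mul_apply, Set.indicator_apply, Set.mem_Ioi]
  split_ifs with h
  · rw [exponentialPDF_of_nonneg h.le]
  · rw [exponentialPDF_of_neg (lt_of_le_of_ne (not_lt.1 h) hx), zero_mul]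

/-- The exponential law is memoryless. -/
theorem expMeasure_memoryless {r u : ℝ} (hu : 0 ≤ u) {s : Set ℝ}
    (hs : MeasurableSet s) :
    expMeasure r {w | u < w ∧ w - u ∈ s} =
      ENNReal.ofReal (Real.exp (-(r * u))) * expMeasure r s := by
  classical
  have hm : MeasurableSet {w : ℝ | u < w ∧ w - u ∈ s} :=
    measurableSet_Ioi.inter ((measurable_id.sub_const u) hs)
  rw [← lintegral_indicator_one hm, ← lintegral_indicator_one hs,
    lintegral_expMeasure _ (measurable_one.indicator hm),
    lintegral_expMeasure _ (measurable_one.indicator hs),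
    ← lintegral_const_mul' _ _ ENNReal.ofReal_ne_top,
    ← lintegral_indicator measurableSet_Ioi, ← lintegral_indicator measurableSet_Ioi]
  -- Translation by `u` carries `(u, ∞)` to `(0, ∞)`; the density changes by the factor `exp (-r
  -- u)`.
  refine Eq.trans ?_ (lintegral_sub_right_eq_self (μ := volume) _ u)
  refine lintegral_congr fun x => ?_
  have h2 : x ∈ {w : ℝ | u < w ∧ w - u ∈ s} ↔ u < x ∧ x - u ∈ s := Iff.rfl
  simp only [Set.indicator_apply, Set.mem_Ioi, sub_pos, h2]
  by_cases h1 : u < x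
  · have h2 : 0 < x := hu.trans_lt h1
    simp only [h1, h2, true_and, if_true, Pi.one_apply]
    split_ifs
    · rw [mul_one, mul_one, ← ENNReal.ofReal_mul (Real.exp_pos _).le, mul_left_comm,
        ← Real.exp_add]
      congr 3
      ring
    · simp
  · simp [h1]

theorem expMeasure_Iic_zero {r : ℝ} : expMeasure r (Set.Iic 0) = 0 := by
  rw [← lintegral_indicator_one measurableSet_Iic,
    lintegral_expMeasure _ (measurable_one.indicator measurableSet_Iic)]
  refine (setLIntegral_congr_fun measurableSet_Ioi fun x hx => ?_).trans lintegral_zero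
  have : x ∉ Set.Iic (0 : ℝ) := by simpa using hx
  simp [this]

end Exponential

/-! ### First-passage percolation for fixed passage times -/

section Passage

variable {V : Type*}

/-- `Passage G w I v t`: in first-passage percolation on `G` with passage times `w`, started from
the set `I`, the vertex `v` is reached by time `t`, along edges of nonnegative passage time. -/
inductive Passage (G : SimpleGraph V) (w : V × V → ℝ) (I : Set V) : V → ℝ → Prop
  | start (v : V) (t : ℝ) : v ∈ I → 0 ≤ t → Passage G w I v t
  | step (x y : V) (t t' : ℝ) : Passage G w I x t → G.Adj x y → 0 ≤ w (x, y) →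
      t + w (x, y) ≤ t' → Passage G w I y t'

variable {G : SimpleGraph V} {w w' : V × V → ℝ} {I J : Set V} {v : V} {t t' : ℝ}

theorem Passage.nonneg (h : Passage G w I v t) : 0 ≤ t := by
  induction h with
  | start v t hv ht => exact ht
  | step x y t t' _ _ hw hle ih => linarith

theorem Passage.mono (h : Passage G w I v t) (ht : t ≤ t') : Passage G w I v t' := by
  cases h with
  | start _ _ hv h0 => exact .start _ _ hv (h0.trans ht)
  | step x y s _ hx hadj hw hle => exact .step x v s t' hx hadj hw (hle.trans ht)

/-- Edges into the starting set are irrelevant. -/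
theorem Passage.congr (h : Passage G w I v t) (hw : ∀ e : V × V, e.2 ∉ I → w e = w' e) :
    Passage G w' I v t := by
  induction h with
  | start v t hv ht => exact .start _ _ hv ht
  | step x y t t' hx hadj hnn hle ih =>
    by_cases hy : y ∈ I
    · exact .start _ _ hy (by linarith [hx.nonneg])
    · rw [hw (x, y) hy] at hnn hle
      exact .step x y t t' ih hadj hnn hle

/-- All vertices are reached by time `t`. -/
def Covers (G : SimpleGraph V) (w : V × V → ℝ) (I : Set V) (t : ℝ) : Prop :=
  ∀ v, Passage G w I v t

theorem Covers.congr (h : Covers G w I t) (hw : ∀ e : V × V, e.2 ∉ I → w e = w' e) :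
    Covers G w' I t := fun v => (h v).congr hw

theorem Covers.mono (h : Covers G w I t) (ht : t ≤ t') : Covers G w I t' :=
  fun v => (h v).mono ht

theorem covers_univ (ht : 0 ≤ t) : Covers G w Set.univ t := fun _ => .start _ _ trivial ht

/-- The cost of a walk. -/
def walkCost (w : V × V → ℝ) {u v : V} (p : G.Walk u v) : ℝ :=
  (p.darts.map fun d => w d.toProd).sum

@[simp] theorem walkCost_nil (u : V) : walkCost w (SimpleGraph.Walk.nil : G.Walk u u) = 0 := by
  simp [walkCost]

@[simp] theorem walkCost_cons {u v x : V} (h : G.Adj u v) (p : G.Walk v x) :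
    walkCost w (SimpleGraph.Walk.cons h p) = w (u, v) + walkCost w p := by
  simp [walkCost]

theorem Passage.walk {u v : V} (p : G.Walk u v) (hu : Passage G w I u t)
    (hp : ∀ d ∈ p.darts, 0 ≤ w d.toProd) : Passage G w I v (t + walkCost w p) := by
  induction p generalizing t with
  | nil => simpa using hu
  | cons h p ih =>
    simp only [SimpleGraph.Walk.darts_cons, List.mem_cons, forall_eq_or_imp] at hp
    have := ih (.step _ _ t _ hu h hp.1 le_rfl) hp.2
    rwa [walkCost_cons, ← add_assoc]

/-- Walks form a countable set, so this form gives measurability; it also gives access to the number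
of edges and to loop erasure. -/
theorem passage_iff : Passage G w I v t ↔
    ∃ a ∈ I, ∃ p : G.Walk a v, (∀ d ∈ p.darts, 0 ≤ w d.toProd) ∧ walkCost w p ≤ t := by
  constructor
  · intro h
    induction h with
    | start v t hv ht => exact ⟨v, hv, .nil, by simp, by simpa⟩
    | step x y t t' hx hadj hnn hle ih =>
      obtain ⟨a, ha, p, hp, hpt⟩ := ih
      refine ⟨a, ha, p.concat hadj, ?_, ?_⟩
      · intro d hd
        rw [SimpleGraph.Walk.darts_concat, List.concat_eq_append, List.mem_append,
          List.mem_singleton] at hd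
        rcases hd with hd | rfl
        · exact hp d hd
        · exact hnn
      · simp only [walkCost, SimpleGraph.Walk.darts_concat, List.concat_eq_append, List.map_append,
          List.sum_append, List.map_cons, List.map_nil, List.sum_singleton]
        simp only [walkCost] at hpt
        linarith
  · rintro ⟨a, ha, p, hp, hpt⟩
    refine Passage.mono ?_ hpt
    have := Passage.walk p (Passage.start (G := G) (w := w) a 0 ha le_rfl) hp
    rwa [zero_add] at this

open Classical in
/-- The edges from `I` to the complement of `J`. -/
noncomputable def outEdges [Fintype V] (G : SimpleGraph V) (I J : Set V) : Finset (V × V) :=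
  Finset.univ.filter fun e => e.1 ∈ I ∧ e.2 ∉ J ∧ G.Adj e.1 e.2

theorem mem_outEdges [Fintype V] {e : V × V} :
    e ∈ outEdges G I J ↔ e.1 ∈ I ∧ e.2 ∉ J ∧ G.Adj e.1 e.2 := by
  simp [outEdges]

/-- Restarting first-passage percolation at time `u` from a set reached by then. -/
theorem Passage.of_shiftOn [Fintype V] {u : ℝ} (hu : 0 ≤ u)
    (hJ : ∀ y ∈ J, y ∉ I → ∃ x ∈ I, G.Adj x y ∧ 0 ≤ w (x, y) ∧ w (x, y) ≤ u)
    (h : Passage G (shiftOn (outEdges G I I) u w) J v t) : Passage G w I v (t + u) := by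
  induction h with
  | start v t hv ht =>
    by_cases hvI : v ∈ I
    · exact .start _ _ hvI (by linarith)
    · obtain ⟨x, hx, hadj, h0, hle⟩ := hJ v hv hvI
      exact .step x v 0 _ (.start _ _ hx le_rfl) hadj h0 (by linarith)
  | step x y t t' hx hadj hnn hle ih =>
    have h0 := hx.nonneg
    by_cases hy : y ∈ I
    · exact .start _ _ hy (by linarith)
    by_cases hxI : x ∈ I
    · have hm : (x, y) ∈ outEdges G I I := mem_outEdges.2 ⟨hxI, hy, hadj⟩
      simp only [shiftOn, hm, if_true] at hnn hle
      exact .step x y 0 _ (.start _ _ hxI le_rfl) hadj (by linarith) (by linarith)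
    · have hm : (x, y) ∉ outEdges G I I := fun h => hxI (mem_outEdges.1 h).1
      simp only [shiftOn, hm, if_false] at hnn hle
      exact .step x y _ _ ih hadj hnn (by linarith)

theorem Covers.of_shiftOn [Fintype V] {u : ℝ} (hu : 0 ≤ u)
    (hJ : ∀ y ∈ J, y ∉ I → ∃ x ∈ I, G.Adj x y ∧ 0 ≤ w (x, y) ∧ w (x, y) ≤ u)
    (h : Covers G (shiftOn (outEdges G I I) u w) J (t - u)) : Covers G w I t := fun v => by
  have := (h v).of_shiftOn hu hJ
  rwa [sub_add_cancel] at this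

/-- Passage times rounded up to multiples of `R`, in units of `R`. -/
noncomputable def rounded (R : ℝ) (w : V × V → ℝ) : V × V → ℝ := fun e => (⌊w e / R⌋₊ : ℝ) + 1

theorem one_le_rounded (R : ℝ) (w : V × V → ℝ) (e : V × V) : 1 ≤ rounded R w e := by
  simp [rounded]

/-- The vertices joined to `I` within one time window of length `R`. -/
def enlarge (G : SimpleGraph V) (R : ℝ) (I : Set V) (w : V × V → ℝ) : Set V :=
  I ∪ {y | ∃ x ∈ I, G.Adj x y ∧ w (x, y) ≤ R}

theorem subset_enlarge (R : ℝ) : I ⊆ enlarge G R I w := Set.subset_union_left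

/-- Every rounded edge costs at least one unit, so whatever lies outside `I` is reached no earlier
than time 1. An edge leaving `I` either ends in the enlarged set `J`, which is the new start, or has
passage time above `R`; in that case subtracting `R` lowers its rounded value by exactly one. Edges
from outside `I` are not started before the window ends and keep their values. -/
theorem Passage.rounded_shiftOn [Fintype V] {R : ℝ} (hR : 0 < R)
    (h : Passage G (rounded R w) I v t) : (v ∈ I ∧ 0 ≤ t) ∨ (1 ≤ t ∧ Passage G
      (rounded R (shiftOn (outEdges G I (enlarge G R I w)) R w)) (enlarge G R I w) v (t - 1)) := by
  set J := enlarge G R I w with hJ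
  induction h with
  | start v t hv ht => exact Or.inl ⟨hv, ht⟩
  | step x y t t' hx hadj hnn hle ih =>
    have h1 := one_le_rounded R w (x, y)
    have h0 := hx.nonneg
    right
    refine ⟨by linarith, ?_⟩
    by_cases hy : y ∈ J
    · exact .start _ _ hy (by linarith)
    have h1' := one_le_rounded R (shiftOn (outEdges G I J) R w) (x, y)
    by_cases hxI : x ∈ I
    · have hm : (x, y) ∈ outEdges G I J := mem_outEdges.2 ⟨hxI, hy, hadj⟩
      have hgt : R < w (x, y) := by
        by_contra hcon
        exact hy (Or.inr ⟨x, hxI, hadj, not_lt.1 hcon⟩)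
      -- The truncated floor drops by exactly one because `w (x, y) / R ≥ 1`.
      have he : rounded R (shiftOn (outEdges G I J) R w) (x, y) = rounded R w (x, y) - 1 := by
        have h2 : 1 ≤ w (x, y) / R := by rw [le_div_iff₀ hR]; linarith
        simp only [rounded, shiftOn, hm, if_true, sub_div, div_self hR.ne', Nat.floor_sub_one]
        rw [Nat.cast_sub (Nat.le_floor (by simpa using h2))]
        simp
      -- The passage is restarted at `x`, which belongs to `J`; the earlier part of the path is
      -- dropped.
      exact .step x y 0 _ (.start _ _ (Or.inl hxI) le_rfl) hadj (by linarith)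
        (by rw [he]; linarith)
    · obtain ⟨ht1, hx1⟩ := ih.resolve_left fun h => hxI h.1
      have hm : (x, y) ∉ outEdges G I J := fun h => hxI (mem_outEdges.1 h).1
      have he : rounded R (shiftOn (outEdges G I J) R w) (x, y) = rounded R w (x, y) := by
        simp only [rounded, shiftOn, hm, if_false]
      exact .step x y _ _ hx1 hadj (by linarith) (by rw [he]; linarith)

theorem Covers.rounded_shiftOn [Fintype V] {R : ℝ} (hR : 0 < R) (ht : 0 ≤ t)
    (h : Covers G (rounded R w) I (t + 1)) :
    Covers G (rounded R (shiftOn (outEdges G I (enlarge G R I w)) R w)) (enlarge G R I w) t := by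
  intro v
  rcases (h v).rounded_shiftOn hR with ⟨hv, _⟩ | ⟨_, h⟩
  · exact .start _ _ (Or.inl hv) ht
  · simpa using h

instance countable_walk [Countable V] (u v : V) : Countable (G.Walk u v) :=
  Function.Injective.countable (f := fun p : G.Walk u v => p.support)
    fun _ _ h => SimpleGraph.Walk.ext_support h

/-- Measurability is needed jointly in the time and the passage times, because the percolation is
later restarted at a random time. -/
theorem measurableSet_passage [Countable V] (G : SimpleGraph V) (I : Set V) (v : V) :
    MeasurableSet {p : ℝ × (V × V → ℝ) | Passage G p.2 I v p.1} := by
  simp only [passage_iff, walkCost]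
  have : {p : ℝ × (V × V → ℝ) | ∃ a ∈ I, ∃ q : G.Walk a v, (∀ d ∈ q.darts, 0 ≤ p.2 d.toProd) ∧
      (q.darts.map fun d => p.2 d.toProd).sum ≤ p.1} = ⋃ a ∈ I, ⋃ q : G.Walk a v,
        (⋂ d ∈ q.darts, {p | 0 ≤ p.2 d.toProd}) ∩
          {p | (q.darts.map fun d => p.2 d.toProd).sum ≤ p.1} := by
    ext; simp
  rw [this]
  refine .biUnion (Set.to_countable I) fun a _ => .iUnion fun q => .inter ?_ ?_
  · refine MeasurableSet.biInter ((List.finite_toSet _).countable) fun d _ => ?_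
    exact measurableSet_le measurable_const (by fun_prop)
  · refine measurableSet_le ?_ measurable_fst
    have : ∀ l : List G.Dart, Measurable fun p : ℝ × (V × V → ℝ) =>
        (l.map fun d => p.2 d.toProd).sum := by
      intro l
      induction l with
      | nil => simp
      | cons d l ih => simp only [List.map_cons, List.sum_cons]; fun_prop
    exact this _

theorem measurableSet_covers [Countable V] (G : SimpleGraph V) (I : Set V) :
    MeasurableSet {p : ℝ × (V × V → ℝ) | Covers G p.2 I p.1} := by
  simp only [Covers, Set.ofPred_forall]
  exact .iInter fun v => measurableSet_passage G I v

theorem measurableSet_covers_right [Countable V] (G : SimpleGraph V) (I : Set V) (t : ℝ) :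
    MeasurableSet {w : V × V → ℝ | Covers G w I t} :=
  (measurable_const.prodMk measurable_id : Measurable fun w : V × V → ℝ => (t, w))
    (measurableSet_covers G I)

theorem measurable_rounded (R : ℝ) : Measurable (rounded R : (V × V → ℝ) → V × V → ℝ) := by
  refine measurable_pi_iff.2 fun e => ?_
  unfold rounded
  have h : Measurable fun w : V × V → ℝ => w e / R := by fun_prop
  have h2 : Measurable fun w : V × V → ℝ => ⌊w e / R⌋₊ := Nat.measurable_floor.comp h
  exact (measurable_from_nat.comp h2).add_const 1

end Passage

/-! ### Independence of events depending on complementary coordinates -/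

section ProductSets

variable {ι : Type*} {α : Type*} [MeasurableSpace α]

theorem infinitePi_inter (μ : ι → Measure α) [∀ i, IsProbabilityMeasure (μ i)]
    (S : Set ι) {A B : Set (ι → α)} (hA : MeasurableSet A) (hB : MeasurableSet B)
    (hAS : ∀ ω ω', (∀ i ∈ S, ω i = ω' i) → ω ∈ A → ω' ∈ A)
    (hBS : ∀ ω ω', (∀ i ∉ S, ω i = ω' i) → ω ∈ B → ω' ∈ B) :
    Measure.infinitePi μ (A ∩ B) = Measure.infinitePi μ A * Measure.infinitePi μ B := by
  classical
  rw [← lintegral_indicator_one (hA.inter hB), ← lintegral_indicator_one hA,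
    ← lintegral_indicator_one hB, ← lintegral_infinitePi_mul μ S (measurable_one.indicator hA)
      (measurable_one.indicator hB)]
  · rw [Set.inter_indicator_one]; rfl
  · intro ω ω' h
    have : ω ∈ A ↔ ω' ∈ A := ⟨hAS _ _ h, hAS _ _ fun i hi => (h i hi).symm⟩
    simp [Set.indicator_apply, this]
  · intro ω ω' h
    have : ω ∈ B ↔ ω' ∈ B := ⟨hBS _ _ h, hBS _ _ fun i hi => (h i hi).symm⟩
    simp [Set.indicator_apply, this]

end ProductSets

/-! ### The law of first-passage percolation and its Markov property -/

section Law

variable {V : Type*}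

open Classical in
/-- The probability that `x` calls `y`. -/
noncomputable def callProb (G : SimpleGraph V) (x y : V) : ℝ :=
  if G.Adj x y then ((G.neighborSet x).ncard : ℝ)⁻¹ else 0

theorem callProb_nonneg (G : SimpleGraph V) (x y : V) : 0 ≤ callProb G x y := by
  unfold callProb; split_ifs <;> positivity

theorem callProb_of_not_adj {G : SimpleGraph V} {x y : V} (h : ¬ G.Adj x y) :
    callProb G x y = 0 := if_neg h

variable [Fintype V] {G : SimpleGraph V} {I J : Set V}

theorem ncard_neighborSet_pos {x y : V} (h : G.Adj x y) : 0 < (G.neighborSet x).ncard :=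
  (Set.ncard_pos (Set.toFinite _)).2 ⟨y, h⟩

theorem callProb_pos {x y : V} (h : G.Adj x y) : 0 < callProb G x y := by
  have := ncard_neighborSet_pos h
  rw [callProb, if_pos h]
  positivity

theorem sum_callProb (G : SimpleGraph V) {x : V} (hx : (G.neighborSet x).Nonempty) :
    ∑ y, callProb G x y = 1 := by
  classical
  have h0 : 0 < (G.neighborSet x).ncard := (Set.ncard_pos (Set.toFinite _)).2 hx
  have : (Finset.univ.filter fun y => G.Adj x y).card = (G.neighborSet x).ncard := by
    rw [← Set.ncard_coe_finset]; congr; ext; simp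
  simp only [callProb]
  rw [← Finset.sum_filter, Finset.sum_const, this, nsmul_eq_mul, mul_inv_cancel₀]
  exact_mod_cast h0.ne'

open Classical in
/-- The rate of first-passage percolation along the edge `e`, the rate at which one of its ends
calls the other one. -/
noncomputable def edgeRate (G : SimpleGraph V) (e : V × V) : ℝ :=
  if G.Adj e.1 e.2 then callProb G e.1 e.2 + callProb G e.2 e.1 else 1

theorem edgeRate_pos (G : SimpleGraph V) (e : V × V) : 0 < edgeRate G e := by
  unfold edgeRate
  split_ifs with h
  · exact add_pos (callProb_pos h) (callProb_pos h.symm)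
  · exact one_pos

instance isProbabilityMeasure_exp_edgeRate (G : SimpleGraph V) (e : V × V) :
    IsProbabilityMeasure (expMeasure (edgeRate G e)) :=
  isProbabilityMeasure_expMeasure (edgeRate_pos G e)

/-- Independent exponential passage times. -/
noncomputable def fppLaw (G : SimpleGraph V) : Measure (V × V → ℝ) :=
  Measure.infinitePi fun e => expMeasure (edgeRate G e)

instance (G : SimpleGraph V) : IsProbabilityMeasure (fppLaw G) := by
  unfold fppLaw; infer_instance

/-- The probability that first-passage percolation from `I` covers the graph by time `t`. -/
noncomputable def coverProb (G : SimpleGraph V) (I : Set V) (t : ℝ) : ℝ≥0∞ :=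
  fppLaw G {w | Covers G w I t}

theorem coverProb_mono (G : SimpleGraph V) (I : Set V) : Monotone (coverProb G I) :=
  fun _ _ h => measure_mono fun _ hw => Covers.mono hw h

theorem coverProb_univ {t : ℝ} (ht : 0 ≤ t) : coverProb G Set.univ t = 1 := by
  simp [coverProb, covers_univ ht]

/-- The edges of `B` all survive time `u` with probability exponential in their total rate, and
given this their residual passage times are fresh. -/
theorem fppLaw_shiftOn (G : SimpleGraph V) (B : Finset (V × V)) {u : ℝ} (hu : 0 ≤ u)
    {A : Set (V × V → ℝ)} (hA : MeasurableSet A) :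
    fppLaw G {w | (∀ e ∈ B, u < w e) ∧ shiftOn B u w ∈ A} =
      ENNReal.ofReal (Real.exp (-((∑ e ∈ B, edgeRate G e) * u))) * fppLaw G A := by
  have h := lintegral_infinitePi_shiftOn (fun e => expMeasure (edgeRate G e)) B u
    (fun e => ENNReal.ofReal (Real.exp (-(edgeRate G e * u))))
    (fun e => (ENNReal.ofReal_pos.2 (Real.exp_pos _)).ne') (fun e => ENNReal.ofReal_ne_top)
    (fun e _ s hs => expMeasure_memoryless hu hs) (measurable_one.indicator hA)
  rw [lintegral_indicator_one hA, ← ENNReal.ofReal_prod_of_nonneg fun _ _ => (Real.exp_pos _).le,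
    ← Real.exp_sum, Finset.sum_neg_distrib, ← Finset.sum_mul] at h
  rw [fppLaw, ← h, ← lintegral_indicator (measurableSet_forall_lt B u)]
  have hm : MeasurableSet {w : V × V → ℝ | (∀ e ∈ B, u < w e) ∧ shiftOn B u w ∈ A} :=
    (measurableSet_forall_lt B u).inter (measurable_shiftOn_right B u hA)
  rw [← lintegral_indicator_one hm]
  congr 1
  ext w
  classical
  have h1 : w ∈ {w | (∀ e ∈ B, u < w e) ∧ shiftOn B u w ∈ A} ↔
    (∀ e ∈ B, u < w e) ∧ shiftOn B u w ∈ A := Iff.rfl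
  have h2 : w ∈ {w | ∀ e ∈ B, u < w e} ↔ ∀ e ∈ B, u < w e := Iff.rfl
  simp only [Set.indicator_apply, h1, h2, Pi.one_apply, ite_and]

/-- The event that the edge `e` has the least passage time among the edges leaving `I`, at most
`u`, and the percolation restarted at that time covers the graph by time `t`. -/
def firstEdgeEvent (G : SimpleGraph V) (I : Set V) (t u : ℝ) (e : V × V)
    (B : Finset (V × V)) : Set (V × V → ℝ) :=
  {w | (0 < w e ∧ w e ≤ u) ∧ (∀ e' ∈ B, w e < w e') ∧
    Covers G (shiftOn B (w e) w) (insert e.2 I) (t - w e)}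

theorem measurableSet_firstEdgeEvent (G : SimpleGraph V) (I : Set V) (t u : ℝ) (e : V × V)
    (B : Finset (V × V)) : MeasurableSet (firstEdgeEvent G I t u e B) := by
  have h1 : MeasurableSet {w : V × V → ℝ | 0 < w e ∧ w e ≤ u} :=
    (measurableSet_lt measurable_const (measurable_pi_apply e)).inter
      (measurableSet_le (measurable_pi_apply e) measurable_const)
  have h2 : MeasurableSet {w : V × V → ℝ | ∀ e' ∈ B, w e < w e'} := by
    simp only [Set.ofPred_forall]
    exact .biInter B.countable_toSet fun e' _ =>
      measurableSet_lt (measurable_pi_apply e) (measurable_pi_apply e')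
  have h3 : Measurable fun w : V × V → ℝ => (t - w e, shiftOn B (w e) w) :=
    (measurable_const.sub (measurable_pi_apply e)).prodMk
      ((measurable_shiftOn B).comp (g := fun p : ℝ × (V × V → ℝ) => shiftOn B p.1 p.2)
        (f := fun w : V × V → ℝ => (w e, w)) ((measurable_pi_apply e).prodMk measurable_id))
  exact h1.inter (h2.inter (h3 (measurableSet_covers G (insert e.2 I))))

-- Condition on `w e = s`. The density of `w e` contributes `r * exp (-r s)` with `r` the rate of
-- `e`, the survival of `B` contributes the exponential of its total rate, and the residual times on
-- `B` are fresh. The frozen value `w e` has no further influence, since `e` points into the new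
-- starting set.
open Classical in
theorem fppLaw_firstEdgeEvent (G : SimpleGraph V) (I : Set V) (t u : ℝ) (e : V × V)
    {B : Finset (V × V)} (he : e ∉ B) :
    fppLaw G (firstEdgeEvent G I t u e B) =
      ∫⁻ s in Set.Ioc 0 u, ENNReal.ofReal (Real.exp (-((∑ e' ∈ insert e B, edgeRate G e') * s))) *
        (ENNReal.ofReal (edgeRate G e) * coverProb G (insert e.2 I) (t - s)) := by
  classical
  have hm := measurableSet_firstEdgeEvent G I t u e B
  set Λ := ∑ e' ∈ B, edgeRate G e' with hΛ
  set h : ℝ → ℝ≥0∞ := fun s => (Set.Ioc 0 u).indicator (fun s => ENNReal.ofReal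
    (Real.exp (-(Λ * s))) * coverProb G (insert e.2 I) (t - s)) s with hh
  have hhm : Measurable h := by
    refine Measurable.indicator (.mul (by fun_prop) ?_) measurableSet_Ioc
    exact (coverProb_mono G _).measurable.comp (by fun_prop)
  have key (f : V × V → ℝ) : ∫⁻ g, (firstEdgeEvent G I t u e B).indicator 1
      (({e} : Set (V × V)).piecewise f g) ∂(fppLaw G) = h (f e) := by
    have hpe (g : V × V → ℝ) : ({e} : Set (V × V)).piecewise f g e = f e := by
      simp [Set.piecewise]
    have hpB (g : V × V → ℝ) : ∀ e', e' ≠ e → ({e} : Set (V × V)).piecewise f g e' = g e' := by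
      intro e' h'; simp [Set.piecewise, h']
    by_cases hs : f e ∈ Set.Ioc 0 u
    · have hset (g : V × V → ℝ) : ({e} : Set (V × V)).piecewise f g ∈
          firstEdgeEvent G I t u e B ↔ g ∈ {g | (∀ e' ∈ B, f e < g e') ∧ shiftOn B (f e) g ∈
            {w | Covers G w (insert e.2 I) (t - f e)}} := by
        simp only [firstEdgeEvent, Set.mem_ofPred_eq, hpe]
        have h1 : (∀ e' ∈ B, f e < ({e} : Set (V × V)).piecewise f g e') ↔
            ∀ e' ∈ B, f e < g e' :=
          forall₂_congr fun e' he' => by rw [hpB g e' (ne_of_mem_of_not_mem he' he)]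
        have h2 : ∀ e' : V × V, e'.2 ∉ insert e.2 I →
            shiftOn B (f e) (({e} : Set (V × V)).piecewise f g) e' = shiftOn B (f e) g e' := by
          intro e' he'
          have : e' ≠ e := by rintro rfl; exact he' (Set.mem_insert _ _)
          unfold shiftOn
          rw [hpB g e' this]
        rw [h1]
        have h3 : Covers G (shiftOn B (f e) (({e} : Set (V × V)).piecewise f g)) (insert e.2 I)
            (t - f e) ↔ Covers G (shiftOn B (f e) g) (insert e.2 I) (t - f e) :=
          ⟨fun h => h.congr h2, fun h => h.congr fun e' he' => (h2 e' he').symm⟩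
        rw [h3]
        exact ⟨fun h => h.2, fun h => ⟨hs, h⟩⟩
      have hA := measurableSet_covers_right G (insert e.2 I) (t - f e)
      have hm' : MeasurableSet {g : V × V → ℝ | (∀ e' ∈ B, f e < g e') ∧ shiftOn B (f e) g ∈
            {w | Covers G w (insert e.2 I) (t - f e)}} :=
        (measurableSet_forall_lt B (f e)).inter (measurable_shiftOn_right B (f e) hA)
      have : ∀ g, (firstEdgeEvent G I t u e B).indicator (1 : (V × V → ℝ) → ℝ≥0∞)
          (({e} : Set (V × V)).piecewise f g) = Set.indicator {g | (∀ e' ∈ B, f e < g e') ∧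
            shiftOn B (f e) g ∈ {w | Covers G w (insert e.2 I) (t - f e)}} 1 g := by
        intro g
        simp only [Set.indicator_apply, hset g, Pi.one_apply]
      simp only [this]
      rw [lintegral_indicator_one hm', fppLaw_shiftOn G B hs.1.le hA, hh]
      simp only [Set.indicator_of_mem hs, ← hΛ]
      rfl
    · have : ∀ g, (firstEdgeEvent G I t u e B).indicator (1 : (V × V → ℝ) → ℝ≥0∞)
          (({e} : Set (V × V)).piecewise f g) = 0 := by
        intro g
        refine Set.indicator_of_notMem (fun hmem => hs ?_) _
        have := hmem.1
        rwa [hpe g] at this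
      simp only [this, lintegral_zero, hh, Set.indicator_of_notMem hs]
  rw [← lintegral_indicator_one hm, fppLaw,
    lintegral_infinitePi_piecewise _ {e} (measurable_one.indicator hm)]
  change ∫⁻ f, ∫⁻ g, _ ∂(fppLaw G) ∂_ = _
  have hev : ∫⁻ f, h (f e) ∂(Measure.infinitePi fun e => expMeasure (edgeRate G e)) =
      ∫⁻ s, h s ∂(expMeasure (edgeRate G e)) := by
    rw [← Measure.infinitePi_map_eval (fun e => expMeasure (edgeRate G e)) e,
      lintegral_map hhm (measurable_pi_apply e)]
  refine (lintegral_congr fun f => ?_).trans (hev.trans ?_)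
  · rw [← key f]
    congr!
  rw [lintegral_expMeasure h hhm, ← lintegral_indicator measurableSet_Ioi,
    ← lintegral_indicator measurableSet_Ioc]
  refine lintegral_congr fun s => ?_
  by_cases hs : s ∈ Set.Ioc 0 u
  · rw [Set.indicator_of_mem hs, Set.indicator_of_mem (show s ∈ Set.Ioi 0 from hs.1), hh]
    simp only [Set.indicator_of_mem hs]
    rw [Finset.sum_insert he, ← hΛ, ENNReal.ofReal_mul (edgeRate_pos G e).le, ← mul_assoc,
      ← mul_assoc]
    congr 1
    rw [mul_assoc, ← ENNReal.ofReal_mul (Real.exp_pos _).le, ← Real.exp_add, mul_comm]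
    congr 3
    ring
  · rw [Set.indicator_of_notMem hs, hh]
    refine Set.indicator_apply_eq_zero.2 fun _ => ?_
    simp only [Set.indicator_of_notMem hs, mul_zero]

/-- The total rate at which first-passage percolation leaves `I`. -/
noncomputable def outRate (G : SimpleGraph V) (I : Set V) : ℝ :=
  ∑ e ∈ outEdges G I I, edgeRate G e

/-- Decomposition according to the first edge leaving `I` that is passed, if it is passed by
time `u`. -/
theorem coverProb_ge (G : SimpleGraph V) (I : Set V) {t u : ℝ} (hu : 0 ≤ u) :
    ENNReal.ofReal (Real.exp (-(outRate G I * u))) * coverProb G I (t - u) +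
      ∫⁻ s in Set.Ioc 0 u, ENNReal.ofReal (Real.exp (-(outRate G I * s))) *
        ∑ e ∈ outEdges G I I, ENNReal.ofReal (edgeRate G e) * coverProb G (insert e.2 I) (t - s)
      ≤ coverProb G I t := by
  classical
  set B := outEdges G I I with hB
  set E0 : Set (V × V → ℝ) := {w | (∀ e ∈ B, u < w e) ∧ shiftOn B u w ∈
    {w | Covers G w I (t - u)}} with hE0
  have hm0 : MeasurableSet E0 := (measurableSet_forall_lt B u).inter
    (measurable_shiftOn_right B u (measurableSet_covers_right G I (t - u)))
  set E := fun e => firstEdgeEvent G I t u e (B.erase e) with hE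
  have hmE : ∀ e, MeasurableSet (E e) := fun e => measurableSet_firstEdgeEvent G I t u e _
  have hPE : ∀ e ∈ B, fppLaw G (E e) = ∫⁻ s in Set.Ioc 0 u,
      ENNReal.ofReal (Real.exp (-(outRate G I * s))) *
        (ENNReal.ofReal (edgeRate G e) * coverProb G (insert e.2 I) (t - s)) := by
    intro e he
    rw [hE]
    simp only
    rw [fppLaw_firstEdgeEvent G I t u e (Finset.notMem_erase e B), Finset.insert_erase he]
    rfl
  have h0 : fppLaw G E0 = ENNReal.ofReal (Real.exp (-(outRate G I * u))) *
      coverProb G I (t - u) := fppLaw_shiftOn G B hu (measurableSet_covers_right G I (t - u))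
  have hdisj : ∀ e ∈ B, ∀ e' ∈ B, e ≠ e' → Disjoint (E e) (E e') := by
    intro e he e' he' hne
    refine Set.disjoint_left.2 fun w hw hw' => ?_
    have h1 := hw.2.1 e' (Finset.mem_erase.2 ⟨hne.symm, he'⟩)
    have h2 := hw'.2.1 e (Finset.mem_erase.2 ⟨hne, he⟩)
    exact lt_asymm h1 h2
  have hdisj0 : Disjoint E0 (⋃ e ∈ B, E e) := by
    refine Set.disjoint_left.2 fun w hw hw' => ?_
    obtain ⟨e, he, hwe⟩ := Set.mem_iUnion₂.1 hw'
    exact absurd hwe.1.2 (not_le.2 (hw.1 e he))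
  have hsub : E0 ∪ (⋃ e ∈ B, E e) ⊆ {w | Covers G w I t} := by
    rintro w (hw | hw)
    · exact Covers.of_shiftOn hu (fun y hy hy' => absurd hy hy') hw.2
    · obtain ⟨e, he, ⟨hw0, hwu⟩, hlt, hcov⟩ := Set.mem_iUnion₂.1 hw
      obtain ⟨he1, he2, hadj⟩ := mem_outEdges.1 he
      -- The event shifts only the edges other than `e`, whereas the restart shifts all of them. The
      -- difference concerns `e` alone, which ends in the new starting set and is irrelevant.
      refine Covers.of_shiftOn (J := insert e.2 I) hw0.le ?_ (hcov.congr ?_)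
      · intro y hy hyI
        rcases hy with rfl | hy
        · exact ⟨e.1, he1, hadj, hw0.le, le_rfl⟩
        · exact absurd hy hyI
      · intro e' he'
        have hne : e' ≠ e := by rintro rfl; exact he' (Set.mem_insert _ _)
        simp only [shiftOn, Finset.mem_erase, hne, ne_eq, not_false_eq_true, true_and, ← hB]
  calc _ = fppLaw G E0 + ∑ e ∈ B, fppLaw G (E e) := by
        rw [h0, Finset.sum_congr rfl hPE]
        congr 1
        rw [← lintegral_finsetSum]
        · refine lintegral_congr fun s => ?_
          rw [Finset.mul_sum]
        · intro e _
          refine .mul (by fun_prop) (.const_mul ?_ _)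
          exact (coverProb_mono G _).measurable.comp (by fun_prop)
    _ = fppLaw G (E0 ∪ ⋃ e ∈ B, E e) := by
        rw [measure_union hdisj0 (.biUnion B.countable_toSet fun e _ => hmE e),
          measure_biUnion_finset (fun e he e' he' hne => hdisj e he e' he' hne) fun e _ => hmE e]
    _ ≤ coverProb G I t := measure_mono hsub

/-- The probability of covering by `rounded` passage times. -/
noncomputable def roundedProb (G : SimpleGraph V) (R : ℝ) (I : Set V) (t : ℝ) : ℝ≥0∞ :=
  fppLaw G {w | Covers G (rounded R w) I t}

/-- The event splits into a survival event for edges ending outside `J` and an event about edges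
ending inside `J`. The two are independent, and only the first interacts with the future of the
percolation. -/
theorem enlarge_eq_iff {R : ℝ} {w : V × V → ℝ} : enlarge G R I w = J ↔
    (∀ e ∈ outEdges G I J, R < w e) ∧
      (I ⊆ J ∧ ∀ y ∈ J, y ∉ I → ∃ x ∈ I, G.Adj x y ∧ w (x, y) ≤ R) := by
  constructor
  · rintro rfl
    refine ⟨fun e he => ?_, subset_enlarge R, fun y hy hyI => hy.resolve_left hyI⟩
    obtain ⟨h1, h2, h3⟩ := mem_outEdges.1 he
    exact not_le.1 fun hle => h2 (Or.inr ⟨e.1, h1, h3, hle⟩)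
  · rintro ⟨h1, h2, h3⟩
    ext y
    constructor
    · rintro (hy | ⟨x, hx, hadj, hle⟩)
      · exact h2 hy
      · by_contra hy
        exact absurd hle (not_le.2 (h1 (x, y) (mem_outEdges.2 ⟨hx, hy, hadj⟩)))
    · intro hy
      by_cases hyI : y ∈ I
      · exact Or.inl hyI
      · exact Or.inr (h3 y hy hyI)

theorem measurableSet_joined (G : SimpleGraph V) (R : ℝ) (I J : Set V) :
    MeasurableSet {w : V × V → ℝ |
      I ⊆ J ∧ ∀ y ∈ J, y ∉ I → ∃ x ∈ I, G.Adj x y ∧ w (x, y) ≤ R} := by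
  have : {w : V × V → ℝ | ∀ y ∈ J, y ∉ I → ∃ x ∈ I, G.Adj x y ∧ w (x, y) ≤ R} =
      ⋂ y ∈ J \ I, ⋃ x ∈ {x | x ∈ I ∧ G.Adj x y}, {w | w (x, y) ≤ R} := by
    ext; simp [and_assoc]
  refine MeasurableSet.inter (s₁ := {_w | I ⊆ J})
    (s₂ := {w : V × V → ℝ | ∀ y ∈ J, y ∉ I → ∃ x ∈ I, G.Adj x y ∧ w (x, y) ≤ R}) (.const _) ?_
  rw [this]
  refine .biInter (Set.to_countable _) fun y _ => .biUnion (Set.to_countable _) fun x _ => ?_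
  exact measurableSet_le (measurable_pi_apply _) measurable_const

theorem measurableSet_enlarge_eq (G : SimpleGraph V) (R : ℝ) (I J : Set V) :
    MeasurableSet {w | enlarge G R I w = J} := by
  simp only [enlarge_eq_iff]
  exact (measurableSet_forall_lt _ R).inter (measurableSet_joined G R I J)

/-- The Markov property at the end of a window. Rounding makes it clean: vertices joined during the
window start passing on the rumour only at its end, so their outgoing edges are untouched, while the
surviving edges out of `I` are refreshed by memorylessness. -/
theorem roundedProb_succ_le (G : SimpleGraph V) {R : ℝ} (hR : 0 < R) (I : Set V) {t : ℝ}
    (ht : 0 ≤ t) : roundedProb G R I (t + 1) ≤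
      ∑ J : Set V, fppLaw G {w | enlarge G R I w = J} * roundedProb G R J t := by
  classical
  have hcov : {w | Covers G (rounded R w) I (t + 1)} ⊆ ⋃ J ∈ (Finset.univ : Finset (Set V)),
      ({w | Covers G (rounded R w) I (t + 1)} ∩ {w | enlarge G R I w = J}) := by
    intro w hw
    simp only [Finset.mem_univ, Set.iUnion_true, Set.mem_iUnion]
    exact ⟨_, hw, rfl⟩
  refine ((measure_mono hcov).trans (measure_biUnion_finset_le _ _)).trans
    (Finset.sum_le_sum fun J _ => ?_)
  set B := outEdges G I J with hB
  set A1 : Set (V × V → ℝ) := {w | I ⊆ J ∧ ∀ y ∈ J, y ∉ I → ∃ x ∈ I, G.Adj x y ∧ w (x, y) ≤ R}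
  set A3 : Set (V × V → ℝ) := {w | Covers G (rounded R w) J t}
  have hA1 : MeasurableSet A1 := measurableSet_joined G R I J
  have hA3 : MeasurableSet A3 := measurable_rounded R (measurableSet_covers_right G J t)
  have hA1S : ∀ ω ω' : V × V → ℝ, (∀ e ∈ {e : V × V | e.2 ∈ J}, ω e = ω' e) → ω ∈ A1 → ω' ∈ A1 := by
    intro ω ω' h hω
    refine ⟨hω.1, fun y hy hyI => ?_⟩
    obtain ⟨x, hx, hadj, hle⟩ := hω.2 y hy hyI
    exact ⟨x, hx, hadj, (h (x, y) hy).symm.trans_le hle⟩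
  have hA3S : ∀ ω ω' : V × V → ℝ, (∀ e ∉ {e : V × V | e.2 ∈ J}, ω e = ω' e) → ω ∈ A3 → ω' ∈ A3 := by
    intro ω ω' h hω
    exact Covers.congr hω fun e he => by simp only [rounded, h e he]
  -- The shifted edges end outside `J`, so the shift does not affect `A1`.
  have hshift : ∀ w : V × V → ℝ, ∀ e ∈ {e : V × V | e.2 ∈ J}, w e = shiftOn B R w e := by
    intro w e he
    have : e ∉ B := fun h => (mem_outEdges.1 h).2.1 he
    simp [shiftOn, this]
  have h1 : fppLaw G {w | enlarge G R I w = J} = ENNReal.ofReal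
      (Real.exp (-((∑ e ∈ B, edgeRate G e) * R))) * fppLaw G A1 := by
    rw [← fppLaw_shiftOn G B hR.le hA1]
    congr 1
    ext w
    refine enlarge_eq_iff.trans (and_congr_right fun _ => ?_)
    exact ⟨hA1S w _ (hshift w), hA1S _ w fun e he => (hshift w e he).symm⟩
  have h2 : fppLaw G (A1 ∩ A3) = fppLaw G A1 * roundedProb G R J t :=
    infinitePi_inter _ {e : V × V | e.2 ∈ J} hA1 hA3 hA1S hA3S
  rw [h1, mul_assoc, ← h2, ← fppLaw_shiftOn G B hR.le (hA1.inter hA3)]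
  refine measure_mono ?_
  rintro w ⟨hw, rfl⟩
  obtain ⟨h3, h4⟩ := (enlarge_eq_iff (G := G) (I := I) (R := R) (w := w)).1 rfl
  exact ⟨h3, hA1S w _ (hshift w) h4, Covers.rounded_shiftOn hR ht hw⟩

end Law

/-! ### Averaging over an independent exponential time -/

section Averaging

theorem setLIntegral_exp_Ioc {c : ℝ} (hc : 0 ≤ c) {s t : ℝ} (hst : s ≤ t) :
    ∫⁻ u in Set.Ioc s t, ENNReal.ofReal (c * Real.exp (-(c * u))) =
      ENNReal.ofReal (Real.exp (-(c * s)) - Real.exp (-(c * t))) := by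
  rw [← ofReal_integral_eq_lintegral_ofReal]
  · rw [← intervalIntegral.integral_of_le hst]
    congr 1
    have hd : ∀ u ∈ Set.uIcc s t, HasDerivAt (fun u => -Real.exp (-(c * u)))
        (c * Real.exp (-(c * u))) u := by
      intro u _
      have h1 : HasDerivAt (fun u : ℝ => -(c * u)) (-(c * 1)) u :=
        ((hasDerivAt_id u).const_mul c).neg
      convert! h1.exp.neg using 1
      ring
    rw [intervalIntegral.integral_eq_sub_of_hasDerivAt hd
      (Continuous.intervalIntegrable (by fun_prop) _ _)]
    ring
  · exact (Continuous.integrableOn_Icc (by fun_prop)).mono_set Set.Ioc_subset_Icc_self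
  · exact Filter.Eventually.of_forall fun u => by positivity

/-- The hypothesis is averaged over `u` distributed as the minimum of `t` and an exponential time of
rate `c`. In the application `c` is the rate of idle calls: a bound obtained by observing the
process at a fixed time `u` becomes one obtained by observing it at the first call, idle or not. -/
theorem lintegral_exp_add_le {X : ℝ≥0∞} {f ψ : ℝ → ℝ≥0∞} (hf : Measurable f)
    (hψ : Measurable ψ) {Λ c t : ℝ} (hc : 0 ≤ c) (ht : 0 ≤ t)
    (h : ∀ u, 0 ≤ u → u ≤ t → ENNReal.ofReal (Real.exp (-(Λ * u))) * f u +
      ∫⁻ s in Set.Ioc 0 u, ENNReal.ofReal (Real.exp (-(Λ * s))) * ψ s ≤ X) :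
    ∫⁻ s in Set.Ioc 0 t, ENNReal.ofReal (Real.exp (-((Λ + c) * s))) *
      (ENNReal.ofReal c * f s + ψ s) ≤ X := by
  set ρ : ℝ → ℝ≥0∞ := fun u => ENNReal.ofReal (c * Real.exp (-(c * u))) with hρ
  set g : ℝ → ℝ≥0∞ := fun s => ENNReal.ofReal (Real.exp (-(Λ * s))) * ψ s with hg
  have hρm : Measurable ρ := by fun_prop
  have hgm : Measurable g := by fun_prop
  -- The averaging law has density `ρ` on `(0, t]` and an atom of mass `exp (-c t)` at `t`.
  have hone : (∫⁻ u in Set.Ioc 0 t, ρ u) + ENNReal.ofReal (Real.exp (-(c * t))) = 1 := by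
    rw [setLIntegral_exp_Ioc hc ht, ← ENNReal.ofReal_add _ (Real.exp_pos _).le]
    · simp
    · rw [sub_nonneg]
      exact Real.exp_le_exp.2 (by nlinarith [mul_nonneg hc ht])
  have hswap : ∫⁻ u in Set.Ioc 0 t, ρ u * ∫⁻ s in Set.Ioc 0 u, g s =
      ∫⁻ s in Set.Ioc 0 t, g s * ENNReal.ofReal (Real.exp (-(c * s)) - Real.exp (-(c * t))) := by
    have hD : MeasurableSet {p : ℝ × ℝ | 0 < p.2 ∧ p.2 ≤ p.1 ∧ p.1 ≤ t} :=
      (measurableSet_lt measurable_const measurable_snd).inter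
        ((measurableSet_le measurable_snd measurable_fst).inter
          (measurableSet_le measurable_fst measurable_const))
    classical
    have hmem (a b : ℝ) : ((a, b) ∈ {p : ℝ × ℝ | 0 < p.2 ∧ p.2 ≤ p.1 ∧ p.1 ≤ t}) ↔
      0 < b ∧ b ≤ a ∧ a ≤ t := Iff.rfl
    set K : ℝ × ℝ → ℝ≥0∞ := Set.indicator {p : ℝ × ℝ | 0 < p.2 ∧ p.2 ≤ p.1 ∧ p.1 ≤ t}
      (fun p => ρ p.1 * g p.2) with hK
    have hKm : Measurable K :=
      ((hρm.comp measurable_fst).mul (hgm.comp measurable_snd)).indicator hD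
    have h1 : ∫⁻ u in Set.Ioc 0 t, ρ u * ∫⁻ s in Set.Ioc 0 u, g s = ∫⁻ u, ∫⁻ s, K (u, s) := by
      rw [← lintegral_indicator measurableSet_Ioc]
      refine lintegral_congr fun u => ?_
      by_cases hu : u ∈ Set.Ioc 0 t
      · rw [Set.indicator_of_mem hu, ← lintegral_indicator measurableSet_Ioc,
          ← lintegral_const_mul _ (hgm.indicator measurableSet_Ioc)]
        refine lintegral_congr fun s => ?_
        simp only [hK, Set.indicator_apply, hmem, Set.mem_Ioc, hu.2, and_true]
        split_ifs <;> simp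
      · rw [Set.indicator_of_notMem hu]
        symm
        refine (lintegral_congr fun s => ?_).trans lintegral_zero
        refine Set.indicator_of_notMem (fun hh => hu ?_) _
        rw [hmem] at hh
        exact ⟨by linarith, hh.2.2⟩
    rw [h1, lintegral_lintegral_swap (f := fun u s => K (u, s)) hKm.aemeasurable, ← lintegral_indicator measurableSet_Ioc]
    refine lintegral_congr fun s => ?_
    by_cases hs : s ∈ Set.Ioc 0 t
    · rw [Set.indicator_of_mem hs, ← setLIntegral_exp_Ioc hc hs.2,
        ← lintegral_const_mul _ (by fun_prop), ← lintegral_indicator measurableSet_Ioc]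
      refine lintegral_congr_ae ?_
      have : ∀ᵐ x : ℝ, x ≠ s := by simp [ae_iff]
      filter_upwards [this] with u hu
      simp only [hK, Set.indicator_apply, hmem, Set.mem_Ioc, hs.1, true_and]
      have : s ≤ u ↔ s < u := ⟨fun h => lt_of_le_of_ne h hu.symm, le_of_lt⟩
      simp only [this]
      split_ifs
      · rw [mul_comm]
      · rfl
    · rw [Set.indicator_of_notMem hs]
      refine (lintegral_congr fun u => ?_).trans lintegral_zero
      refine Set.indicator_of_notMem (fun hh => hs ?_) _
      rw [hmem] at hh
      exact ⟨hh.1, hh.2.1.trans hh.2.2⟩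
  have hF : Measurable fun u => ∫⁻ s in Set.Ioc 0 u, g s := by
    refine Monotone.measurable fun a b hab => ?_
    exact lintegral_mono_set (Set.Ioc_subset_Ioc_right hab)
  calc _ = (∫⁻ u in Set.Ioc 0 t, ρ u * (ENNReal.ofReal (Real.exp (-(Λ * u))) * f u)) +
        ((∫⁻ u in Set.Ioc 0 t, ρ u * ∫⁻ s in Set.Ioc 0 u, g s) +
          ENNReal.ofReal (Real.exp (-(c * t))) * ∫⁻ s in Set.Ioc 0 t, g s) := by
        rw [hswap, ← lintegral_const_mul _ hgm, ← lintegral_add_left (by fun_prop),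
          ← lintegral_add_left (by fun_prop)]
        refine setLIntegral_congr_fun measurableSet_Ioc fun s hs => ?_
        have e1 : ENNReal.ofReal (Real.exp (-((Λ + c) * s))) = ENNReal.ofReal (Real.exp (-(c * s)))
            * ENNReal.ofReal (Real.exp (-(Λ * s))) := by
          rw [← ENNReal.ofReal_mul (Real.exp_pos _).le, ← Real.exp_add]
          congr 2; ring
        have e2 : ENNReal.ofReal (Real.exp (-(c * s)) - Real.exp (-(c * t))) +
            ENNReal.ofReal (Real.exp (-(c * t))) = ENNReal.ofReal (Real.exp (-(c * s))) := by
          rw [← ENNReal.ofReal_add _ (Real.exp_pos _).le]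
          · simp
          · rw [sub_nonneg]
            exact Real.exp_le_exp.2 (by nlinarith [mul_le_mul_of_nonneg_left hs.2 hc])
        simp only [hρ, hg]
        rw [mul_comm (ENNReal.ofReal (Real.exp (-(c * t)))), ← mul_add, e2, e1,
          ENNReal.ofReal_mul hc]
        ring
    _ ≤ (∫⁻ u in Set.Ioc 0 t, ρ u * X) + ENNReal.ofReal (Real.exp (-(c * t))) * X := by
        rw [← add_assoc, ← lintegral_add_left (by fun_prop)]
        gcongr ?_ + _ * ?_
        · refine setLIntegral_mono (by fun_prop) fun u hu => ?_
          rw [← mul_add]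
          gcongr
          exact h u hu.1.le hu.2
        -- At the atom the summand with `f` is discarded.
        · exact le_add_self.trans (h t ht le_rfl)
    _ = X := by
        rw [lintegral_mul_const _ hρm, ← add_mul, hone, one_mul]

end Averaging

/-! ### Calls, effective and idle -/

section Calls

variable {V : Type*}

open Classical in
/-- The informed set after a call of `x` to `y`. -/
def afterCall (I : Set V) (x y : V) : Set V :=
  if x ∈ I then insert y I else if y ∈ I then insert x I else I

theorem subset_afterCall (I : Set V) (x y : V) : I ⊆ afterCall I x y := by
  unfold afterCall
  split_ifs
  · exact Set.subset_insert _ _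
  · exact Set.subset_insert _ _
  · exact subset_rfl

variable [Fintype V] {G : SimpleGraph V}

open Classical in
/-- The total rate of the calls that are without effect when `I` is the informed set. -/
noncomputable def idleRate (G : SimpleGraph V) (I : Set V) : ℝ :=
  ∑ x, ∑ y, if (x ∈ I ↔ y ∈ I) then callProb G x y else 0

theorem idleRate_nonneg (G : SimpleGraph V) (I : Set V) : 0 ≤ idleRate G I :=
  Finset.sum_nonneg fun x _ => Finset.sum_nonneg fun y _ => by
    split_ifs
    exacts [callProb_nonneg G x y, le_rfl]

/-- A boundary edge is used by a push from its inner end or by a pull from its outer end, with the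
same effect, so the two call probabilities add up to the rate of the edge. All other calls leave `I`
unchanged. -/
theorem sum_calls (G : SimpleGraph V) (I : Set V) {φ : Set V → ℝ≥0∞} :
    ∑ x, ∑ y, ENNReal.ofReal (callProb G x y) * φ (afterCall I x y) =
      ∑ e ∈ outEdges G I I, ENNReal.ofReal (edgeRate G e) * φ (insert e.2 I) +
        ENNReal.ofReal (idleRate G I) * φ I := by
  classical
  have h1 : ∀ x y, ENNReal.ofReal (callProb G x y) * φ (afterCall I x y) =
      (if x ∈ I ∧ y ∉ I then ENNReal.ofReal (callProb G x y) * φ (insert y I) else 0) +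
      (if y ∈ I ∧ x ∉ I then ENNReal.ofReal (callProb G x y) * φ (insert x I) else 0) +
      (if (x ∈ I ↔ y ∈ I) then ENNReal.ofReal (callProb G x y) else 0) * φ I := by
    intro x y
    by_cases hx : x ∈ I <;> by_cases hy : y ∈ I <;> simp [afterCall, hx, hy]
  have h2 : ∑ e ∈ outEdges G I I, ENNReal.ofReal (edgeRate G e) * φ (insert e.2 I) =
      ∑ x, ∑ y, if x ∈ I ∧ y ∉ I then ENNReal.ofReal (callProb G x y) * φ (insert y I) +
        ENNReal.ofReal (callProb G y x) * φ (insert y I) else 0 := by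
    rw [outEdges, Finset.sum_filter, ← Finset.univ_product_univ, Finset.sum_product]
    refine Finset.sum_congr rfl fun x _ => Finset.sum_congr rfl fun y _ => ?_
    by_cases hx : x ∈ I <;> by_cases hy : y ∈ I <;> simp only [hx, hy, true_and, false_and,
      not_true_eq_false, not_false_eq_true, if_false, if_true]
    by_cases hadj : G.Adj x y
    · simp only [hadj, if_true, edgeRate]
      rw [ENNReal.ofReal_add (callProb_nonneg G x y) (callProb_nonneg G y x), add_mul]
    · simp [hadj, callProb_of_not_adj hadj, callProb_of_not_adj fun h => hadj (SimpleGraph.Adj.symm h)]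
  have h3 : ENNReal.ofReal (idleRate G I) =
      ∑ x, ∑ y, if (x ∈ I ↔ y ∈ I) then ENNReal.ofReal (callProb G x y) else 0 := by
    have hnn : ∀ x y, 0 ≤ if (x ∈ I ↔ y ∈ I) then callProb G x y else 0 := fun x y => by
      split_ifs
      exacts [callProb_nonneg G x y, le_rfl]
    rw [idleRate, ENNReal.ofReal_sum_of_nonneg fun x _ => Finset.sum_nonneg fun y _ => hnn x y]
    refine Finset.sum_congr rfl fun x _ => ?_
    rw [ENNReal.ofReal_sum_of_nonneg fun y _ => hnn x y]
    refine Finset.sum_congr rfl fun y _ => ?_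
    split_ifs <;> simp
  simp only [h1, Finset.sum_add_distrib]
  rw [Finset.sum_comm (f := fun x y => if y ∈ I ∧ x ∉ I then _ else _), h2, h3,
    ← Finset.sum_add_distrib, Finset.sum_mul]
  congr 1
  · refine Finset.sum_congr rfl fun x _ => ?_
    rw [← Finset.sum_add_distrib]
    refine Finset.sum_congr rfl fun y _ => ?_
    split_ifs <;> simp
  · exact Finset.sum_congr rfl fun x _ => (Finset.sum_mul _ _ _).symm

/-- Each vertex calls at total rate 1; this is `sum_calls` with a constant function. -/
theorem outRate_add_idleRate (hG : ∀ x, (G.neighborSet x).Nonempty) (I : Set V) :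
    outRate G I + idleRate G I = Fintype.card V := by
  have h := sum_calls G I (φ := fun _ => 1)
  simp only [mul_one] at h
  rw [← ENNReal.ofReal_sum_of_nonneg fun e _ => (edgeRate_pos G e).le, ← ENNReal.ofReal_add
    (Finset.sum_nonneg fun e _ => (edgeRate_pos G e).le) (idleRate_nonneg G I)] at h
  have h2 : ∀ x, ∑ y, ENNReal.ofReal (callProb G x y) = 1 := fun x => by
    rw [← ENNReal.ofReal_sum_of_nonneg fun y _ => callProb_nonneg G x y, sum_callProb G (hG x),
      ENNReal.ofReal_one]
  simp only [h2, Finset.sum_const, Finset.card_univ, nsmul_eq_mul, mul_one] at h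
  have h3 := congrArg ENNReal.toReal h
  rw [ENNReal.toReal_ofReal (add_nonneg (Finset.sum_nonneg fun e _ => (edgeRate_pos G e).le)
    (idleRate_nonneg G I))] at h3
  simpa [outRate] using h3.symm

/-- First-passage percolation dominates the percolation observed at the first call. -/
theorem coverProb_superharmonic (hG : ∀ x, (G.neighborSet x).Nonempty) (I : Set V) {t : ℝ}
    (ht : 0 ≤ t) :
    ∫⁻ s in Set.Ioc 0 t, ENNReal.ofReal (Real.exp (-((Fintype.card V : ℝ) * s))) *
      ∑ x, ∑ y, ENNReal.ofReal (callProb G x y) * coverProb G (afterCall I x y) (t - s) ≤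
        coverProb G I t := by
  have hm (J : Set V) : Measurable fun s => coverProb G J (t - s) :=
    (coverProb_mono G J).measurable.comp (by fun_prop)
  -- An idle call keeps `I` and only lets time pass, so `f` is the covering probability of `I`
  -- itself and the extra rate is `idleRate G I`.
  have := lintegral_exp_add_le (X := coverProb G I t) (f := fun s => coverProb G I (t - s))
    (ψ := fun s => ∑ e ∈ outEdges G I I, ENNReal.ofReal (edgeRate G e) *
      coverProb G (insert e.2 I) (t - s)) (hm I)
    (Finset.measurable_sum _ fun e _ => (hm _).const_mul _) (Λ := outRate G I)
    (idleRate_nonneg G I) ht (fun u hu _ => coverProb_ge G I hu)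
  rw [outRate_add_idleRate hG] at this
  refine le_trans (le_of_eq ?_) this
  refine lintegral_congr fun s => ?_
  rw [sum_calls G I (φ := fun J => coverProb G J (t - s)), add_comm]

end Calls

/-! ### The asynchronous protocol restarted at its first ring -/

section AsyncDeterministic

variable {V : Type*}

/-- The asynchronous protocol started from a set `I` of informed vertices. -/
inductive KnowsFrom (I : Set V) (ω : AsyncOutcome V) : V → ℝ → Prop
  | start (v : V) : v ∈ I → KnowsFrom I ω v 0
  | stay (x : V) (t t' : ℝ) : KnowsFrom I ω x t → t ≤ t' → KnowsFrom I ω x t'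
  | push (x : V) (k : ℕ) (t : ℝ) : KnowsFrom I ω x t → t < ringTime ω x k →
      KnowsFrom I ω (ω.2 (x, k)) (ringTime ω x k)
  | pull (x : V) (k : ℕ) (t : ℝ) : KnowsFrom I ω (ω.2 (x, k)) t → t < ringTime ω x k →
      KnowsFrom I ω x (ringTime ω x k)

variable {I : Set V} {ω : AsyncOutcome V} {s v : V} {t t' : ℝ}

theorem asyncKnows_iff : AsyncKnows s ω v t ↔ KnowsFrom {s} ω v t := by
  constructor
  · intro h
    induction h with
    | start => exact .start _ rfl
    | stay x t t' _ ht ih => exact .stay x t t' ih ht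
    | push x k t _ ht ih => exact .push x k t ih ht
    | pull x k t _ ht ih => exact .pull x k t ih ht
  · intro h
    induction h with
    | start v hv => rw [Set.mem_singleton_iff.1 hv]; exact .start
    | stay x t t' _ ht ih => exact .stay x t t' ih ht
    | push x k t _ ht ih => exact .push x k t ih ht
    | pull x k t _ ht ih => exact .pull x k t ih ht

theorem KnowsFrom.nonneg (h : KnowsFrom I ω v t) : 0 ≤ t := by
  induction h with
  | start v hv => exact le_rfl
  | stay x t t' _ ht ih => linarith
  | push x k t _ ht ih => linarith
  | pull x k t _ ht ih => linarith

/-- Everyone knows the rumour by time `t`. -/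
def InformedBy (I : Set V) (ω : AsyncOutcome V) (t : ℝ) : Prop := ∀ v, KnowsFrom I ω v t

theorem InformedBy.mono (h : InformedBy I ω t) (ht : t ≤ t') : InformedBy I ω t' :=
  fun v => .stay v t t' (h v) ht

/-- The rumour reaches `v` by time `t` through at most `m` calls. -/
def KnowsWithin (I : Set V) (ω : AsyncOutcome V) : ℕ → V → ℝ → Prop
  | 0, v, t => v ∈ I ∧ 0 ≤ t
  | m + 1, v, t => KnowsWithin I ω m v t ∨ ∃ (x : V) (k : ℕ) (q : ℚ), (q : ℝ) < ringTime ω x k ∧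
      ringTime ω x k ≤ t ∧ ((KnowsWithin I ω m x q ∧ ω.2 (x, k) = v) ∨
        (x = v ∧ ∃ y, ω.2 (x, k) = y ∧ KnowsWithin I ω m y q))

theorem KnowsWithin.mono {m : ℕ} (h : KnowsWithin I ω m v t) (ht : t ≤ t') :
    KnowsWithin I ω m v t' := by
  induction m generalizing t t' v with
  | zero => exact ⟨h.1, h.2.trans ht⟩
  | succ m ih =>
    rcases h with h | ⟨x, k, q, h1, h2, h3⟩
    · exact Or.inl (ih h ht)
    · exact Or.inr ⟨x, k, q, h1, h2.trans ht, h3⟩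

/-- The number of calls and a rational time strictly before each ring turn the inductive predicate
into a countable combination of measurable conditions. -/
theorem knowsFrom_iff : KnowsFrom I ω v t ↔ ∃ m, KnowsWithin I ω m v t := by
  constructor
  · intro h
    induction h with
    | start v hv => exact ⟨0, hv, le_rfl⟩
    | stay x t t' _ ht ih =>
      obtain ⟨m, hm⟩ := ih
      exact ⟨m, hm.mono ht⟩
    | push x k t _ ht ih =>
      obtain ⟨m, hm⟩ := ih
      obtain ⟨q, h1, h2⟩ := exists_rat_btwn ht
      exact ⟨m + 1, Or.inr ⟨x, k, q, h2, le_rfl, Or.inl ⟨hm.mono h1.le, rfl⟩⟩⟩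
    | pull x k t _ ht ih =>
      obtain ⟨m, hm⟩ := ih
      obtain ⟨q, h1, h2⟩ := exists_rat_btwn ht
      exact ⟨m + 1, Or.inr ⟨x, k, q, h2, le_rfl, Or.inr ⟨rfl, _, rfl, hm.mono h1.le⟩⟩⟩
  · rintro ⟨m, hm⟩
    induction m generalizing v t with
    | zero => exact .stay v 0 t (.start v hm.1) hm.2
    | succ m ih =>
      rcases hm with h | ⟨x, k, q, h1, h2, ⟨h3, rfl⟩ | ⟨rfl, y, rfl, h3⟩⟩
      · exact ih h
      · exact .stay _ _ _ (.push x k q (ih h3) h1) h2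
      · exact .stay _ _ _ (.pull x k q (ih h3) h1) h2

theorem measurable_ringTime [MeasurableSpace V] (x : V) (k : ℕ) :
    Measurable fun ω : AsyncOutcome V => ringTime ω x k := by
  unfold ringTime
  exact Finset.measurable_sum _ fun j _ => (measurable_pi_apply (x, j)).comp measurable_fst

theorem measurableSet_knowsFrom [Countable V] [MeasurableSpace V] [MeasurableSingletonClass V]
    (I : Set V) (v : V) :
    MeasurableSet {p : ℝ × AsyncOutcome V | KnowsFrom I p.2 v p.1} := by
  have key : ∀ m v, MeasurableSet {p : ℝ × AsyncOutcome V | KnowsWithin I p.2 m v p.1} := by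
    intro m
    induction m with
    | zero =>
      intro v
      exact MeasurableSet.inter (s₁ := {_p : ℝ × AsyncOutcome V | v ∈ I})
        (s₂ := {p : ℝ × AsyncOutcome V | 0 ≤ p.1}) (.const _)
          (measurableSet_le measurable_const measurable_fst)
    | succ m ih =>
      intro v
      have ih' (x : V) (q : ℝ) : MeasurableSet {p : ℝ × AsyncOutcome V | KnowsWithin I p.2 m x q} :=
        (measurable_const.prodMk measurable_snd :
          Measurable fun p : ℝ × AsyncOutcome V => (q, p.2)) (ih x)
      have hc (x y : V) (k : ℕ) : MeasurableSet {p : ℝ × AsyncOutcome V | p.2.2 (x, k) = y} :=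
        ((measurable_pi_apply (x, k)).comp (measurable_snd.comp measurable_snd) :
          Measurable fun p : ℝ × AsyncOutcome V => p.2.2 (x, k)) (measurableSet_singleton y)
      have hr (x : V) (k : ℕ) : Measurable fun p : ℝ × AsyncOutcome V => ringTime p.2 x k :=
        (measurable_ringTime x k).comp measurable_snd
      have : {p : ℝ × AsyncOutcome V | KnowsWithin I p.2 (m + 1) v p.1} =
          {p | KnowsWithin I p.2 m v p.1} ∪ ⋃ (x : V) (k : ℕ) (q : ℚ),
            {p | (q : ℝ) < ringTime p.2 x k} ∩ ({p | ringTime p.2 x k ≤ p.1} ∩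
              (({p | KnowsWithin I p.2 m x q} ∩ {p | p.2.2 (x, k) = v}) ∪
                ({_p | x = v} ∩ ⋃ y, ({p | p.2.2 (x, k) = y} ∩ {p | KnowsWithin I p.2 m y q})))) := by
        ext p
        simp [KnowsWithin]
      rw [this]
      refine (ih v).union (.iUnion fun x => .iUnion fun k => .iUnion fun q => .inter ?_
        (.inter ?_ (.union ((ih' x q).inter (hc x v k)) (.inter (.const _)
          (.iUnion fun y => (hc x y k).inter (ih' y q))))))
      · exact measurableSet_lt measurable_const (hr x k)
      · exact measurableSet_le (hr x k) measurable_fst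
  simp only [knowsFrom_iff, Set.ofPred_exists]
  exact .iUnion fun m => key m v

theorem measurableSet_informedBy [Countable V] [MeasurableSpace V] [MeasurableSingletonClass V]
    (I : Set V) : MeasurableSet {p : ℝ × AsyncOutcome V | InformedBy I p.2 p.1} := by
  simp only [InformedBy, Set.ofPred_forall]
  exact .iInter fun v => measurableSet_knowsFrom I v

theorem measurableSet_informedBy_right [Countable V] [MeasurableSpace V]
    [MeasurableSingletonClass V] (I : Set V) (t : ℝ) :
    MeasurableSet {ω : AsyncOutcome V | InformedBy I ω t} :=
  (measurable_const.prodMk measurable_id : Measurable fun ω : AsyncOutcome V => (t, ω))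
    (measurableSet_informedBy I)

open Classical in
/-- The indices of the rings after the first ring of `x`. -/
noncomputable def skipRing (x : V) (i : V × ℕ) : V × ℕ := if i.1 = x then (x, i.2 + 1) else i

theorem skipRing_self (x : V) (k : ℕ) : skipRing x (x, k) = (x, k + 1) := by simp [skipRing]

theorem skipRing_of_ne {x y : V} (h : y ≠ x) (k : ℕ) : skipRing x (y, k) = (y, k) := by
  simp [skipRing, h]

theorem skipRing_fst (x : V) (i : V × ℕ) : (skipRing x i).1 = i.1 := by
  unfold skipRing; split_ifs with h
  · exact h.symm
  · rfl

theorem skipRing_injective (x : V) : Function.Injective (skipRing x) := by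
  rintro ⟨y, k⟩ ⟨z, l⟩ h
  have h1 := congrArg Prod.fst h
  simp only [skipRing_fst] at h1
  subst h1
  by_cases hy : y = x
  · subst hy
    simp only [skipRing_self, Prod.mk.injEq, true_and, Nat.add_right_cancel_iff] at h
    rw [h]
  · rwa [skipRing_of_ne hy, skipRing_of_ne hy] at h

theorem skipRing_ne (x : V) (i : V × ℕ) : (x, 0) ≠ skipRing x i := by
  obtain ⟨y, k⟩ := i
  by_cases hy : y = x
  · subst hy; simp [skipRing_self]
  · rw [skipRing_of_ne hy]; intro h; exact hy (congrArg Prod.fst h).symm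

open Classical in
/-- The clocks other than the one at `x`, before their first ring. -/
noncomputable def otherClocks [Fintype V] (x : V) : Finset (V × ℕ) :=
  (Finset.univ.filter fun y => y ≠ x).map ⟨fun y => (y, 0), fun _ _ h => (Prod.mk.inj h).1⟩

theorem mem_otherClocks [Fintype V] {x : V} {i : V × ℕ} :
    i ∈ otherClocks x ↔ i.1 ≠ x ∧ i.2 = 0 := by
  classical
  simp only [otherClocks, Finset.mem_map, Finset.mem_filter, Finset.mem_univ, true_and]
  constructor
  · rintro ⟨y, hy, rfl⟩; exact ⟨hy, rfl⟩
  · rintro ⟨h1, h2⟩; exact ⟨i.1, h1, Prod.ext rfl h2.symm⟩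

theorem card_otherClocks [Fintype V] (x : V) :
    (otherClocks x).card + 1 = Fintype.card V := by
  classical
  rw [otherClocks, Finset.card_map, Finset.filter_ne', Finset.card_erase_of_mem (Finset.mem_univ _),
    Finset.card_univ]
  exact Nat.sub_add_cancel (Fintype.card_pos_iff.2 ⟨x⟩)

/-- The outcome seen from time `u` on, when the first ring is the one of `x` at time `u`. -/
noncomputable def afterRing [Fintype V] (x : V) (u : ℝ) (ω : AsyncOutcome V) : AsyncOutcome V :=
  (shiftOn (otherClocks x) u (ω.1 ∘ skipRing x), ω.2 ∘ skipRing x)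

/-- The first ring is the one of `x`. -/
def firstRing (x : V) : Set (AsyncOutcome V) :=
  {ω | 0 < ω.1 (x, 0) ∧ ∀ y, y ≠ x → ω.1 (x, 0) < ω.1 (y, 0)}

theorem ringTime_zero (ω : AsyncOutcome V) (x : V) : ringTime ω x 0 = ω.1 (x, 0) := by
  simp [ringTime]

theorem ringTime_afterRing_self [Fintype V] (ω : AsyncOutcome V) (x : V) (k : ℕ) :
    ringTime (afterRing x (ω.1 (x, 0)) ω) x k = ringTime ω x (k + 1) - ω.1 (x, 0) := by
  have : ∀ j, (x, j) ∉ otherClocks x := fun j h => (mem_otherClocks.1 h).1 rfl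
  simp only [ringTime, afterRing, shiftOn, this, if_false, Function.comp, skipRing_self]
  rw [Finset.sum_range_succ' _ (k + 1)]
  ring

theorem ringTime_afterRing_of_ne [Fintype V] (ω : AsyncOutcome V) {x y : V} (h : y ≠ x) (u : ℝ)
    (k : ℕ) : ringTime (afterRing x u ω) y k = ringTime ω y k - u := by
  have h0 : (y, 0) ∈ otherClocks x := mem_otherClocks.2 ⟨h, rfl⟩
  have h1 : ∀ j, (y, j + 1) ∉ otherClocks x := fun j h => by simpa using (mem_otherClocks.1 h).2
  simp only [ringTime, afterRing, Finset.sum_range_succ' _ k]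
  simp only [shiftOn, h0, h1, if_false, if_true, Function.comp, skipRing_of_ne h]
  ring

/-- Each later ring is a ring of the outcome seen from the first ring on. -/
theorem exists_ring_afterRing [Fintype V] {x : V} (y : V) (k : ℕ) (hne : (y, k) ≠ (x, 0)) :
    ∃ l, ringTime (afterRing x (ω.1 (x, 0)) ω) y l = ringTime ω y k - ω.1 (x, 0) ∧
      (afterRing x (ω.1 (x, 0)) ω).2 (y, l) = ω.2 (y, k) := by
  by_cases hy : y = x
  · subst hy
    obtain ⟨l, rfl⟩ : ∃ l, k = l + 1 := Nat.exists_eq_succ_of_ne_zero fun h => hne (by rw [h])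
    exact ⟨l, ringTime_afterRing_self ω y l, by simp [afterRing, skipRing_self]⟩
  · exact ⟨k, ringTime_afterRing_of_ne ω hy _ k, by simp [afterRing, skipRing_of_ne hy]⟩

theorem exists_ring_of_afterRing [Fintype V] (x : V) (y : V) (l : ℕ) :
    ∃ k, ringTime (afterRing x (ω.1 (x, 0)) ω) y l = ringTime ω y k - ω.1 (x, 0) ∧
      (afterRing x (ω.1 (x, 0)) ω).2 (y, l) = ω.2 (y, k) := by
  by_cases hy : y = x
  · subst hy
    exact ⟨l + 1, ringTime_afterRing_self ω y l, by simp [afterRing, skipRing_self]⟩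
  · exact ⟨l, ringTime_afterRing_of_ne ω hy _ l, by simp [afterRing, skipRing_of_ne hy]⟩

theorem lt_ringTime {x : V} (hω : ω ∈ firstRing x) (hpos : ∀ i, 0 < ω.1 i) (y : V) (k : ℕ)
    (hne : (y, k) ≠ (x, 0)) : ω.1 (x, 0) < ringTime ω y k := by
  have h1 : ω.1 (y, 0) ≤ ringTime ω y k := by
    rw [ringTime, Finset.sum_range_succ']
    have : 0 ≤ ∑ j ∈ Finset.range k, ω.1 (y, j + 1) := Finset.sum_nonneg fun j _ => (hpos _).le
    linarith
  by_cases hy : y = x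
  · subst hy
    obtain ⟨l, rfl⟩ : ∃ l, k = l + 1 := Nat.exists_eq_succ_of_ne_zero fun h => hne (by rw [h])
    rw [ringTime, Finset.sum_range_succ', Finset.sum_range_succ]
    have : 0 ≤ ∑ j ∈ Finset.range l, ω.1 (y, j + 1) := Finset.sum_nonneg fun j _ => (hpos _).le
    linarith [hpos (y, l + 1)]
  · exact (hω.2 y hy).trans_le h1

/-- Before the first ring nothing spreads. At that moment only `x` calls, since all other rings are
strictly later when waiting times are positive, so the informed set becomes `afterCall`; every later
ring is a ring of the shifted outcome. -/
theorem KnowsFrom.to_afterRing [Fintype V] {x : V} (hω : ω ∈ firstRing x) (hpos : ∀ i, 0 < ω.1 i)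
    (h : KnowsFrom I ω v t) : (t < ω.1 (x, 0) → v ∈ I) ∧ (ω.1 (x, 0) ≤ t →
      KnowsFrom (afterCall I x (ω.2 (x, 0))) (afterRing x (ω.1 (x, 0)) ω) v (t - ω.1 (x, 0))) := by
  have hu := hω.1
  have hsub := subset_afterCall I x (ω.2 (x, 0))
  have hring0 := ringTime_zero ω x
  induction h with
  | start v hv => exact ⟨fun _ => hv, fun h => absurd hu (not_lt.2 h)⟩
  | stay y t t' hy ht ih =>
    refine ⟨fun h => ih.1 (ht.trans_lt h), fun h => ?_⟩
    by_cases h1 : ω.1 (x, 0) ≤ t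
    · exact .stay _ _ _ (ih.2 h1) (by linarith)
    · exact .stay _ 0 _ (.start _ (hsub (ih.1 (not_le.1 h1)))) (by linarith)
  | push y k t hy ht ih =>
    by_cases hne : (y, k) = (x, 0)
    · obtain ⟨rfl, rfl⟩ := Prod.mk.inj hne
      rw [hring0] at ht ⊢
      refine ⟨fun h => absurd h (lt_irrefl _), fun _ => ?_⟩
      rw [sub_self]
      exact .start _ (by rw [afterCall, if_pos (ih.1 ht)]; exact Set.mem_insert _ _)
    · have hlt := lt_ringTime hω hpos y k hne
      refine ⟨fun h => absurd h (not_lt.2 hlt.le), fun _ => ?_⟩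
      obtain ⟨l, h1, h2⟩ := exists_ring_afterRing (ω := ω) y k hne
      rw [← h1, ← h2]
      by_cases h3 : ω.1 (x, 0) ≤ t
      · exact .push y l _ (ih.2 h3) (by rw [h1]; linarith)
      · exact .push y l 0 (.start _ (hsub (ih.1 (not_le.1 h3)))) (by rw [h1]; linarith)
  | pull y k t hy ht ih =>
    by_cases hne : (y, k) = (x, 0)
    · obtain ⟨rfl, rfl⟩ := Prod.mk.inj hne
      rw [hring0] at ht ⊢
      refine ⟨fun h => absurd h (lt_irrefl _), fun _ => ?_⟩
      rw [sub_self]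
      refine .start _ ?_
      by_cases hyI : y ∈ I
      · exact hsub hyI
      · rw [afterCall, if_neg hyI, if_pos (ih.1 ht)]
        exact Set.mem_insert _ _
    · have hlt := lt_ringTime hω hpos y k hne
      refine ⟨fun h => absurd h (not_lt.2 hlt.le), fun _ => ?_⟩
      obtain ⟨l, h1, h2⟩ := exists_ring_afterRing (ω := ω) y k hne
      rw [← h1]
      rw [← h2] at ih
      by_cases h3 : ω.1 (x, 0) ≤ t
      · exact .pull y l _ (ih.2 h3) (by rw [h1]; linarith)
      · refine .pull y l 0 (.start _ (hsub ?_)) (by rw [h1]; linarith)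
        exact ih.1 (not_le.1 h3)

theorem KnowsFrom.of_afterRing [Fintype V] {x : V} (hu : 0 < ω.1 (x, 0))
    (h : KnowsFrom (afterCall I x (ω.2 (x, 0))) (afterRing x (ω.1 (x, 0)) ω) v t) :
    KnowsFrom I ω v (t + ω.1 (x, 0)) := by
  have hring0 := ringTime_zero ω x
  induction h with
  | start v hv =>
    rw [zero_add, ← hring0]
    by_cases hvI : v ∈ I
    · exact .stay _ 0 _ (.start _ hvI) (by rw [hring0]; exact hu.le)
    unfold afterCall at hv
    split_ifs at hv with h1 h2
    · rw [hv.resolve_right hvI]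
      exact .push x 0 0 (.start _ h1) (by rwa [hring0])
    · rw [hv.resolve_right hvI]
      exact .pull x 0 0 (.start _ h2) (by rwa [hring0])
    · exact absurd hv hvI
  | stay y t t' hy ht ih => exact .stay _ _ _ ih (by linarith)
  | push y l t hy ht ih =>
    obtain ⟨k, h1, h2⟩ := exists_ring_of_afterRing (ω := ω) x y l
    rw [h1] at ht ⊢
    rw [h2, sub_add_cancel]
    exact .push y k _ ih (by linarith)
  | pull y l t hy ht ih =>
    obtain ⟨k, h1, h2⟩ := exists_ring_of_afterRing (ω := ω) x y l
    rw [h1] at ht ⊢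
    rw [h2] at ih
    rw [sub_add_cancel]
    exact .pull y k _ ih (by linarith)

end AsyncDeterministic

/-! ### Separating one coordinate from the others -/

section SingleCoordinate

variable {ι κ α : Type*} [MeasurableSpace α]

theorem lintegral_infinitePi_eval_comp (μ : ι → Measure α) [∀ i, IsProbabilityMeasure (μ i)]
    (i : ι) {τ : κ → ι} (hτ : Function.Injective τ) (hd : ∀ j, i ≠ τ j)
    {Φ : α → (κ → α) → ℝ≥0∞} (hΦ : Measurable (Function.uncurry Φ)) :
    ∫⁻ ω, Φ (ω i) (ω ∘ τ) ∂(Measure.infinitePi μ) =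
      ∫⁻ a, ∫⁻ g, Φ a g ∂(Measure.infinitePi fun j => μ (τ j)) ∂(μ i) := by
  have hΨ : Measurable (Function.uncurry fun (f : Unit → α) (g : κ → α) => Φ (f ()) g) :=
    hΦ.comp (f := fun p : (Unit → α) × (κ → α) => (p.1 (), p.2))
      (((measurable_pi_apply ()).comp measurable_fst).prodMk measurable_snd)
  have h1 := lintegral_infinitePi_comp_comp μ (σ := fun _ : Unit => i) (τ := τ)
    (fun _ _ _ => rfl) hτ (fun _ j => hd j) hΨ
  refine h1.trans ?_
  have h2 := Measure.infinitePi_map_eval (fun _ : Unit => μ i) ()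
  conv_rhs => rw [← h2]
  exact (lintegral_map (Measurable.lintegral_prod_right' hΦ) (measurable_pi_apply ())).symm

end SingleCoordinate

/-! ### The regeneration of the asynchronous law at the first ring -/

section AsyncLaw

variable {V : Type*} [Fintype V] [MeasurableSpace V] [MeasurableSingletonClass V]
  {G : SimpleGraph V}

theorem callLaw_singleton {x : V} (hx : (G.neighborSet x).Nonempty) (y : V) :
    callLaw G x {y} = ENNReal.ofReal (callProb G x y) := by
  classical
  have h0 : 0 < (G.neighborSet x).ncard := (Set.ncard_pos (Set.toFinite _)).2 hx
  have hs : G.neighborSet x = ((G.neighborSet x).toFinset : Set V) := by simp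
  have hcard : (G.neighborSet x).ncard = (G.neighborSet x).toFinset.card :=
    Set.ncard_eq_toFinset_card' _
  rw [callLaw, if_pos hx]
  rw [hs, ← Finset.coe_singleton, uniformOn_apply_finset, callProb]
  split_ifs with h
  · rw [Finset.inter_singleton_of_mem (by simpa using h), Finset.card_singleton, ← hcard,
      ENNReal.ofReal_inv_of_pos (by exact_mod_cast h0), ENNReal.ofReal_natCast]
    simp
  · rw [Finset.inter_singleton_of_notMem (by simpa using h)]
    simp

theorem lintegral_callLaw {x : V} (hx : (G.neighborSet x).Nonempty) (f : V → ℝ≥0∞) :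
    ∫⁻ y, f y ∂(callLaw G x) = ∑ y, ENNReal.ofReal (callProb G x y) * f y := by
  rw [lintegral_fintype]
  exact Finset.sum_congr rfl fun y _ => by rw [callLaw_singleton hx, mul_comm]

instance isProbabilityMeasure_exp_one : IsProbabilityMeasure (expMeasure 1) :=
  isProbabilityMeasure_expMeasure one_pos

instance isProbabilityMeasure_asyncLaw (G : SimpleGraph V) :
    IsProbabilityMeasure (asyncLaw G) := by
  unfold asyncLaw; infer_instance

theorem measurable_uncurry_of_discrete {β : Type*} [MeasurableSpace β] {f : V → β → ℝ≥0∞}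
    (hf : ∀ y, Measurable (f y)) : Measurable (Function.uncurry f) :=
  measurable_from_prod_countable_right hf

theorem measurableSet_firstRing (x : V) :
    MeasurableSet (firstRing x : Set (AsyncOutcome V)) := by
  have hw (y : V) : Measurable fun ω : AsyncOutcome V => ω.1 (y, 0) :=
    (measurable_pi_apply (y, 0)).comp measurable_fst
  refine MeasurableSet.inter (s₁ := {ω : AsyncOutcome V | 0 < ω.1 (x, 0)})
    (s₂ := {ω : AsyncOutcome V | ∀ y, y ≠ x → ω.1 (x, 0) < ω.1 (y, 0)})
    (measurableSet_lt measurable_const (hw x)) ?_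
  simp only [Set.ofPred_forall]
  exact .iInter fun y => .iInter fun _ => measurableSet_lt (hw x) (hw y)

theorem measurable_afterRing (x : V) :
    Measurable fun ω : AsyncOutcome V => afterRing x (ω.1 (x, 0)) ω := by
  refine Measurable.prodMk ?_ ((measurable_precomp _).comp measurable_snd)
  exact (measurable_shiftOn _).comp (g := fun p : ℝ × (V × ℕ → ℝ) => shiftOn _ p.1 p.2)
    (((measurable_pi_apply (x, 0)).comp measurable_fst).prodMk
      ((measurable_precomp _).comp measurable_fst))

/-- The law of the time, the caller and the callee of the first call and of the outcome seen
afterwards. -/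
theorem lintegral_firstRing (hG : ∀ x, (G.neighborSet x).Nonempty) (x : V)
    {Φ : ℝ → V → AsyncOutcome V → ℝ≥0∞}
    (hΦ : ∀ y, Measurable fun p : ℝ × AsyncOutcome V => Φ p.1 y p.2) :
    ∫⁻ ω in firstRing x, Φ (ω.1 (x, 0)) (ω.2 (x, 0)) (afterRing x (ω.1 (x, 0)) ω) ∂(asyncLaw G) =
      ∫⁻ u in Set.Ioi 0, ENNReal.ofReal (Real.exp (-((Fintype.card V : ℝ) * u))) *
        ∑ y, ENNReal.ofReal (callProb G x y) * ∫⁻ ω, Φ u y ω ∂(asyncLaw G) := by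
  classical
  set W : Measure (V × ℕ → ℝ) := Measure.infinitePi fun _ : V × ℕ => expMeasure 1 with hW
  set C : Measure (V × ℕ → V) := Measure.infinitePi fun p : V × ℕ => callLaw G p.1 with hC
  have hμ : asyncLaw G = W.prod C := rfl
  set B := otherClocks x with hB
  have hf1 : Measurable fun ω : AsyncOutcome V => ω.1 (x, 0) :=
    (measurable_pi_apply (x, 0)).comp measurable_fst
  have hf2 : Measurable fun ω : AsyncOutcome V => ω.2 (x, 0) :=
    (measurable_pi_apply (x, 0)).comp measurable_snd
  have hS := measurableSet_firstRing x
  have hΦ' : Measurable (fun p : V × ℝ × AsyncOutcome V => Φ p.2.1 p.1 p.2.2) :=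
    measurable_uncurry_of_discrete (f := fun y (p : ℝ × AsyncOutcome V) => Φ p.1 y p.2) hΦ
  set Θ : ℝ → (V × ℕ → ℝ) → ℝ≥0∞ := fun a g => ∑ y, ENNReal.ofReal (callProb G x y) *
    ∫⁻ c, Φ a y (g, c) ∂C with hΘ
  have hΘm : Measurable (Function.uncurry Θ) := by
    refine Finset.measurable_sum _ fun y _ => .const_mul ?_ _
    refine Measurable.lintegral_prod_right' (f := fun p : (ℝ × (V × ℕ → ℝ)) × (V × ℕ → V) =>
      Φ p.1.1 y (p.1.2, p.2)) ?_
    exact (hΦ y).comp ((measurable_fst.comp measurable_fst).prodMk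
      ((measurable_snd.comp measurable_fst).prodMk measurable_snd))
  have hcalls : ∀ (a : ℝ) (g : V × ℕ → ℝ), ∫⁻ c, Φ a (c (x, 0)) (g, c ∘ skipRing x) ∂C = Θ a g := by
    intro a g
    have h1 : Measurable (Function.uncurry fun (y : V) (c : V × ℕ → V) => Φ a y (g, c)) :=
      measurable_uncurry_of_discrete fun y =>
        (hΦ y).comp (measurable_const.prodMk (measurable_const.prodMk measurable_id))
    have h2 := lintegral_infinitePi_eval_comp (fun p : V × ℕ => callLaw G p.1) (x, 0)
      (skipRing_injective x) (skipRing_ne x) h1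
    simp only [skipRing_fst] at h2
    refine h2.trans ?_
    rw [lintegral_callLaw (hG x)]
  set Ξ : ℝ → (V × ℕ → ℝ) → ℝ≥0∞ := fun a g => Set.indicator
    {p : ℝ × (V × ℕ → ℝ) | 0 < p.1 ∧ ∀ i ∈ B, p.1 < p.2 i}
    (fun p => Θ p.1 (shiftOn B p.1 p.2)) (a, g) with hΞ
  have hset : MeasurableSet {p : ℝ × (V × ℕ → ℝ) | 0 < p.1 ∧ ∀ i ∈ B, p.1 < p.2 i} := by
    refine MeasurableSet.inter (s₁ := {p : ℝ × (V × ℕ → ℝ) | 0 < p.1})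
      (s₂ := {p | ∀ i ∈ B, p.1 < p.2 i}) (measurableSet_lt measurable_const measurable_fst) ?_
    simp only [Set.ofPred_forall]
    exact .biInter B.countable_toSet fun i _ =>
      measurableSet_lt measurable_fst ((measurable_pi_apply i).comp measurable_snd)
  have hshift : Measurable fun p : ℝ × (V × ℕ → ℝ) => Θ p.1 (shiftOn B p.1 p.2) :=
    hΘm.comp (measurable_fst.prodMk (measurable_shiftOn B))
  have hΞm : Measurable (Function.uncurry Ξ) := hshift.indicator hset
  have hΞint : ∀ a, 0 < a → ∫⁻ g, Ξ a g ∂W =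
      ENNReal.ofReal (Real.exp (-(B.card * a))) * ∫⁻ g, Θ a g ∂W := by
    intro a ha
    have h1 := lintegral_infinitePi_shiftOn (fun _ : V × ℕ => expMeasure 1) B a
      (fun _ => ENNReal.ofReal (Real.exp (-(1 * a))))
      (fun _ => (ENNReal.ofReal_pos.2 (Real.exp_pos _)).ne') (fun _ => ENNReal.ofReal_ne_top)
      (fun _ _ s hs => expMeasure_memoryless ha.le hs)
      (Φ := Θ a) (hΘm.comp (measurable_const.prodMk measurable_id))
    rw [Finset.prod_const, ← ENNReal.ofReal_pow (Real.exp_pos _).le, ← Real.exp_nat_mul,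
      one_mul, mul_neg] at h1
    rw [← h1, ← lintegral_indicator (measurableSet_forall_lt B a)]
    refine lintegral_congr fun g => ?_
    have h2 : (a, g) ∈ {p : ℝ × (V × ℕ → ℝ) | 0 < p.1 ∧ ∀ i ∈ B, p.1 < p.2 i} ↔
        g ∈ {f | ∀ i ∈ B, a < f i} := ⟨fun h => h.2, fun h => ⟨ha, h⟩⟩
    simp only [hΞ, Set.indicator_apply, h2]
  have hmeas : Measurable fun ω : AsyncOutcome V =>
      Φ (ω.1 (x, 0)) (ω.2 (x, 0)) (afterRing x (ω.1 (x, 0)) ω) :=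
    hΦ'.comp (hf2.prodMk (hf1.prodMk (measurable_afterRing x)))
  have hstep : ∀ w, ∫⁻ c, (firstRing x).indicator (fun ω : AsyncOutcome V =>
      Φ (ω.1 (x, 0)) (ω.2 (x, 0)) (afterRing x (ω.1 (x, 0)) ω)) (w, c) ∂C =
        Ξ (w (x, 0)) (w ∘ skipRing x) := by
    intro w
    have hB' : ∀ i ∈ B, w (skipRing x i) = w i := by
      rintro ⟨y, k⟩ hi
      rw [skipRing_of_ne (mem_otherClocks.1 hi).1]
    by_cases hw : 0 < w (x, 0) ∧ ∀ y, y ≠ x → w (x, 0) < w (y, 0)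
    · have h1 : ((w (x, 0), w ∘ skipRing x) : ℝ × (V × ℕ → ℝ)) ∈
          {p : ℝ × (V × ℕ → ℝ) | 0 < p.1 ∧ ∀ i ∈ B, p.1 < p.2 i} := by
        refine ⟨hw.1, fun i hi => ?_⟩
        obtain ⟨h2, h3⟩ := mem_otherClocks.1 hi
        simp only [Function.comp, hB' i hi]
        have : i = (i.1, 0) := Prod.ext rfl h3
        rw [this]
        exact hw.2 _ h2
      have h2 : ∀ c, ((w, c) : AsyncOutcome V) ∈ firstRing x := fun c => hw
      simp only [hΞ, Set.indicator_of_mem h1, Set.indicator_of_mem (h2 _)]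
      exact hcalls (w (x, 0)) (shiftOn B (w (x, 0)) (w ∘ skipRing x))
    · have h1 : ((w (x, 0), w ∘ skipRing x) : ℝ × (V × ℕ → ℝ)) ∉
          {p : ℝ × (V × ℕ → ℝ) | 0 < p.1 ∧ ∀ i ∈ B, p.1 < p.2 i} := by
        rintro ⟨h2, h3⟩
        refine hw ⟨h2, fun y hy => ?_⟩
        have hm : (y, 0) ∈ B := mem_otherClocks.2 ⟨hy, rfl⟩
        have := h3 (y, 0) hm
        simpa only [Function.comp, hB' _ hm] using this
      have h2 : ∀ c, ((w, c) : AsyncOutcome V) ∉ firstRing x := fun c => hw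
      simp only [hΞ, Set.indicator_of_notMem h1, Set.indicator_of_notMem (h2 _), lintegral_zero]
  rw [← lintegral_indicator hS, hμ, lintegral_prod _ (hmeas.indicator hS).aemeasurable,
    lintegral_congr hstep]
  have h3 := lintegral_infinitePi_eval_comp (fun _ : V × ℕ => expMeasure 1) (x, 0)
    (skipRing_injective x) (skipRing_ne x) hΞm
  refine h3.trans ?_
  refine (lintegral_expMeasure (fun a => ∫⁻ g, Ξ a g ∂W)
    (Measurable.lintegral_prod_right' hΞm)).trans ?_
  refine setLIntegral_congr_fun measurableSet_Ioi fun a ha => ?_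
  -- The rate-one density of the clock at `x` times the survival of the `|V| - 1` other clocks gives
  -- `exp (-|V| a)`.
  rw [hΞint a ha, ← mul_assoc, ← ENNReal.ofReal_mul (by positivity), one_mul, one_mul,
    ← Real.exp_add, ← card_otherClocks x]
  have h4 : ∫⁻ g, Θ a g ∂W = ∑ y, ENNReal.ofReal (callProb G x y) *
      ∫⁻ ω, Φ a y ω ∂(W.prod C) := by
    rw [hΘ, lintegral_finsetSum]
    · refine Finset.sum_congr rfl fun y _ => ?_
      have hy : Measurable fun ω : AsyncOutcome V => Φ a y ω :=
        (hΦ y).comp (measurable_const.prodMk measurable_id)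
      rw [lintegral_const_mul _ (Measurable.lintegral_prod_right' hy),
        lintegral_prod _ hy.aemeasurable]
    · intro y _
      have hy : Measurable fun ω : AsyncOutcome V => Φ a y ω :=
        (hΦ y).comp (measurable_const.prodMk measurable_id)
      exact .const_mul (Measurable.lintegral_prod_right' hy) _
  rw [h4]
  congr 3
  push_cast
  ring

end AsyncLaw

/-! ### Comparison of the asynchronous protocol with percolation -/

section AsyncComparison

variable {V : Type*} [Fintype V] [MeasurableSpace V] [MeasurableSingletonClass V]
  {G : SimpleGraph V}

theorem lintegral_Ioi_exp_mul {c : ℝ} (hc : 0 < c) :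
    ∫⁻ u in Set.Ioi (0 : ℝ), ENNReal.ofReal (Real.exp (-(c * u))) = ENNReal.ofReal c⁻¹ := by
  have := isProbabilityMeasure_expMeasure hc
  have h1 := lintegral_expMeasure (r := c) (fun _ => 1) measurable_const
  simp only [lintegral_one, measure_univ, mul_one] at h1
  calc _ = ∫⁻ u in Set.Ioi (0 : ℝ), ENNReal.ofReal c⁻¹ *
        ENNReal.ofReal (c * Real.exp (-(c * u))) := by
        refine lintegral_congr fun u => ?_
        rw [← ENNReal.ofReal_mul (inv_nonneg.2 hc.le), inv_mul_cancel_left₀ hc.ne']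
    _ = _ := by rw [lintegral_const_mul _ (by fun_prop), ← h1, mul_one]

theorem sum_ofReal_callProb (hG : ∀ x, (G.neighborSet x).Nonempty) (x : V) :
    ∑ y, ENNReal.ofReal (callProb G x y) = 1 := by
  rw [← ENNReal.ofReal_sum_of_nonneg fun y _ => callProb_nonneg G x y, sum_callProb G (hG x),
    ENNReal.ofReal_one]

theorem asyncLaw_firstRing (hG : ∀ x, (G.neighborSet x).Nonempty) (x : V) :
    asyncLaw G (firstRing x) = (Fintype.card V : ℝ≥0∞)⁻¹ := by
  have hn : 0 < (Fintype.card V : ℝ) := by exact_mod_cast Fintype.card_pos_iff.2 ⟨x⟩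
  have h := lintegral_firstRing hG x (Φ := fun _ _ _ => 1) fun _ => measurable_const
  simp only [lintegral_one, measure_univ, mul_one, Measure.restrict_apply_univ,
    sum_ofReal_callProb hG x] at h
  rw [h, lintegral_Ioi_exp_mul hn, ENNReal.ofReal_inv_of_pos hn, ENNReal.ofReal_natCast]

theorem disjoint_firstRing {x y : V} (h : x ≠ y) :
    Disjoint (firstRing x : Set (AsyncOutcome V)) (firstRing y) :=
  Set.disjoint_left.2 fun _ h1 h2 => lt_asymm (h1.2 y h.symm) (h2.2 x h)

/-- Almost surely, all waiting times are positive and there is a single first ring. -/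
theorem ae_firstRing [Nonempty V] (hG : ∀ x, (G.neighborSet x).Nonempty) :
    ∀ᵐ ω ∂(asyncLaw G), (∀ i, 0 < ω.1 i) ∧ ∃ x, ω ∈ firstRing x := by
  refine Filter.Eventually.and ?_ ?_
  · rw [ae_all_iff]
    intro i
    have h1 : Measurable fun ω : AsyncOutcome V => ω.1 i :=
      (measurable_pi_apply i).comp measurable_fst
    have h2 : (asyncLaw G).map (fun ω => ω.1 i) = expMeasure 1 := by
      have : (fun ω : AsyncOutcome V => ω.1 i) = (fun w : V × ℕ → ℝ => w i) ∘ Prod.fst := rfl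
      rw [this, ← Measure.map_map (measurable_pi_apply i) measurable_fst, asyncLaw,
        Measure.map_fst_prod, measure_univ, one_smul, Measure.infinitePi_map_eval]
    have h3 : ∀ᵐ a ∂(expMeasure 1), 0 < a := by
      rw [ae_iff]
      simp only [not_lt]
      exact expMeasure_Iic_zero
    rw [← h2] at h3
    exact ae_of_ae_map h1.aemeasurable h3
  · have h1 : asyncLaw G (⋃ x, firstRing x) = 1 := by
      rw [measure_iUnion (fun x y h => disjoint_firstRing h) measurableSet_firstRing,
        tsum_fintype]
      simp only [asyncLaw_firstRing hG, Finset.sum_const, Finset.card_univ, nsmul_eq_mul]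
      exact ENNReal.mul_inv_cancel (by simp) (ENNReal.natCast_ne_top _)
    have h2 := (prob_compl_eq_zero_iff (μ := asyncLaw G)
      (MeasurableSet.iUnion fun x : V => measurableSet_firstRing x)).2 h1
    rw [ae_iff]
    convert h2 using 2
    ext; simp

/-- A bound on an expectation by conditioning on the first ring. -/
theorem lintegral_asyncLaw_le (hG : ∀ x, (G.neighborSet x).Nonempty) [Nonempty V]
    {f : AsyncOutcome V → ℝ≥0∞}
    {Φ : ℝ → V → V → AsyncOutcome V → ℝ≥0∞}
    (hΦ : ∀ x y, Measurable fun p : ℝ × AsyncOutcome V => Φ p.1 x y p.2)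
    (h : ∀ x ω, ω ∈ firstRing x → (∀ i, 0 < ω.1 i) →
      f ω ≤ Φ (ω.1 (x, 0)) x (ω.2 (x, 0)) (afterRing x (ω.1 (x, 0)) ω)) :
    ∫⁻ ω, f ω ∂(asyncLaw G) ≤
      ∫⁻ u in Set.Ioi 0, ENNReal.ofReal (Real.exp (-((Fintype.card V : ℝ) * u))) *
        ∑ x, ∑ y, ENNReal.ofReal (callProb G x y) * ∫⁻ ω, Φ u x y ω ∂(asyncLaw G) := by
  have hm (x y : V) : Measurable fun u => ∫⁻ ω, Φ u x y ω ∂(asyncLaw G) :=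
    Measurable.lintegral_prod_right' (f := fun p : ℝ × AsyncOutcome V => Φ p.1 x y p.2) (hΦ x y)
  have hmf (x : V) : Measurable fun ω : AsyncOutcome V =>
      Φ (ω.1 (x, 0)) x (ω.2 (x, 0)) (afterRing x (ω.1 (x, 0)) ω) := by
    have hf1 : Measurable fun ω : AsyncOutcome V => ω.1 (x, 0) :=
      (measurable_pi_apply (x, 0)).comp measurable_fst
    have hf2 : Measurable fun ω : AsyncOutcome V => ω.2 (x, 0) :=
      (measurable_pi_apply (x, 0)).comp measurable_snd
    have hΦ' : Measurable (fun p : V × ℝ × AsyncOutcome V => Φ p.2.1 x p.1 p.2.2) :=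
      measurable_uncurry_of_discrete (f := fun y (p : ℝ × AsyncOutcome V) => Φ p.1 x y p.2) (hΦ x)
    exact hΦ'.comp (hf2.prodMk (hf1.prodMk (measurable_afterRing x)))
  calc ∫⁻ ω, f ω ∂(asyncLaw G) ≤ ∫⁻ ω, ∑ x, (firstRing x).indicator (fun ω =>
        Φ (ω.1 (x, 0)) x (ω.2 (x, 0)) (afterRing x (ω.1 (x, 0)) ω)) ω ∂(asyncLaw G) := by
        refine lintegral_mono_ae ?_
        filter_upwards [ae_firstRing hG] with ω hω
        obtain ⟨hpos, x, hx⟩ := hω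
        refine (h x ω hx hpos).trans ?_
        refine le_trans (le_of_eq ?_) (Finset.single_le_sum (fun _ _ => zero_le)
          (Finset.mem_univ x))
        rw [Set.indicator_of_mem hx]
    _ = ∑ x, ∫⁻ ω in firstRing x,
        Φ (ω.1 (x, 0)) x (ω.2 (x, 0)) (afterRing x (ω.1 (x, 0)) ω) ∂(asyncLaw G) := by
        rw [lintegral_finsetSum _ fun x _ => (hmf x).indicator (measurableSet_firstRing x)]
        exact Finset.sum_congr rfl fun x _ => lintegral_indicator (measurableSet_firstRing x) _
    _ = _ := by
        have h1 (x : V) := lintegral_firstRing hG x (Φ := fun u y ω => Φ u x y ω) (hΦ x)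
        simp only [h1, Finset.mul_sum]
        rw [lintegral_finsetSum]
        intro x _
        exact Finset.measurable_sum _ fun y _ => .mul (by fun_prop) ((hm x y).const_mul _)

/-- The probability that the asynchronous protocol started from `I` has informed everyone by
time `t`. -/
noncomputable def informedProb (G : SimpleGraph V) (I : Set V) (t : ℝ) : ℝ≥0∞ :=
  asyncLaw G {ω | InformedBy I ω t}

theorem informedProb_le_one (G : SimpleGraph V) (I : Set V) (t : ℝ) : informedProb G I t ≤ 1 :=
  prob_le_one

theorem informedProb_of_neg [Nonempty V] (I : Set V) {t : ℝ} (ht : t < 0) :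
    informedProb G I t = 0 := by
  have : {ω : AsyncOutcome V | InformedBy I ω t} = ∅ := by
    refine Set.eq_empty_of_forall_notMem fun ω hω => ?_
    exact absurd (hω (Classical.arbitrary V)).nonneg (not_le.2 ht)
  rw [informedProb, this, measure_empty]

/-- Condition on the first ring. Some vertex is uninformed at the start, so everyone being informed
by time `t` forces that ring to occur by time `t`. The covering probabilities satisfy the reverse
inequality, `coverProb_superharmonic`, so the two can be compared by iteration. -/
theorem informedProb_le [Nonempty V] (hG : ∀ x, (G.neighborSet x).Nonempty) {I : Set V}
    (hI : I ≠ Set.univ) (t : ℝ) : informedProb G I t ≤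
      ∫⁻ u in Set.Ioc 0 t, ENNReal.ofReal (Real.exp (-((Fintype.card V : ℝ) * u))) *
        ∑ x, ∑ y, ENNReal.ofReal (callProb G x y) *
          informedProb G (afterCall I x y) (t - u) := by
  classical
  set Φ : ℝ → V → V → AsyncOutcome V → ℝ≥0∞ := fun u x y ω => (Set.Iic t).indicator
    (fun u => Set.indicator {p : ℝ × AsyncOutcome V | InformedBy (afterCall I x y) p.2 p.1}
      1 (t - u, ω)) u with hΦ
  have hΦm : ∀ x y, Measurable fun p : ℝ × AsyncOutcome V => Φ p.1 x y p.2 := by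
    intro x y
    have h1 : Measurable fun p : ℝ × AsyncOutcome V =>
        Set.indicator {p : ℝ × AsyncOutcome V | InformedBy (afterCall I x y) p.2 p.1}
          (1 : ℝ × AsyncOutcome V → ℝ≥0∞) (t - p.1, p.2) :=
      (measurable_one.indicator (measurableSet_informedBy _)).comp
        ((measurable_const.sub measurable_fst).prodMk measurable_snd)
    exact h1.indicator (measurable_fst measurableSet_Iic)
  rw [informedProb, ← lintegral_indicator_one (measurableSet_informedBy_right I t)]
  refine (lintegral_asyncLaw_le hG hΦm ?_).trans (le_of_eq ?_)
  · intro x ω hx hpos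
    by_cases hω : InformedBy I ω t
    · obtain ⟨v, hv⟩ := (Set.ne_univ_iff_exists_notMem I).1 hI
      have hle : ω.1 (x, 0) ≤ t := not_lt.1 fun h => hv (((hω v).to_afterRing hx hpos).1 h)
      have h2 : InformedBy (afterCall I x (ω.2 (x, 0))) (afterRing x (ω.1 (x, 0)) ω)
        (t - ω.1 (x, 0)) := fun v => ((hω v).to_afterRing hx hpos).2 hle
      simp only [hΦ]
      rw [Set.indicator_of_mem (show ω.1 (x, 0) ∈ Set.Iic t from hle), Set.indicator_of_mem,
        Set.indicator_of_mem]
      · exact le_rfl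
      · exact h2
      · exact hω
    · rw [Set.indicator_of_notMem hω]
      exact zero_le
  · rw [← lintegral_indicator measurableSet_Ioi, ← lintegral_indicator measurableSet_Ioc]
    refine lintegral_congr fun u => ?_
    by_cases h0 : 0 < u
    · by_cases hu : u ≤ t
      · rw [Set.indicator_of_mem (show u ∈ Set.Ioi 0 from h0),
          Set.indicator_of_mem (show u ∈ Set.Ioc 0 t from ⟨h0, hu⟩)]
        refine congrArg _ (Finset.sum_congr rfl fun x _ => Finset.sum_congr rfl fun y _ => ?_)
        congr 1
        rw [informedProb, ← lintegral_indicator_one (measurableSet_informedBy_right _ _)]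
        refine lintegral_congr fun ω => ?_
        simp only [hΦ]
        rw [Set.indicator_of_mem (show u ∈ Set.Iic t from hu)]
        rfl
      · rw [Set.indicator_of_mem (show u ∈ Set.Ioi 0 from h0),
          Set.indicator_of_notMem (show u ∉ Set.Ioc 0 t from fun h => hu h.2)]
        simp only [hΦ, Set.indicator_of_notMem (show u ∉ Set.Iic t from hu)]
        simp
    · rw [Set.indicator_of_notMem (show u ∉ Set.Ioi 0 from h0),
        Set.indicator_of_notMem (show u ∉ Set.Ioc 0 t from fun h => h0 h.1)]

/-- The asynchronous protocol is at most as fast as first-passage percolation. -/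
theorem informedProb_le_coverProb [Nonempty V] (hG : ∀ x, (G.neighborSet x).Nonempty)
    (I : Set V) (t : ℝ) : informedProb G I t ≤ coverProb G I t := by
  set n : ℝ := (Fintype.card V : ℝ) with hn
  have hn0 : 0 < n := by rw [hn]; exact_mod_cast Fintype.card_pos
  -- This is the probability that some clock rings by time `t`. Each conditioning on a first ring
  -- multiplies the error by at most `ρ < 1`.
  set ρ : ℝ≥0∞ := ENNReal.ofReal (1 - Real.exp (-(n * t))) with hρ
  have key : ∀ k : ℕ, ∀ I : Set V, ∀ t' ≤ t, informedProb G I t' ≤ coverProb G I t' + ρ ^ k := by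
    intro k
    induction k with
    | zero =>
      intro I t' _
      rw [pow_zero]
      exact (informedProb_le_one G I t').trans le_add_self
    | succ k ih =>
      intro I t' ht'
      rcases lt_or_ge t' 0 with h0 | h0
      · rw [informedProb_of_neg I h0]; exact zero_le
      by_cases hI : I = Set.univ
      · subst hI
        rw [coverProb_univ h0]
        exact (informedProb_le_one G _ t').trans le_self_add
      have hFm : Measurable fun u => ENNReal.ofReal (Real.exp (-(n * u))) *
          ∑ x, ∑ y, ENNReal.ofReal (callProb G x y) * coverProb G (afterCall I x y) (t' - u) := by
        refine .mul (by fun_prop) (Finset.measurable_sum _ fun x _ =>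
          Finset.measurable_sum _ fun y _ => .const_mul ?_ _)
        exact (coverProb_mono G _).measurable.comp (by fun_prop)
      calc informedProb G I t' ≤ _ := informedProb_le hG hI t'
        _ ≤ ∫⁻ u in Set.Ioc 0 t', (ENNReal.ofReal (Real.exp (-(n * u))) * (∑ x, ∑ y,
              ENNReal.ofReal (callProb G x y) * coverProb G (afterCall I x y) (t' - u)) +
            ENNReal.ofReal (n * Real.exp (-(n * u))) * ρ ^ k) := by
            refine setLIntegral_mono (hFm.add (by fun_prop)) fun u hu => ?_
            have h1 : ∑ x, ∑ y, ENNReal.ofReal (callProb G x y) *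
                informedProb G (afterCall I x y) (t' - u) ≤ (∑ x, ∑ y,
                ENNReal.ofReal (callProb G x y) * coverProb G (afterCall I x y) (t' - u)) +
                  ENNReal.ofReal n * ρ ^ k := by
              have h2 : ENNReal.ofReal n * ρ ^ k =
                  ∑ x, ∑ y, ENNReal.ofReal (callProb G x y) * ρ ^ k := by
                simp only [← Finset.sum_mul, sum_ofReal_callProb hG, Finset.sum_const,
                  Finset.card_univ, nsmul_eq_mul, mul_one, hn, ENNReal.ofReal_natCast]
              rw [h2, ← Finset.sum_add_distrib]
              refine Finset.sum_le_sum fun x _ => ?_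
              rw [← Finset.sum_add_distrib]
              refine Finset.sum_le_sum fun y _ => ?_
              rw [← mul_add]
              gcongr
              exact ih _ _ (by linarith [hu.1])
            refine (mul_le_mul_right h1 _).trans (le_of_eq ?_)
            rw [mul_add, ENNReal.ofReal_mul hn0.le]
            ring
        _ ≤ coverProb G I t' + ρ ^ (k + 1) := by
            rw [lintegral_add_left hFm]
            gcongr
            · exact coverProb_superharmonic hG I h0
            · rw [lintegral_mul_const _ (by fun_prop), setLIntegral_exp_Ioc hn0.le h0, pow_succ',
                mul_zero, neg_zero, Real.exp_zero]
              gcongr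
              exact ENNReal.ofReal_le_ofReal (sub_le_sub_left (Real.exp_le_exp.2
                (neg_le_neg (mul_le_mul_of_nonneg_left ht' hn0.le))) 1)
  have hρ1 : ρ < 1 := by
    rw [hρ, ← ENNReal.ofReal_one]
    exact (ENNReal.ofReal_lt_ofReal_iff one_pos).2 (by linarith [Real.exp_pos (-(n * t))])
  have hlim : Filter.Tendsto (fun k => coverProb G I t + ρ ^ k) Filter.atTop
      (nhds (coverProb G I t + 0)) :=
    tendsto_const_nhds.add (ENNReal.tendsto_pow_atTop_nhds_zero_of_lt_one hρ1)
  rw [add_zero] at hlim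
  exact ge_of_tendsto' hlim fun k => key k I t le_rfl

end AsyncComparison

/-! ### Finiteness of the asynchronous expectation -/

section AsyncFinite

variable {V : Type*} [Fintype V] {G : SimpleGraph V}

theorem outEdges_nonempty (hG : G.Connected) {I : Set V} (h0 : I.Nonempty) (h1 : I ≠ Set.univ) :
    (outEdges G I I).Nonempty := by
  obtain ⟨u, hu⟩ := h0
  obtain ⟨v, hv⟩ := (Set.ne_univ_iff_exists_notMem I).1 h1
  obtain ⟨p⟩ := hG.preconnected u v
  obtain ⟨d, _, hd1, hd2⟩ := p.exists_boundary_dart I hu hv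
  exact ⟨d.toProd, mem_outEdges.2 ⟨hd1, hd2, d.adj⟩⟩

theorem neighborSet_nonempty (hG : G.Connected) (hn : 1 < Fintype.card V) (x : V) :
    (G.neighborSet x).Nonempty := by
  have h1 : ({x} : Set V) ≠ Set.univ := by
    intro h
    obtain ⟨y, hy⟩ := Fintype.exists_ne_of_one_lt_card hn x
    exact hy (Set.mem_singleton_iff.1 (h ▸ Set.mem_univ y))
  obtain ⟨e, he⟩ := outEdges_nonempty hG (Set.singleton_nonempty x) h1
  obtain ⟨h2, _, h3⟩ := mem_outEdges.1 he
  rw [Set.mem_singleton_iff] at h2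
  exact ⟨e.2, h2 ▸ h3⟩

theorem outRate_pos (hG : G.Connected) {I : Set V} (h0 : I.Nonempty) (h1 : I ≠ Set.univ) :
    0 < outRate G I :=
  Finset.sum_pos (fun e _ => edgeRate_pos G e) (outEdges_nonempty hG h0 h1)

/-- The time at which the asynchronous protocol started from `I` has informed everyone. -/
noncomputable def spreadFrom (I : Set V) (ω : AsyncOutcome V) : ℝ≥0∞ :=
  ⨅ (q : ℚ) (_ : InformedBy I ω q), ENNReal.ofReal q

theorem asyncSpreadTime_le_spreadFrom (s : V) (ω : AsyncOutcome V) :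
    asyncSpreadTime s ω ≤ spreadFrom {s} ω :=
  le_iInf₂ fun q hq => iInf₂_le (q : ℝ) fun v => asyncKnows_iff.2 (hq v)

/-- Knowledge persists, so restricting the infimum to rational times, which serves measurability,
loses nothing. -/
theorem spreadFrom_le {I : Set V} {ω : AsyncOutcome V} {t : ℝ} (h : InformedBy I ω t) :
    spreadFrom I ω ≤ ENNReal.ofReal t := by
  refine not_lt.1 fun hlt => ?_
  obtain ⟨q, hq0, h1, h2⟩ := ENNReal.lt_iff_exists_rat_btwn.1 hlt
  have h3 : t ≤ q := by
    have : ENNReal.ofReal t < ENNReal.ofReal (q : ℝ) := h1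
    exact le_of_not_gt fun h => not_lt.2 (ENNReal.ofReal_le_ofReal h.le) this
  exact absurd h2 (not_lt.2 (iInf₂_le q (h.mono h3)))

theorem spreadFrom_le_add [Nonempty V] {I : Set V} {ω : AsyncOutcome V} {x : V} (hx : ω ∈ firstRing x) :
    spreadFrom I ω ≤ ENNReal.ofReal (ω.1 (x, 0)) +
      spreadFrom (afterCall I x (ω.2 (x, 0))) (afterRing x (ω.1 (x, 0)) ω) := by
  have h1 : ∀ q : ℚ, InformedBy (afterCall I x (ω.2 (x, 0))) (afterRing x (ω.1 (x, 0)) ω) q →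
      spreadFrom I ω ≤ ENNReal.ofReal (ω.1 (x, 0)) + ENNReal.ofReal q := by
    intro q hq
    have h0 : (0 : ℝ) ≤ q := (hq (Classical.arbitrary V)).nonneg
    rw [add_comm, ← ENNReal.ofReal_add h0 hx.1.le]
    exact spreadFrom_le fun v => (hq v).of_afterRing hx.1
  conv_rhs => rw [spreadFrom]
  simp only [ENNReal.add_iInf]
  exact le_iInf₂ h1

theorem spreadFrom_univ (ω : AsyncOutcome V) : spreadFrom Set.univ ω = 0 := by
  have : InformedBy Set.univ ω 0 := fun v => .start v trivial
  simpa using spreadFrom_le this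

variable [MeasurableSpace V] [MeasurableSingletonClass V]

theorem measurable_spreadFrom (I : Set V) : Measurable (spreadFrom I) := by
  classical
  refine Measurable.iInf fun q => ?_
  simp only [iInf_eq_if]
  exact Measurable.ite (measurableSet_informedBy_right I q) measurable_const measurable_const

theorem lintegral_Ioi_exp_mul_self_lt_top {c : ℝ} (hc : 0 < c) :
    ∫⁻ u in Set.Ioi (0 : ℝ), ENNReal.ofReal (Real.exp (-(c * u))) * ENNReal.ofReal u < ∞ := by
  calc _ ≤ ∫⁻ u in Set.Ioi (0 : ℝ), ENNReal.ofReal (2 / c) *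
        ENNReal.ofReal (Real.exp (-(c / 2 * u))) := by
        refine setLIntegral_mono (by fun_prop) fun u hu => ?_
        rw [← ENNReal.ofReal_mul (Real.exp_pos _).le, ← ENNReal.ofReal_mul (by positivity)]
        refine ENNReal.ofReal_le_ofReal ?_
        have h1 := Real.add_one_le_exp (c / 2 * u)
        have h2 : Real.exp (-(c / 2 * u)) = Real.exp (-(c * u)) * Real.exp (c / 2 * u) := by
          rw [← Real.exp_add]; congr 1; ring
        rw [h2, ← mul_assoc, mul_comm (2 / c), mul_assoc]
        refine mul_le_mul_of_nonneg_left ?_ (Real.exp_pos _).le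
        rw [div_mul_eq_mul_div, le_div_iff₀ hc]
        nlinarith
    _ < ∞ := by
        rw [lintegral_const_mul _ (by fun_prop), lintegral_Ioi_exp_mul (by positivity)]
        exact ENNReal.mul_lt_top ENNReal.ofReal_lt_top ENNReal.ofReal_lt_top

/-- The expected spread time, truncated at `c`. -/
noncomputable def truncatedMean (G : SimpleGraph V) (c : ℕ) (I : Set V) : ℝ≥0∞ :=
  ∫⁻ ω, min (spreadFrom I ω) c ∂(asyncLaw G)

theorem truncatedMean_ne_top (G : SimpleGraph V) (c : ℕ) (I : Set V) :
    truncatedMean G c I ≠ ∞ := by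
  refine ne_top_of_le_ne_top (ENNReal.natCast_ne_top c) ?_
  refine (lintegral_mono fun ω => min_le_right _ _).trans ?_
  simp

/-- This is the first-step recursion at the first ring, with the idle calls cancelled from both
sides. The cancellation requires a finite quantity, hence the truncation at `c`; the constant `K`
does not depend on `c`. -/
theorem truncatedMean_le [Nonempty V] (hG : ∀ x, (G.neighborSet x).Nonempty) :
    ∃ K : ℝ≥0∞, K ≠ ∞ ∧ ∀ (c : ℕ) (I : Set V),
      ENNReal.ofReal (outRate G I) * truncatedMean G c I ≤
        K + ∑ e ∈ outEdges G I I, ENNReal.ofReal (edgeRate G e) *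
          truncatedMean G c (insert e.2 I) := by
  set n : ℝ := (Fintype.card V : ℝ) with hn
  have hn0 : 0 < n := by rw [hn]; exact_mod_cast Fintype.card_pos
  set K1 := ∫⁻ u in Set.Ioi (0 : ℝ), ENNReal.ofReal (Real.exp (-(n * u))) * ENNReal.ofReal u
  refine ⟨ENNReal.ofReal n * (K1 * ENNReal.ofReal n), ENNReal.mul_ne_top ENNReal.ofReal_ne_top
    (ENNReal.mul_ne_top (lintegral_Ioi_exp_mul_self_lt_top hn0).ne ENNReal.ofReal_ne_top),
    fun c I => ?_⟩
  set S := ∑ x, ∑ y, ENNReal.ofReal (callProb G x y) * truncatedMean G c (afterCall I x y) with hS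
  have h1 : truncatedMean G c I ≤ ∫⁻ u in Set.Ioi 0, ENNReal.ofReal (Real.exp (-(n * u))) *
      ∑ x, ∑ y, ENNReal.ofReal (callProb G x y) *
        (ENNReal.ofReal u + truncatedMean G c (afterCall I x y)) := by
    have := lintegral_asyncLaw_le hG (f := fun ω => min (spreadFrom I ω) c)
      (Φ := fun u x y ω => ENNReal.ofReal u + min (spreadFrom (afterCall I x y) ω) c)
      (fun x y => (ENNReal.measurable_ofReal.comp measurable_fst).add
        (((measurable_spreadFrom _).comp measurable_snd).min measurable_const))
      (fun x ω hx _ => ?_)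
    · refine this.trans (le_of_eq ?_)
      refine lintegral_congr fun u => ?_
      refine congrArg _ (Finset.sum_congr rfl fun x _ => Finset.sum_congr rfl fun y _ => ?_)
      rw [lintegral_add_left measurable_const, lintegral_const, measure_univ, mul_one]
      rfl
    · refine (min_le_min_right _ (spreadFrom_le_add hx)).trans ?_
      rw [← min_add_add_left]
      exact min_le_min_left _ le_add_self
  have h2 : truncatedMean G c I ≤ K1 * ENNReal.ofReal n + ENNReal.ofReal n⁻¹ * S := by
    refine h1.trans (le_of_eq ?_)
    rw [← lintegral_Ioi_exp_mul hn0, ← lintegral_mul_const _ (by fun_prop),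
      ← lintegral_mul_const _ (by fun_prop), ← lintegral_add_left (by fun_prop)]
    refine lintegral_congr fun u => ?_
    have h3 : ∑ x : V, ∑ y, ENNReal.ofReal (callProb G x y) * ENNReal.ofReal u =
        ENNReal.ofReal u * ENNReal.ofReal n := by
      simp only [← Finset.sum_mul, sum_ofReal_callProb hG, one_mul, Finset.sum_const,
        Finset.card_univ, nsmul_eq_mul, hn, ENNReal.ofReal_natCast]
      rw [mul_comm]
    simp only [mul_add, Finset.sum_add_distrib, h3, ← hS]
    ring
  have h3 : ENNReal.ofReal n * truncatedMean G c I ≤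
      ENNReal.ofReal n * (K1 * ENNReal.ofReal n) + S := by
    refine (mul_le_mul_right h2 _).trans (le_of_eq ?_)
    rw [mul_add, ← mul_assoc _ (ENNReal.ofReal n⁻¹), ← ENNReal.ofReal_mul hn0.le,
      mul_inv_cancel₀ hn0.ne', ENNReal.ofReal_one, one_mul]
  have h4 : ENNReal.ofReal n =
      ENNReal.ofReal (outRate G I) + ENNReal.ofReal (idleRate G I) := by
    rw [← ENNReal.ofReal_add (show 0 ≤ outRate G I from
      Finset.sum_nonneg fun e _ => (edgeRate_pos G e).le) (idleRate_nonneg G I), outRate_add_idleRate hG I, hn]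
  have h5 : ENNReal.ofReal (idleRate G I) * truncatedMean G c I ≠ ∞ :=
    ENNReal.mul_ne_top ENNReal.ofReal_ne_top (truncatedMean_ne_top G c I)
  set K := ENNReal.ofReal n * (K1 * ENNReal.ofReal n)
  rw [hS, sum_calls G I (φ := truncatedMean G c), h4, add_mul, ← add_assoc] at h3
  exact (ENNReal.add_le_add_iff_right h5).1 h3

/-- Induction on the number of uninformed vertices: by connectedness the rate of leaving `I` is
positive, so the recursion can be solved for `I` in terms of strictly larger sets. Uniformity in `c`
allows monotone convergence afterwards. -/
theorem exists_truncatedMean_le (hG : G.Connected) (hn : 1 < Fintype.card V) (I : Set V)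
    (hI : I.Nonempty) : ∃ K : ℝ≥0∞, K ≠ ∞ ∧ ∀ c : ℕ, truncatedMean G c I ≤ K := by
  classical
  have : Nonempty V := Fintype.card_pos_iff.1 (by omega)
  obtain ⟨K, hK, hle⟩ := truncatedMean_le (neighborSet_nonempty hG hn)
  induction hm : (Iᶜ).ncard using Nat.strong_induction_on generalizing I with
  | _ m ih =>
    by_cases h1 : I = Set.univ
    · refine ⟨0, by simp, fun c => ?_⟩
      simp [truncatedMean, h1, spreadFrom_univ]
    have hins : ∀ e ∈ outEdges G I I, ∃ K : ℝ≥0∞, K ≠ ∞ ∧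
        ∀ c : ℕ, truncatedMean G c (insert e.2 I) ≤ K := by
      intro e he
      refine ih _ ?_ _ (Set.insert_nonempty _ _) rfl
      rw [← hm]
      refine Set.ncard_lt_ncard ?_ (Set.toFinite _)
      refine ⟨Set.compl_subset_compl.2 (Set.subset_insert _ _), fun h => ?_⟩
      exact h (mem_outEdges.1 he).2.1 (Set.mem_insert _ _)
    choose! K' hK' hle' using hins
    have hpos := outRate_pos hG hI h1
    refine ⟨(ENNReal.ofReal (outRate G I))⁻¹ * (K + ∑ e ∈ outEdges G I I,
      ENNReal.ofReal (edgeRate G e) * K' e), ?_, fun c => ?_⟩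
    · refine ENNReal.mul_ne_top (ENNReal.inv_ne_top.2 (ENNReal.ofReal_pos.2 hpos).ne')
        (ENNReal.add_ne_top.2 ⟨hK, ?_⟩)
      exact ENNReal.sum_ne_top.2 fun e he => ENNReal.mul_ne_top ENNReal.ofReal_ne_top (hK' e he)
    · have h2 := (hle c I).trans (add_le_add_right (Finset.sum_le_sum fun e he =>
        mul_le_mul_right (hle' e he c) (ENNReal.ofReal (edgeRate G e))) K)
      rw [← ENNReal.div_eq_inv_mul, ENNReal.le_div_iff_mul_le
        (Or.inl (ENNReal.ofReal_pos.2 hpos).ne') (Or.inl ENNReal.ofReal_ne_top), mul_comm]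
      exact h2

theorem expectedAsync_lt_top (hG : G.Connected) (hn : 1 < Fintype.card V) (s : V) :
    expectedAsync G s < ∞ := by
  obtain ⟨K, hK, hle⟩ := exists_truncatedMean_le hG hn {s} (Set.singleton_nonempty s)
  refine lt_of_le_of_lt ?_ (lt_top_iff_ne_top.2 hK)
  refine (lintegral_mono fun ω => asyncSpreadTime_le_spreadFrom s ω).trans ?_
  have h1 : ∀ ω : AsyncOutcome V, spreadFrom {s} ω = ⨆ c : ℕ, min (spreadFrom {s} ω) (c : ℝ≥0∞) := by
    intro ω
    rw [← inf_iSup_eq, ENNReal.iSup_natCast, inf_top_eq]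
  rw [lintegral_congr h1, lintegral_iSup]
  · exact iSup_le hle
  · exact fun c => (measurable_spreadFrom _).min measurable_const
  · intro a b hab ω
    exact min_le_min_left _ (by exact_mod_cast hab)

/-- A lower bound on the expected spread time. -/
theorem mul_informedProb_compl_le (G : SimpleGraph V) (s : V) (t : ℝ) :
    ENNReal.ofReal t * (1 - informedProb G {s} t) ≤ expectedAsync G s := by
  have hm := measurableSet_informedBy_right (V := V) {s} t
  rw [informedProb, ← prob_compl_eq_one_sub hm, ← lintegral_indicator_one hm.compl,
    ← lintegral_const_mul _ (measurable_one.indicator hm.compl)]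
  refine lintegral_mono fun ω => ?_
  by_cases h : InformedBy {s} ω t
  · rw [Set.indicator_of_notMem (show ω ∉ {ω | InformedBy {s} ω t}ᶜ from fun h' => h' h)]
    simp
  · rw [Set.indicator_of_mem (show ω ∈ {ω | InformedBy {s} ω t}ᶜ from h), Pi.one_apply, mul_one]
    refine le_iInf₂ fun t' ht' => ENNReal.ofReal_le_ofReal ?_
    refine le_of_lt (not_le.1 fun hle => h fun v => ?_)
    exact .stay v t' t (asyncKnows_iff.1 (ht' v)) hle

end AsyncFinite

/-! ### Total weight of self-avoiding paths -/

section PathWeight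

variable {V : Type*} [Fintype V]

/-- A superharmonic potential of total mass at most `|V|`, dominating half of the expected number of
calls received. -/
theorem exists_potential (P : V → V → ℝ) (h0 : ∀ x y, 0 ≤ P x y) (h1 : ∀ x, ∑ y, P x y = 1) :
    ∃ b : V → ℝ, (∀ z, 0 ≤ b z) ∧ (∀ z, ∑ v, P v z * (1 + b v) ≤ 2 * b z) ∧
      ∑ z, b z ≤ Fintype.card V := by
  -- Fixed-point iteration from 0 for `2 b z = ∑ v, P v z * (1 + b v)`. It is increasing, and since
  -- the rows of `P` sum to 1, total mass at most `|V|` is preserved: `(|V| + |V|) / 2 = |V|`.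
  set B : ℕ → V → ℝ := fun j => j.rec (fun _ => 0) fun _ b z => (∑ v, P v z * (1 + b v)) / 2 with hB
  have hs : ∀ j z, B (j + 1) z = (∑ v, P v z * (1 + B j v)) / 2 := fun j z => rfl
  have hz : ∀ z, B 0 z = 0 := fun z => rfl
  have hnn : ∀ j z, 0 ≤ B j z := by
    intro j
    induction j with
    | zero => intro z; exact le_of_eq (hz z).symm
    | succ j ih =>
      intro z
      rw [hs]
      exact div_nonneg (Finset.sum_nonneg fun v _ => mul_nonneg (h0 v z) (by linarith [ih v]))
        zero_le_two
  have hmono : ∀ j z, B j z ≤ B (j + 1) z := by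
    intro j
    induction j with
    | zero => intro z; rw [hz]; exact hnn 1 z
    | succ j ih =>
      intro z
      rw [hs j, hs (j + 1)]
      refine div_le_div_of_nonneg_right (Finset.sum_le_sum fun v _ => ?_) zero_le_two
      exact mul_le_mul_of_nonneg_left (by linarith [ih v]) (h0 v z)
  have hsum : ∀ j, ∑ z, B j z ≤ Fintype.card V := by
    intro j
    induction j with
    | zero => simp [hz]
    | succ j ih =>
      simp only [hs, ← Finset.sum_div]
      rw [Finset.sum_comm]
      simp only [← Finset.sum_mul, h1, one_mul, Finset.sum_add_distrib, Finset.sum_const,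
        Finset.card_univ, nsmul_eq_mul, mul_one]
      linarith
  have hbdd : ∀ z, BddAbove (Set.range fun j => B j z) := fun z => by
    refine ⟨Fintype.card V, ?_⟩
    rintro _ ⟨j, rfl⟩
    exact (Finset.single_le_sum (fun z _ => hnn j z) (Finset.mem_univ z)).trans (hsum j)
  have hlim : ∀ z, Filter.Tendsto (fun j => B j z) Filter.atTop (nhds (⨆ j, B j z)) := fun z =>
    tendsto_atTop_ciSup (monotone_nat_of_le_succ fun j => hmono j z) (hbdd z)
  refine ⟨fun z => ⨆ j, B j z, fun z => ge_of_tendsto' (hlim z) fun j => hnn j z, fun z => ?_, ?_⟩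
  · have h2 : Filter.Tendsto (fun j => ∑ v, P v z * (1 + B j v)) Filter.atTop
        (nhds (∑ v, P v z * (1 + ⨆ j, B j v))) :=
      tendsto_finsetSum _ fun v _ => ((hlim v).const_add 1).const_mul _
    refine le_of_tendsto' h2 fun j => ?_
    have := le_ciSup (hbdd z) (j + 1)
    simp only [hs] at this
    linarith
  · exact le_of_tendsto' (tendsto_finsetSum _ fun z _ => hlim z) hsum

variable [DecidableEq V]

/-- The weight of the self-avoiding paths of length `j` from `z` outside `A`, where the step from
`x` to `y` has weight `P x y + P y x`. -/
noncomputable def pathWeight (P : V → V → ℝ) : ℕ → V → Finset V → ℝ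
  | 0, _, _ => 1
  | j + 1, z, A => ∑ y ∈ (insert z A)ᶜ, (P z y + P y z) * pathWeight P j y (insert z A)

theorem pathWeight_nonneg {P : V → V → ℝ} (h0 : ∀ x y, 0 ≤ P x y) (j : ℕ) (z : V)
    (A : Finset V) : 0 ≤ pathWeight P j z A := by
  induction j generalizing z A with
  | zero => exact zero_le_one
  | succ j ih => exact Finset.sum_nonneg fun y _ => mul_nonneg (add_nonneg (h0 _ _) (h0 _ _)) (ih _ _)

/-- The minimum balances the two kinds of step. For pushes the bound `μ` at the next vertex is used,
with total step weight at most 1. For pulls the bound `1 + b y` is used, and the potential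
inequality turns the sum into `2 * b z`. The factor `1 + κ * b z` pays for the pulls at `z`; as the
path avoids itself, each vertex supplies its factor only once. -/
theorem pathWeight_le_min {P : V → V → ℝ} (h0 : ∀ x y, 0 ≤ P x y) (h1 : ∀ x, ∑ y, P x y = 1)
    {b : V → ℝ} (hb0 : ∀ z, 0 ≤ b z) (hb : ∀ z, ∑ v, P v z * (1 + b v) ≤ 2 * b z) {κ μ : ℝ}
    (hκ : 0 ≤ κ) (hμ : 2 ≤ μ) (hμκ : 2 ≤ μ ^ 2 * κ) (j : ℕ) (z : V) (A : Finset V) (hz : z ∉ A) :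
    pathWeight P j z A ≤ μ ^ j * (∏ x ∈ Aᶜ, (1 + κ * b x)) * min μ (1 + b z) := by
  have hg : ∀ A : Finset V, 1 ≤ ∏ x ∈ Aᶜ, (1 + κ * b x) := fun A =>
    Finset.prod_const_one.symm.le.trans (Finset.prod_le_prod (fun _ _ => zero_le_one)
      fun x _ => by linarith [mul_nonneg hκ (hb0 x)])
  induction j generalizing z A with
  | zero =>
    have : 1 ≤ min μ (1 + b z) := le_min (by linarith) (by linarith [hb0 z])
    have := one_le_mul_of_one_le_of_one_le (hg A) this
    simpa [pathWeight] using this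
  | succ j ih =>
    set A' := insert z A with hA'
    set g := ∏ x ∈ A'ᶜ, (1 + κ * b x) with hgdef
    have hgA : ∏ x ∈ Aᶜ, (1 + κ * b x) = (1 + κ * b z) * g := by
      rw [hgdef, hA', Finset.compl_insert, Finset.mul_prod_erase _ fun x => 1 + κ * b x]
      simpa using hz
    have hμj : 0 ≤ μ ^ j * g := mul_nonneg (pow_nonneg (by linarith) j) (by linarith [hg A'])
    have hpush : ∑ y ∈ A'ᶜ, P z y * pathWeight P j y A' ≤ μ ^ j * g * μ := by
      calc _ ≤ ∑ y ∈ A'ᶜ, P z y * (μ ^ j * g * μ) := by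
            refine Finset.sum_le_sum fun y hy => mul_le_mul_of_nonneg_left ?_ (h0 _ _)
            exact (ih y A' (Finset.mem_compl.1 hy)).trans
              (mul_le_mul_of_nonneg_left (min_le_left _ _) hμj)
        _ ≤ 1 * (μ ^ j * g * μ) := by
            rw [← Finset.sum_mul]
            refine mul_le_mul_of_nonneg_right ?_ (mul_nonneg hμj (by linarith))
            rw [← h1 z]
            exact Finset.sum_le_sum_of_subset_of_nonneg (Finset.subset_univ _) fun y _ _ => h0 _ _
        _ = _ := one_mul _
    have hpull : ∑ y ∈ A'ᶜ, P y z * pathWeight P j y A' ≤ μ ^ j * g * (2 * b z) := by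
      calc _ ≤ ∑ y ∈ A'ᶜ, P y z * (μ ^ j * g * (1 + b y)) := by
            refine Finset.sum_le_sum fun y hy => mul_le_mul_of_nonneg_left ?_ (h0 _ _)
            exact (ih y A' (Finset.mem_compl.1 hy)).trans
              (mul_le_mul_of_nonneg_left (min_le_right _ _) hμj)
        _ ≤ ∑ y, P y z * (μ ^ j * g * (1 + b y)) :=
            Finset.sum_le_sum_of_subset_of_nonneg (Finset.subset_univ _) fun y _ _ =>
              mul_nonneg (h0 _ _) (mul_nonneg hμj (by linarith [hb0 y]))
        _ = μ ^ j * g * ∑ y, P y z * (1 + b y) := by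
            rw [Finset.mul_sum]; exact Finset.sum_congr rfl fun y _ => by ring
        _ ≤ _ := mul_le_mul_of_nonneg_left (hb z) hμj
    have hsum : pathWeight P (j + 1) z A ≤ μ ^ j * g * (μ + 2 * b z) := by
      rw [pathWeight, ← hA']
      simp only [add_mul, Finset.sum_add_distrib]
      linarith
    -- If the minimum is `μ`, then `μ² ≥ μ` and `μ² κ ≥ 2` suffice; if it is `1 + b z`, then `μ ≥ 2`
    -- does.
    have key : μ + 2 * b z ≤ μ * (1 + κ * b z) * min μ (1 + b z) := by
      have hbz := hb0 z
      have hκb : 0 ≤ κ * b z := mul_nonneg hκ hbz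
      rcases min_choice μ (1 + b z) with h | h <;> rw [h]
      · nlinarith [mul_le_mul_of_nonneg_right hμκ hbz]
      · nlinarith [mul_nonneg (mul_nonneg (by linarith : 0 ≤ μ) hκb) (by linarith : 0 ≤ 1 + b z),
          mul_le_mul_of_nonneg_right hμ hbz]
    refine hsum.trans ((mul_le_mul_of_nonneg_left key hμj).trans (le_of_eq ?_))
    rw [hgA]; ring

/-- The product of the factors `1 + κ * b x` is at most `exp (κ * ∑ x, b x)`, and the potential has
total mass at most `|V|`. -/
theorem pathWeight_le {P : V → V → ℝ} (h0 : ∀ x y, 0 ≤ P x y) (h1 : ∀ x, ∑ y, P x y = 1)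
    {κ μ : ℝ} (hκ : 0 ≤ κ) (hμ : 2 ≤ μ) (hμκ : 2 ≤ μ ^ 2 * κ) (j : ℕ) (z : V) :
    pathWeight P j z ∅ ≤ μ ^ (j + 1) * Real.exp (κ * Fintype.card V) := by
  obtain ⟨b, hb0, hb, hbs⟩ := exists_potential P h0 h1
  refine (pathWeight_le_min h0 h1 hb0 hb hκ hμ hμκ j z ∅ (by simp)).trans ?_
  have hg : ∏ x ∈ (∅ : Finset V)ᶜ, (1 + κ * b x) ≤ Real.exp (κ * Fintype.card V) := by
    calc _ ≤ ∏ x ∈ (∅ : Finset V)ᶜ, Real.exp (κ * b x) :=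
          Finset.prod_le_prod (fun x _ => by linarith [mul_nonneg hκ (hb0 x)]) fun x _ => by
            linarith [Real.add_one_le_exp (κ * b x)]
      _ = Real.exp (κ * ∑ x, b x) := by
          rw [← Real.exp_sum, Finset.mul_sum, Finset.compl_empty]
      _ ≤ _ := Real.exp_le_exp.2 (mul_le_mul_of_nonneg_left hbs hκ)
  have hμj : 0 ≤ μ ^ j := pow_nonneg (by linarith) j
  calc _ ≤ μ ^ j * Real.exp (κ * Fintype.card V) * μ := by
        refine mul_le_mul (mul_le_mul_of_nonneg_left hg hμj) (min_le_left _ _)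
          (le_min (by linarith) (by linarith [hb0 z])) (mul_nonneg hμj (Real.exp_pos _).le)
    _ = _ := by ring

end PathWeight

/-! ### Fast paths are short, and rounding is cheap on them -/

section LongPaths

variable {V : Type*} [Fintype V] [DecidableEq V] {G : SimpleGraph V}

open Classical in
/-- The exponential sum over the self-avoiding paths of length `j` from `z` outside `A`. -/
noncomputable def pathSum (G : SimpleGraph V) (θ : ℝ) : ℕ → V → Finset V → (V × V → ℝ) → ℝ≥0∞
  | 0, _, _, _ => 1
  | j + 1, z, A, w => ∑ y ∈ (insert z A)ᶜ with G.Adj z y,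
      ENNReal.ofReal (Real.exp (-(θ * w (z, y)))) * pathSum G θ j y (insert z A) w

theorem measurable_pathSum (θ : ℝ) (j : ℕ) (z : V) (A : Finset V) :
    Measurable (pathSum G θ j z A) := by
  induction j generalizing z A with
  | zero => exact measurable_const
  | succ j ih =>
    classical
    have hm : ∀ y, Measurable fun w : V × V → ℝ => ENNReal.ofReal (Real.exp (-(θ * w (z, y)))) :=
      fun y => by fun_prop
    change Measurable fun w => pathSum G θ (j + 1) z A w
    simp only [pathSum]
    exact Finset.measurable_sum _ fun y _ => (hm y).mul (ih _ _)

/-- A path that avoids `A` uses only edges starting outside `A`; this makes the first edge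
independent of the remaining sum. -/
theorem pathSum_congr {θ : ℝ} {w w' : V × V → ℝ} (j : ℕ) (z : V) (A : Finset V) (hz : z ∉ A)
    (h : ∀ e : V × V, e.1 ∉ A → w e = w' e) : pathSum G θ j z A w = pathSum G θ j z A w' := by
  induction j generalizing z A with
  | zero => rfl
  | succ j ih =>
    classical
    simp only [pathSum]
    refine Finset.sum_congr rfl fun y hy => ?_
    rw [Finset.mem_filter, Finset.mem_compl] at hy
    rw [h (z, y) hz, ih y _ hy.1 fun e he => h e fun h' => he (Finset.mem_insert_of_mem h')]

/-- The exact value is `r / (r + θ)`. The weaker bound is linear in the rate, so the rates along a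
path multiply to its weight. -/
theorem lintegral_exp_neg_mul_le {r θ : ℝ} (hr : 0 < r) (hθ : 0 < θ) :
    ∫⁻ x, ENNReal.ofReal (Real.exp (-(θ * x))) ∂(expMeasure r) ≤ ENNReal.ofReal (r / θ) := by
  rw [lintegral_expMeasure _ (by fun_prop)]
  calc _ ≤ ∫⁻ x in Set.Ioi (0 : ℝ), ENNReal.ofReal r * ENNReal.ofReal (Real.exp (-(θ * x))) := by
        refine setLIntegral_mono (by fun_prop) fun x hx => ?_
        refine mul_le_mul_left (ENNReal.ofReal_le_ofReal ?_) _
        refine mul_le_of_le_one_right hr.le (Real.exp_le_one_iff.2 ?_)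
        have := mul_pos hr (Set.mem_Ioi.1 hx)
        linarith
    _ = ENNReal.ofReal (r / θ) := by
        rw [lintegral_const_mul _ (by fun_prop), lintegral_Ioi_exp_mul hθ,
          ← ENNReal.ofReal_mul hr.le]
        rfl

theorem lintegral_pathSum_le {θ : ℝ} (hθ : 0 < θ) (j : ℕ) (z : V) (A : Finset V) (hz : z ∉ A) :
    ∫⁻ w, pathSum G θ j z A w ∂(fppLaw G) ≤
      ENNReal.ofReal (θ⁻¹ ^ j * pathWeight (callProb G) j z A) := by
  classical
  have hP := callProb_nonneg G
  induction j generalizing z A with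
  | zero => simp [pathSum, pathWeight]
  | succ j ih =>
    simp only [pathSum, pathWeight]
    have hm : ∀ y, Measurable fun w : V × V → ℝ => ENNReal.ofReal (Real.exp (-(θ * w (z, y)))) :=
      fun y => by fun_prop
    rw [lintegral_finsetSum (f := fun y w => ENNReal.ofReal (Real.exp (-(θ * w (z, y)))) *
        pathSum G θ j y (insert z A) w) _ fun y _ => (hm y).mul (measurable_pathSum _ _ _ _),
      Finset.mul_sum, ENNReal.ofReal_sum_of_nonneg fun y _ => mul_nonneg (by positivity)
        (mul_nonneg (add_nonneg (hP _ _) (hP _ _)) (pathWeight_nonneg hP _ _ _))]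
    refine (Finset.sum_le_sum fun y hy => ?_).trans
      (Finset.sum_le_sum_of_subset (Finset.filter_subset _ _))
    rw [Finset.mem_filter, Finset.mem_compl] at hy
    have h1 := lintegral_infinitePi_mul (fun e => expMeasure (edgeRate G e)) {(z, y)} (hm y)
      (measurable_pathSum (G := G) θ j y (insert z A))
      (fun w w' h => by rw [h (z, y) rfl])
      (fun w w' h => pathSum_congr j y _ hy.1 fun e he => h e fun h' => he (by
        rw [Set.mem_singleton_iff] at h'
        simp [h']))
    rw [fppLaw, h1]
    have h2 : ∫⁻ w, ENNReal.ofReal (Real.exp (-(θ * w (z, y))))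
        ∂(Measure.infinitePi fun e => expMeasure (edgeRate G e)) ≤
          ENNReal.ofReal ((callProb G z y + callProb G y z) / θ) := by
      rw [(measurePreserving_eval_infinitePi (fun e => expMeasure (edgeRate G e))
        (z, y)).lintegral_comp (f := fun x : ℝ => ENNReal.ofReal (Real.exp (-(θ * x))))
          (by fun_prop)]
      refine (lintegral_exp_neg_mul_le (edgeRate_pos G _) hθ).trans (le_of_eq ?_)
      rw [edgeRate, if_pos hy.2]
    refine (mul_le_mul' h2 (ih y _ hy.1)).trans (le_of_eq ?_)
    rw [← ENNReal.ofReal_mul (div_nonneg (add_nonneg (hP _ _) (hP _ _)) hθ.le)]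
    congr 1
    rw [pow_succ]
    ring

/-- The initial segment of `j` edges is one of the paths summed over, and its cost is at most that
of the whole path. -/
theorem le_pathSum {θ : ℝ} (hθ : 0 ≤ θ) {w : V × V → ℝ} (j : ℕ) {z v : V} (p : G.Walk z v)
    (hp : p.IsPath) (A : Finset V) (hA : ∀ x ∈ p.support, x ∉ A) (hj : j ≤ p.length)
    (hw : ∀ d ∈ p.darts, 0 ≤ w d.toProd) :
    ENNReal.ofReal (Real.exp (-(θ * walkCost w p))) ≤ pathSum G θ j z A w := by
  have hnn : ∀ {a b : V} (q : G.Walk a b), (∀ d ∈ q.darts, 0 ≤ w d.toProd) → 0 ≤ walkCost w q :=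
    fun q hq => List.sum_nonneg fun x hx => by
      obtain ⟨d, hd, rfl⟩ := List.mem_map.1 hx
      exact hq d hd
  induction j generalizing z A with
  | zero =>
    simp only [pathSum]
    rw [← ENNReal.ofReal_one]
    refine ENNReal.ofReal_le_ofReal (Real.exp_le_one_iff.2 ?_)
    linarith [mul_nonneg hθ (hnn p hw)]
  | succ j ih =>
    cases p with
    | nil => simp at hj
    | @cons _ y _ hadj q =>
      rw [SimpleGraph.Walk.cons_isPath_iff] at hp
      simp only [SimpleGraph.Walk.support_cons, List.mem_cons, forall_eq_or_imp] at hA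
      simp only [SimpleGraph.Walk.darts_cons, List.mem_cons, forall_eq_or_imp] at hw
      have hq : ∀ x ∈ q.support, x ∉ insert z A := fun x hx => by
        rw [Finset.mem_insert, not_or]
        exact ⟨fun h => hp.2 (h ▸ hx), hA.2 x hx⟩
      have h1 := ih q hp.1 (insert z A) hq (by simpa using hj) hw.2
      rw [walkCost_cons, mul_add, neg_add, Real.exp_add, ENNReal.ofReal_mul (Real.exp_pos _).le]
      refine (mul_le_mul_right h1 _).trans ?_
      simp only [pathSum]
      classical
      exact Finset.single_le_sum (f := fun y => ENNReal.ofReal (Real.exp (-(θ * w (z, y)))) *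
        pathSum G θ j y (insert z A) w) (fun _ _ => zero_le) (by
          rw [Finset.mem_filter, Finset.mem_compl]
          exact ⟨hq y q.start_mem_support, hadj⟩)

/-- With high probability no long self-avoiding path is fast. -/
theorem fppLaw_le_pathSum_le (hG : ∀ x, (G.neighborSet x).Nonempty) {θ κ μ t : ℝ} (hθ : 0 < θ)
    (hκ : 0 ≤ κ) (hμ : 2 ≤ μ) (hμκ : 2 ≤ μ ^ 2 * κ) (j : ℕ) (z : V) :
    fppLaw G {w | ENNReal.ofReal (Real.exp (-(θ * t))) ≤ pathSum G θ j z ∅ w} ≤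
      ENNReal.ofReal (Real.exp (θ * t) *
        (θ⁻¹ ^ j * (μ ^ (j + 1) * Real.exp (κ * Fintype.card V)))) := by
  have h1 := mul_meas_ge_le_lintegral (μ := fppLaw G) (measurable_pathSum (G := G) θ j z ∅)
    (ENNReal.ofReal (Real.exp (-(θ * t))))
  have h2 := h1.trans (lintegral_pathSum_le hθ j z ∅ (by simp))
  have h3 := mul_le_mul_right h2 (ENNReal.ofReal (Real.exp (θ * t)))
  rw [← mul_assoc, ← ENNReal.ofReal_mul (Real.exp_pos _).le, ← Real.exp_add, add_neg_cancel,
    Real.exp_zero, ENNReal.ofReal_one, one_mul, ← ENNReal.ofReal_mul (Real.exp_pos _).le] at h3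
  refine h3.trans (ENNReal.ofReal_le_ofReal ?_)
  refine mul_le_mul_of_nonneg_left ?_ (Real.exp_pos _).le
  refine mul_le_mul_of_nonneg_left ?_ (by positivity)
  exact pathWeight_le (callProb_nonneg G) (fun x => sum_callProb G (hG x)) hκ hμ hμκ j z

/-- The left side is `(e² * (t / L) * μ) ^ L * μ` with `μ² = 2n / L`. The square of the base is `2
e⁴ t² n / L³`, which the cubic hypothesis makes at most `1/64`, and the last factor is absorbed by
`μ ≤ L ≤ 2 ^ L`. -/
theorem longPath_bound_le {n t : ℝ} {L : ℕ} (ht : 1 / 3 ≤ t) (hL : 1 ≤ L)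
    (hL3 : 8000 * (t ^ 2 * n) ≤ L ^ 3) (hn : 2 * L ≤ n) :
    Real.exp (L / t * t) * ((L / t)⁻¹ ^ L * (√(2 * n / L) ^ (L + 1) * Real.exp (L / n * n))) ≤
      1 / 4 := by
  have hL0 : (1 : ℝ) ≤ L := by exact_mod_cast hL
  have ht0 : 0 < t := by linarith
  have hn0 : 0 < n := by linarith
  set μ := √(2 * n / L) with hμ
  have hμ2 : μ ^ 2 = 2 * n / L := Real.sq_sqrt (by positivity)
  have hμ0 : 0 ≤ μ := Real.sqrt_nonneg _
  have he : Real.exp 1 < 2.7182818286 := Real.exp_one_lt_d9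
  have he0 := Real.exp_pos 1
  have he4 : Real.exp 1 ^ 4 ≤ 60 := by
    calc _ ≤ (2.7182818286 : ℝ) ^ 4 := by gcongr
      _ ≤ 60 := by norm_num
  -- the base of the geometric factor
  have hbase : Real.exp 1 ^ 2 * (t / L) * μ ≤ 1 / 8 := by
    refine abs_le_of_sq_le_sq' (a := Real.exp 1 ^ 2 * (t / L) * μ) ?_ (by norm_num) |>.2
    have : (Real.exp 1 ^ 2 * (t / L) * μ) ^ 2 = Real.exp 1 ^ 4 * (2 * (t ^ 2 * n) / L ^ 3) := by
      rw [mul_pow, hμ2]; field_simp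
    rw [this]
    have h2 : 2 * (t ^ 2 * n) / (L : ℝ) ^ 3 ≤ 1 / 4000 := by
      rw [div_le_div_iff₀ (by positivity) (by norm_num)]
      linarith
    calc _ ≤ 60 * (1 / 4000 : ℝ) := mul_le_mul he4 h2 (by positivity) (by norm_num)
      _ ≤ _ := by norm_num
  -- Here `t ≥ 1/3` enters: `n ≤ 9 t² n`, which the cubic hypothesis bounds by a small multiple of
  -- `L³`.
  have hμL : μ ≤ L := by
    refine abs_le_of_sq_le_sq' (a := μ) ?_ (by linarith) |>.2
    rw [hμ2, div_le_iff₀ (by linarith)]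
    have : (1 / 3 : ℝ) ^ 2 * n ≤ t ^ 2 * n := by gcongr
    nlinarith
  have h2L : (L : ℝ) ≤ 2 ^ L := by exact_mod_cast Nat.lt_two_pow_self.le
  calc _ = (Real.exp 1 ^ 2 * (t / L) * μ) ^ L * μ := by
        rw [div_mul_cancel₀ _ ht0.ne', div_mul_cancel₀ _ hn0.ne', inv_div, mul_pow, mul_pow,
          ← pow_mul, pow_succ, ← mul_one (L : ℝ), Real.exp_nat_mul, mul_one]
        ring
    _ ≤ (1 / 8) ^ L * 2 ^ L := by
        gcongr
        exact hμL.trans h2L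
    _ = (1 / 4) ^ L := by rw [← mul_pow]; norm_num
    _ ≤ (1 / 4) ^ 1 := pow_le_pow_of_le_one (by norm_num) (by norm_num) hL
    _ = _ := by norm_num

/-- Rounding adds at most one unit to each edge. -/
theorem walkCost_rounded_le {R : ℝ} (hR : 0 < R) {w : V × V → ℝ} {u v : V} (p : G.Walk u v)
    (hp : ∀ d ∈ p.darts, 0 ≤ w d.toProd) :
    walkCost (rounded R w) p ≤ walkCost w p / R + p.length := by
  induction p with
  | nil => simp
  | cons h p ih =>
    simp only [SimpleGraph.Walk.darts_cons, List.mem_cons, forall_eq_or_imp] at hp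
    have h1 := ih hp.2
    have h2 := Nat.floor_le (div_nonneg hp.1 hR.le)
    simp only [walkCost_cons, SimpleGraph.Walk.length_cons, add_div, rounded] at h2 ⊢
    simp only [walkCost, rounded] at h1 ⊢
    push_cast
    linarith

theorem walkCost_bypass_le {w : V × V → ℝ} {u v : V} (p : G.Walk u v)
    (hp : ∀ d ∈ p.darts, 0 ≤ w d.toProd) : walkCost w p.bypass ≤ walkCost w p := by
  refine List.Sublist.sum_le_sum (p.darts_bypass_sublist_darts.map _) fun x hx => ?_
  obtain ⟨d, hd, rfl⟩ := List.mem_map.1 hx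
  exact hp d hd

/-- Covering by time `t` survives the rounding of passage times if `L` is of larger order than
`t ^ (2 / 3) * |V| ^ (1 / 3)`. -/
theorem roundedProb_ge (hG : ∀ x, (G.neighborSet x).Nonempty) {s : V} {t R m : ℝ} {L : ℕ}
    (hcov : ENNReal.ofReal (3 / 4) ≤ coverProb G {s} t) (ht : 1 / 3 ≤ t) (hL : 1 ≤ L)
    (hL3 : 8000 * (t ^ 2 * Fintype.card V) ≤ L ^ 3) (hR : 0 < R) (hm : t / R + 2 * L ≤ m) :
    ENNReal.ofReal (1 / 2) ≤ roundedProb G R {s} m := by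
  have hL0 : (1 : ℝ) ≤ L := by exact_mod_cast hL
  have ht0 : 0 < t := by linarith
  have hfast : ∀ {w : V × V → ℝ} {v : V} (p : G.Walk s v), (∀ d ∈ p.darts, 0 ≤ w d.toProd) →
      walkCost w p ≤ t → p.length ≤ 2 * L → Passage G (rounded R w) {s} v m := by
    intro w v p hp hpt hlen
    refine passage_iff.2 ⟨s, rfl, p, fun d _ => zero_le_one.trans (one_le_rounded _ _ _), ?_⟩
    refine (walkCost_rounded_le hR p hp).trans (le_trans ?_ hm)
    have h1 : (p.length : ℝ) ≤ 2 * L := by exact_mod_cast hlen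
    have h2 := div_le_div_of_nonneg_right hpt hR.le
    linarith
  have hpath : ∀ {w : V × V → ℝ} {v : V}, Passage G w {s} v t → ∃ p : G.Walk s v, p.IsPath ∧
      (∀ d ∈ p.darts, 0 ≤ w d.toProd) ∧ walkCost w p ≤ t := by
    intro w v h
    obtain ⟨a, rfl, p, hp, hpt⟩ := passage_iff.1 h
    exact ⟨p.bypass, p.bypass_isPath, fun d hd => hp d (p.darts_bypass_sublist_darts.subset hd),
      (walkCost_bypass_le p hp).trans hpt⟩
  by_cases hn : 2 * (L : ℝ) ≤ Fintype.card V
  · set n : ℝ := (Fintype.card V : ℝ) with hndef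
    have hn0 : 0 < n := by linarith
    set θ : ℝ := L / t with hθ
    -- The value `θ = L / t` minimises `exp (θ t) * θ ^ (-L)`. Outside `bad` no self-avoiding path
    -- from `s` of cost at most `t` has `L` or more edges.
    set bad : Set (V × V → ℝ) :=
      {w | ENNReal.ofReal (Real.exp (-(θ * t))) ≤ pathSum G θ L s ∅ w} with hbad
    have hθ0 : 0 < θ := by positivity
    have hbadle : fppLaw G bad ≤ ENNReal.ofReal (1 / 4) := by
      have hμ : 2 ≤ √(2 * n / L) := by
        refine Real.le_sqrt_of_sq_le ?_
        rw [le_div_iff₀ (by linarith)]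
        linarith
      refine (fppLaw_le_pathSum_le hG (κ := L / n) hθ0 (by positivity) hμ ?_ L s).trans
        (ENNReal.ofReal_le_ofReal (longPath_bound_le ht hL hL3 hn))
      rw [Real.sq_sqrt (by positivity)]
      refine le_of_eq ?_
      field_simp
    have hsub : {w | Covers G w {s} t} ⊆ {w | Covers G (rounded R w) {s} m} ∪ bad := by
      intro w hw
      by_cases hb : w ∈ bad
      · exact Or.inr hb
      refine Or.inl fun v => ?_
      obtain ⟨p, hp, hp0, hpt⟩ := hpath (hw v)
      refine hfast p hp0 hpt ?_
      by_contra hlen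
      refine hb ((ENNReal.ofReal_le_ofReal (Real.exp_le_exp.2 ?_)).trans
        (le_pathSum hθ0.le L p hp ∅ (by simp) (by omega) hp0))
      exact neg_le_neg (mul_le_mul_of_nonneg_left hpt hθ0.le)
    have h1 := hcov.trans ((measure_mono hsub).trans
      ((measure_union_le _ _).trans (add_le_add_right hbadle _)))
    have h2 : ENNReal.ofReal (3 / 4) = ENNReal.ofReal (1 / 2) + ENNReal.ofReal (1 / 4) := by
      rw [← ENNReal.ofReal_add (by norm_num) (by norm_num)]; norm_num
    rw [h2] at h1
    exact (ENNReal.add_le_add_iff_right ENNReal.ofReal_ne_top).1 h1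
  -- If `|V| < 2L`, every self-avoiding path has fewer than `2L` edges. This case is the reason for
  -- allowing `2L` edges rather than `L`.
  · refine le_trans (ENNReal.ofReal_le_ofReal (by norm_num)) (hcov.trans (measure_mono ?_))
    intro w hw v
    obtain ⟨p, hp, hp0, hpt⟩ := hpath (hw v)
    refine hfast p hp0 hpt ?_
    have h1 := hp.length_lt
    have h2 : Fintype.card V < 2 * L := by exact_mod_cast not_le.1 hn
    omega

end LongPaths

/-! ### A priori bounds for percolation covering times -/

section FppBounds

variable {V : Type*} [Fintype V] {G : SimpleGraph V}

theorem fppLaw_eval (G : SimpleGraph V) (e : V × V) {s : Set ℝ} (hs : MeasurableSet s) :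
    fppLaw G {w | w e ∈ s} = expMeasure (edgeRate G e) s :=
  (measurePreserving_eval_infinitePi (fun e => expMeasure (edgeRate G e)) e).measure_preimage
    hs.nullMeasurableSet

theorem expMeasure_Iic_le {r : ℝ} (hr : 0 < r) (t : ℝ) :
    expMeasure r (Set.Iic t) ≤ ENNReal.ofReal (t * r) := by
  rw [← lintegral_indicator_one measurableSet_Iic,
    lintegral_expMeasure _ (measurable_one.indicator measurableSet_Iic)]
  calc _ ≤ ∫⁻ x in Set.Ioi (0 : ℝ), (Set.Iic t).indicator (fun _ => ENNReal.ofReal r) x := by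
        refine setLIntegral_mono (measurable_const.indicator measurableSet_Iic) fun x hx => ?_
        by_cases h : x ∈ Set.Iic t
        · rw [Set.indicator_of_mem h, Set.indicator_of_mem h, Pi.one_apply, mul_one]
          refine ENNReal.ofReal_le_ofReal (mul_le_of_le_one_right hr.le (Real.exp_le_one_iff.2 ?_))
          have := mul_pos hr (Set.mem_Ioi.1 hx)
          linarith
        · rw [Set.indicator_of_notMem h, mul_zero]; exact zero_le
    _ = ENNReal.ofReal (t * r) := by
        rw [lintegral_indicator_const measurableSet_Iic, Measure.restrict_apply measurableSet_Iic,
          Set.Iic_inter_Ioi, Real.volume_Ioc, sub_zero, ← ENNReal.ofReal_mul hr.le, mul_comm]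

/-- All call probabilities add up to `n`, so their average over the `n - 1` possible targets other
than `s` is at most `n / (n - 1) ≤ 2`. -/
theorem exists_sum_callProb_le (hG : ∀ x, (G.neighborSet x).Nonempty) (hn : 1 < Fintype.card V)
    (s : V) : ∃ v, v ≠ s ∧ ∑ x, callProb G x v ≤ 2 := by
  classical
  by_contra! h
  have h1 : ∑ v, ∑ x, callProb G x v = Fintype.card V := by
    rw [Finset.sum_comm]
    simp [sum_callProb G (hG _)]
  have h2 : ∑ v ∈ Finset.univ.erase s, (2 : ℝ) < ∑ v ∈ Finset.univ.erase s, ∑ x, callProb G x v := by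
    refine Finset.sum_lt_sum_of_nonempty ?_ fun v hv => h v (Finset.ne_of_mem_erase hv)
    rw [← Finset.card_pos, Finset.card_erase_of_mem (Finset.mem_univ s), Finset.card_univ]
    omega
  have h3 : ∑ v ∈ Finset.univ.erase s, ∑ x, callProb G x v ≤ ∑ v, ∑ x, callProb G x v :=
    Finset.sum_le_sum_of_subset_of_nonneg (Finset.subset_univ _) fun v _ _ =>
      Finset.sum_nonneg fun x _ => callProb_nonneg G x v
  rw [Finset.sum_const, Finset.card_erase_of_mem (Finset.mem_univ s), Finset.card_univ,
    nsmul_eq_mul, Nat.cast_sub hn.le] at h2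
  have h4 : (2 : ℝ) ≤ Fintype.card V := by exact_mod_cast hn
  push_cast at h2
  linarith

/-- To reach the vertex `v` of the preceding lemma, some edge into `v` must have passage time at
most `t`. The rates of these edges total at most 3: at most 2 from calls to `v` and 1 from calls by
`v`. -/
theorem coverProb_le (hG : ∀ x, (G.neighborSet x).Nonempty) (hn : 1 < Fintype.card V) (s : V)
    {t : ℝ} (ht : 0 ≤ t) : coverProb G {s} t ≤ ENNReal.ofReal (3 * t) := by
  classical
  obtain ⟨v, hvs, hv⟩ := exists_sum_callProb_le hG hn s
  have hsub : {w | Covers G w {s} t} ⊆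
      ⋃ x ∈ Finset.univ.filter fun x => G.Adj x v, {w : V × V → ℝ | w (x, v) ∈ Set.Iic t} := by
    intro w hw
    have hw' : Passage G w {s} v t := hw v
    simp only [Finset.mem_filter, Finset.mem_univ, true_and, Set.mem_iUnion]
    cases hw' with
    | start _ _ h _ => exact absurd h hvs
    | step x _ t' _ h1 h2 h3 h4 =>
      refine ⟨x, h2, ?_⟩
      change w (x, v) ≤ t
      linarith [h1.nonneg]
  calc coverProb G {s} t ≤ ∑ x ∈ Finset.univ.filter fun x => G.Adj x v,
        fppLaw G {w | w (x, v) ∈ Set.Iic t} :=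
        (measure_mono hsub).trans (measure_biUnion_finset_le _ _)
    _ ≤ ∑ x ∈ Finset.univ.filter fun x => G.Adj x v,
        ENNReal.ofReal (t * (callProb G x v + callProb G v x)) := by
        refine Finset.sum_le_sum fun x hx => ?_
        rw [fppLaw_eval G _ measurableSet_Iic]
        refine (expMeasure_Iic_le (edgeRate_pos G _) t).trans (le_of_eq ?_)
        rw [edgeRate, if_pos (Finset.mem_filter.1 hx).2]
    _ ≤ ∑ x, ENNReal.ofReal (t * (callProb G x v + callProb G v x)) :=
        Finset.sum_le_sum_of_subset (Finset.filter_subset _ _)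
    _ = ENNReal.ofReal (t * (∑ x, callProb G x v + 1)) := by
        rw [← ENNReal.ofReal_sum_of_nonneg fun x _ => mul_nonneg ht
          (add_nonneg (callProb_nonneg G _ _) (callProb_nonneg G _ _)), ← Finset.mul_sum,
          Finset.sum_add_distrib, sum_callProb G (hG v)]
    _ ≤ _ := ENNReal.ofReal_le_ofReal (by nlinarith)

theorem ae_fppLaw_nonneg (G : SimpleGraph V) : ∀ᵐ w ∂(fppLaw G), ∀ e, 0 ≤ w e := by
  refine ae_all_iff.2 fun e => ?_
  have h1 : fppLaw G {w | w e ∈ Set.Iic (0 : ℝ)} = 0 := by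
    rw [fppLaw_eval G e measurableSet_Iic, expMeasure_Iic_zero]
  refine measure_mono_null (fun w hw => ?_) h1
  exact (not_le.1 (show ¬ 0 ≤ w e from hw)).le

/-- The exact value is `r / (r - η)`, which is at most `1 + 2η / r` when `2η ≤ r`. -/
theorem lintegral_exp_mul_le {r η : ℝ} (hr : 0 < r) (hη : 0 ≤ η) (h : 2 * η ≤ r) :
    ∫⁻ x, ENNReal.ofReal (Real.exp (η * x)) ∂(expMeasure r) ≤
      ENNReal.ofReal (Real.exp (2 * η / r)) := by
  have h0 : 0 < r - η := by linarith
  rw [lintegral_expMeasure _ (by fun_prop)]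
  calc _ = ∫⁻ x in Set.Ioi (0 : ℝ), ENNReal.ofReal r *
        ENNReal.ofReal (Real.exp (-((r - η) * x))) := by
        refine lintegral_congr fun x => ?_
        rw [← ENNReal.ofReal_mul (by positivity), ← ENNReal.ofReal_mul hr.le, mul_assoc,
          ← Real.exp_add]
        congr 3; ring
    _ = ENNReal.ofReal (r / (r - η)) := by
        rw [lintegral_const_mul _ (by fun_prop), lintegral_Ioi_exp_mul h0,
          ← ENNReal.ofReal_mul hr.le]
        rfl
    _ ≤ _ := by
        refine ENNReal.ofReal_le_ofReal (le_trans ?_ (Real.add_one_le_exp _))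
        rw [div_add_one hr.ne', div_le_div_iff₀ h0 hr]
        nlinarith

/-- The number of vertices within distance one of the `i`-th layer around `s`. -/
noncomputable def layerCount (G : SimpleGraph V) (s : V) (i : ℕ) : ℕ :=
  (Finset.univ.filter fun u => G.dist s u ≤ i + 1 ∧ i ≤ G.dist s u + 1).card

/-- A vertex lies within one of at most three consecutive layers. Together with
`ncard_neighborSet_le_layerCount` this bounds the sum of degrees along a geodesic by `3n`. -/
theorem sum_layerCount_le (G : SimpleGraph V) (s : V) (k : ℕ) :
    ∑ i ∈ Finset.range k, layerCount G s i ≤ 3 * Fintype.card V := by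
  simp only [layerCount, Finset.card_filter]
  rw [Finset.sum_comm]
  calc _ ≤ ∑ _u : V, 3 := by
        refine Finset.sum_le_sum fun u _ => ?_
        rw [← Finset.card_filter]
        calc _ ≤ (Finset.Icc (G.dist s u - 1) (G.dist s u + 1)).card := by
              refine Finset.card_le_card fun i hi => ?_
              rw [Finset.mem_filter] at hi
              rw [Finset.mem_Icc]
              omega
          _ ≤ 3 := by rw [Nat.card_Icc]; omega
    _ = _ := by simp [mul_comm]

theorem ncard_neighborSet_le_layerCount (hG : G.Connected) (s x : V) :
    (G.neighborSet x).ncard ≤ layerCount G s (G.dist s x) := by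
  rw [layerCount, ← Set.ncard_coe_finset]
  refine Set.ncard_le_ncard (fun u hu => ?_) (Set.toFinite _)
  have hadj : G.Adj x u := hu
  have h1 : G.dist s u ≤ G.dist s x + G.dist x u := hG.dist_triangle
  have h2 : G.dist s x ≤ G.dist s u + G.dist u x := hG.dist_triangle
  rw [SimpleGraph.dist_eq_one_iff_adj.2 hadj] at h1
  rw [SimpleGraph.dist_eq_one_iff_adj.2 hadj.symm] at h2
  simp only [Finset.coe_filter, Finset.mem_univ, true_and, Set.mem_ofPred_eq]
  omega

theorem exists_adj_dist (hG : G.Connected) {s v : V} {k : ℕ} (h : G.dist s v = k + 1) :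
    ∃ x, G.Adj x v ∧ G.dist s x = k := by
  obtain ⟨p, hp⟩ := hG.exists_walk_length_eq_dist v s
  rw [SimpleGraph.dist_comm, h] at hp
  cases p with
  | nil => simp at hp
  | @cons _ x _ hadj q =>
    refine ⟨x, hadj.symm, ?_⟩
    have h1 : G.dist x s ≤ q.length := SimpleGraph.dist_le q
    have h2 : G.dist s v ≤ G.dist s x + G.dist x v := hG.dist_triangle
    rw [SimpleGraph.dist_eq_one_iff_adj.2 hadj.symm] at h2
    rw [SimpleGraph.Walk.length_cons] at hp
    rw [SimpleGraph.dist_comm] at h1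
    omega

theorem measurable_walkCost {u v : V} (p : G.Walk u v) :
    Measurable fun w : V × V → ℝ => walkCost w p := by
  induction p with
  | nil => simp only [walkCost_nil]; exact measurable_const
  | cons h p ih => simp only [walkCost_cons]; exact (measurable_pi_apply _).add ih

theorem walkCost_concat {w : V × V → ℝ} {u v x : V} (p : G.Walk u v) (h : G.Adj v x) :
    walkCost w (p.concat h) = walkCost w p + w (v, x) := by
  simp [walkCost, SimpleGraph.Walk.darts_concat]

theorem inv_card_le_callProb {x y : V} (h : G.Adj x y) :
    ((Fintype.card V : ℝ))⁻¹ ≤ callProb G x y := by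
  rw [callProb, if_pos h]
  refine inv_anti₀ (by exact_mod_cast ncard_neighborSet_pos h) ?_
  have := Set.ncard_le_ncard (Set.subset_univ (G.neighborSet x)) (Set.toFinite _)
  rw [Set.ncard_univ, Nat.card_eq_fintype_card] at this
  exact_mod_cast this

/-- Extend a geodesic by one edge from `x` to the next layer. That edge ends farther from `s` than
all earlier edges, so it is independent of them, and its rate is at least the inverse degree of `x`,
so its exponential moment is controlled by the size of the layers around `x`. -/
theorem exists_walk_laplace_le (hG : G.Connected) {η : ℝ} (hη : 0 ≤ η)
    (hηn : 2 * η * Fintype.card V ≤ 1) (s : V) (k : ℕ) (v : V) (hv : G.dist s v = k) :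
    ∃ p : G.Walk s v, (∀ d ∈ p.darts, G.dist s d.toProd.2 ≤ k) ∧
      ∫⁻ w, ENNReal.ofReal (Real.exp (η * walkCost w p)) ∂(fppLaw G) ≤
        ENNReal.ofReal (Real.exp (2 * η * ∑ i ∈ Finset.range k, layerCount G s i)) := by
  induction k generalizing v with
  | zero =>
    obtain rfl := hG.dist_eq_zero_iff.1 hv
    exact ⟨.nil, by simp, by simp⟩
  | succ k ih =>
    obtain ⟨x, hadj, hx⟩ := exists_adj_dist hG hv
    obtain ⟨p, hp, hle⟩ := ih x hx
    refine ⟨p.concat hadj, fun d hd => ?_, ?_⟩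
    · rw [SimpleGraph.Walk.darts_concat, List.concat_eq_append, List.mem_append,
        List.mem_singleton] at hd
      rcases hd with hd | rfl
      · exact (hp d hd).trans (Nat.le_succ k)
      · exact hv.le
    have hm1 : Measurable fun w : V × V → ℝ => ENNReal.ofReal (Real.exp (η * walkCost w p)) := by
      have := measurable_walkCost p
      fun_prop
    have hm2 : Measurable fun w : V × V → ℝ => ENNReal.ofReal (Real.exp (η * w (x, v))) := by
      fun_prop
    have hcallpos := ncard_neighborSet_pos hadj
    have hrate : callProb G x v ≤ edgeRate G (x, v) := by
      rw [edgeRate, if_pos hadj]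
      linarith [callProb_nonneg G v x]
    have hn0 : (0 : ℝ) < Fintype.card V := by
      have : Nonempty V := ⟨s⟩
      exact_mod_cast Fintype.card_pos
    have hη2 : 2 * η ≤ callProb G x v :=
      le_trans (by rw [← one_div, le_div_iff₀ hn0]; exact hηn) (inv_card_le_callProb hadj)
    have h1 : ∫⁻ w, ENNReal.ofReal (Real.exp (η * w (x, v))) ∂(fppLaw G) ≤
        ENNReal.ofReal (Real.exp (2 * η * layerCount G s k)) := by
      rw [fppLaw, (measurePreserving_eval_infinitePi (fun e => expMeasure (edgeRate G e))
        (x, v)).lintegral_comp (f := fun x : ℝ => ENNReal.ofReal (Real.exp (η * x)))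
          (by fun_prop)]
      refine (lintegral_exp_mul_le (edgeRate_pos G _) hη (hη2.trans hrate)).trans
        (ENNReal.ofReal_le_ofReal (Real.exp_le_exp.2 ?_))
      rw [div_eq_mul_inv]
      refine mul_le_mul_of_nonneg_left ?_ (by linarith)
      refine (inv_anti₀ (callProb_pos hadj) hrate).trans ?_
      rw [callProb, if_pos hadj, inv_inv, ← hx]
      exact_mod_cast ncard_neighborSet_le_layerCount hG s x
    have h2 := lintegral_infinitePi_mul (fun e => expMeasure (edgeRate G e)) {(x, v)}ᶜ hm1 hm2
      (fun w w' h => by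
        congr 3
        refine congrArg List.sum (List.map_congr_left fun d hd => h _ fun h' => ?_)
        have := hp d hd
        rw [Set.mem_singleton_iff.1 h', hv] at this
        omega)
      (fun w w' h => by rw [h (x, v) (by simp)])
    simp only [walkCost_concat, mul_add, Real.exp_add]
    simp only [ENNReal.ofReal_mul (Real.exp_pos _).le]
    rw [fppLaw, h2]
    refine (mul_le_mul' hle h1).trans (le_of_eq ?_)
    rw [← ENNReal.ofReal_mul (Real.exp_pos _).le, ← Real.exp_add, Finset.sum_range_succ]
    push_cast
    rw [mul_add]

/-- With `η = 1 / (2n)` the cost of a geodesic has exponential moment at most `exp 3`, as its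
degrees add up to at most `3n`. Markov's inequality bounds the probability of exceeding `T` by `exp
(3 - (log n + 5)) = exp (-2) / n`, and a union over the endpoints leaves `exp (-2) ≤ 1/4`. -/
theorem coverProb_ge_of_le (hG : G.Connected) (s : V) {T : ℝ}
    (hT : 2 * Fintype.card V * (Real.log (Fintype.card V) + 5) ≤ T) :
    ENNReal.ofReal (3 / 4) ≤ coverProb G {s} T := by
  classical
  have : Nonempty V := ⟨s⟩
  have hn0 : (0 : ℝ) < Fintype.card V := by exact_mod_cast Fintype.card_pos
  set n : ℝ := (Fintype.card V : ℝ) with hn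
  set η : ℝ := 1 / (2 * n) with hη
  have hη0 : 0 < η := by positivity
  choose p _ hp using fun v =>
    exists_walk_laplace_le hG hη0.le (by rw [hη, ← hn]; field_simp; rfl) s (G.dist s v) v rfl
  set slow : V → Set (V × V → ℝ) := fun v =>
    {w | ENNReal.ofReal (Real.exp (η * T)) ≤ ENNReal.ofReal (Real.exp (η * walkCost w (p v)))}
  have hslow : ∀ v, fppLaw G (slow v) ≤ ENNReal.ofReal (Real.exp (-2) / n) := by
    intro v
    have hm1 : Measurable fun w : V × V → ℝ => ENNReal.ofReal (Real.exp (η * walkCost w (p v))) := by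
      have := measurable_walkCost (p v)
      fun_prop
    have h1 := (mul_meas_ge_le_lintegral (μ := fppLaw G) hm1
      (ENNReal.ofReal (Real.exp (η * T)))).trans (hp v)
    have h3 := mul_le_mul_right h1 (ENNReal.ofReal (Real.exp (-(η * T))))
    rw [← mul_assoc, ← ENNReal.ofReal_mul (Real.exp_pos _).le, ← Real.exp_add, neg_add_cancel,
      Real.exp_zero, ENNReal.ofReal_one, one_mul, ← ENNReal.ofReal_mul (Real.exp_pos _).le,
      ← Real.exp_add] at h3
    refine h3.trans (ENNReal.ofReal_le_ofReal ?_)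
    have h4 : (((∑ i ∈ Finset.range (G.dist s v), layerCount G s i : ℕ)) : ℝ) ≤ 3 * n := by
      have := sum_layerCount_le G s (G.dist s v)
      rw [hn]
      exact_mod_cast this
    have h5 : 2 * η * (3 * n) = 3 := by rw [hη]; field_simp
    have h6 : Real.log n + 5 ≤ η * T := by
      calc _ = η * (2 * n * (Real.log n + 5)) := by rw [hη]; field_simp
        _ ≤ _ := mul_le_mul_of_nonneg_left hT hη0.le
    rw [div_eq_mul_inv, ← Real.exp_log hn0, ← Real.exp_neg, ← Real.exp_add]
    refine Real.exp_le_exp.2 ?_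
    have h7 := mul_le_mul_of_nonneg_left h4 (by positivity : 0 ≤ 2 * η)
    push_cast at h7 ⊢
    linarith
  have hcov : ({w | Covers G w {s} T}ᶜ : Set (V × V → ℝ)) ⊆
      {w | ¬ ∀ e, 0 ≤ w e} ∪ ⋃ v, slow v := by
    intro w hw
    by_cases h0 : ∀ e, 0 ≤ w e
    · right
      by_contra hcon
      refine hw fun v => passage_iff.2 ⟨s, rfl, p v, fun d _ => h0 _, ?_⟩
      by_contra hlt
      refine hcon (Set.mem_iUnion.2 ⟨v, ENNReal.ofReal_le_ofReal (Real.exp_le_exp.2 ?_)⟩)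
      exact mul_le_mul_of_nonneg_left (not_le.1 hlt).le hη0.le
    · exact Or.inl h0
  have hcompl : fppLaw G ({w | Covers G w {s} T}ᶜ) ≤ ENNReal.ofReal (1 / 4) := by
    refine (measure_mono hcov).trans ((measure_union_le _ _).trans ?_)
    rw [show fppLaw G {w | ¬ ∀ e, 0 ≤ w e} = 0 from ae_fppLaw_nonneg G, zero_add]
    refine (measure_iUnion_fintype_le _ _).trans ((Finset.sum_le_sum fun v _ => hslow v).trans ?_)
    rw [Finset.sum_const, Finset.card_univ, nsmul_eq_mul, ← ENNReal.ofReal_natCast,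
      ← ENNReal.ofReal_mul (Nat.cast_nonneg _)]
    refine ENNReal.ofReal_le_ofReal ?_
    rw [← hn, mul_div_cancel₀ _ hn0.ne', Real.exp_neg, ← one_div]
    refine one_div_le_one_div_of_le (by norm_num) ?_
    have h1 := Real.add_one_le_exp (1 : ℝ)
    have h2 : Real.exp 2 = Real.exp 1 * Real.exp 1 := by rw [← Real.exp_add]; norm_num
    nlinarith
  rw [prob_compl_eq_one_sub (measurableSet_covers_right G {s} T)] at hcompl
  have h1 : (1 : ℝ≥0∞) ≤ ENNReal.ofReal (1 / 4) + coverProb G {s} T := tsub_le_iff_right.1 hcompl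
  have h2 : (1 : ℝ≥0∞) = ENNReal.ofReal (1 / 4) + ENNReal.ofReal (3 / 4) := by
    rw [← ENNReal.ofReal_add (by norm_num) (by norm_num)]; norm_num
  rw [h2] at h1
  exact (ENNReal.add_le_add_iff_left ENNReal.ofReal_ne_top).1 h1

end FppBounds

/-! ### Laws of random subsets of a finite set -/

section RandomSet

variable {V Ω Ω' : Type*} [Fintype V] [MeasurableSpace Ω] [MeasurableSpace Ω']

theorem measurableSet_randomSet_eq {X : Ω → Set V} (hX : ∀ y, MeasurableSet {ω | y ∈ X ω})
    (J : Set V) : MeasurableSet {ω | X ω = J} := by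
  simp only [Set.ext_iff, Set.ofPred_forall]
  refine .iInter fun y => ?_
  by_cases hy : y ∈ J
  · simpa [hy] using hX y
  · simp only [hy, iff_false]; exact (hX y).compl

theorem lintegral_randomSet (μ : Measure Ω) {X : Ω → Set V}
    (hX : ∀ y, MeasurableSet {ω | y ∈ X ω}) (h : Set V → ℝ≥0∞) :
    ∫⁻ ω, h (X ω) ∂μ = ∑ J, μ {ω | X ω = J} * h J := by
  classical
  have h1 : ∀ ω, h (X ω) = ∑ J, {ω | X ω = J}.indicator (fun _ => h J) ω := by
    intro ω
    simp [Set.indicator_apply]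
  simp only [h1]
  rw [lintegral_finsetSum _ fun J _ =>
    measurable_const.indicator (measurableSet_randomSet_eq hX J)]
  refine Finset.sum_congr rfl fun J _ => ?_
  rw [lintegral_indicator_const (measurableSet_randomSet_eq hX J), mul_comm]

theorem measure_randomSet_mem (μ : Measure Ω) {X : Ω → Set V}
    (hX : ∀ y, MeasurableSet {ω | y ∈ X ω}) (𝒜 : Finset (Set V)) :
    μ {ω | X ω ∈ 𝒜} = ∑ J ∈ 𝒜, μ {ω | X ω = J} := by
  have : {ω | X ω ∈ 𝒜} = ⋃ J ∈ 𝒜, {ω | X ω = J} := by ext; simp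
  rw [this, measure_biUnion_finset]
  · intro J _ K _ hJK
    refine Set.disjoint_left.2 fun ω h1 h2 => hJK ?_
    exact (show X ω = J from h1).symm.trans h2
  · exact fun J _ => measurableSet_randomSet_eq hX J

/-- The law of a random subset of a finite set is determined by its distribution function. -/
theorem measure_randomSet_eq {μ : Measure Ω} {ν : Measure Ω'} [IsFiniteMeasure μ]
    {X : Ω → Set V} {Y : Ω' → Set V} (hX : ∀ y, MeasurableSet {ω | y ∈ X ω})
    (hY : ∀ y, MeasurableSet {ω | y ∈ Y ω}) (h : ∀ J, μ {ω | X ω ⊆ J} = ν {ω | Y ω ⊆ J})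
    (J : Set V) : μ {ω | X ω = J} = ν {ω | Y ω = J} := by
  classical
  induction hm : J.ncard using Nat.strong_induction_on generalizing J with
  | _ m ih =>
    have hsub : ∀ J' ∈ (Finset.univ.filter (· ⊆ J)).erase J,
        μ {ω | X ω = J'} = ν {ω | Y ω = J'} := by
      intro J' hJ'
      rw [Finset.mem_erase, Finset.mem_filter] at hJ'
      refine ih _ ?_ J' rfl
      rw [← hm]
      exact Set.ncard_lt_ncard (hJ'.2.2.ssubset_of_ne hJ'.1) (Set.toFinite _)
    -- Inclusion-exclusion by induction: the contributions of proper subsets of `J` already agree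
    -- and are subtracted from the common value of the distribution functions at `J`.
    have h1 := measure_randomSet_mem μ hX (Finset.univ.filter (· ⊆ J))
    have h2 := measure_randomSet_mem ν hY (Finset.univ.filter (· ⊆ J))
    have hJ : J ∈ Finset.univ.filter (· ⊆ J) := by simp
    rw [← Finset.add_sum_erase _ _ hJ] at h1 h2
    simp only [Finset.mem_filter, Finset.mem_univ, true_and] at h1 h2
    rw [h, h2, Finset.sum_congr rfl hsub] at h1
    refine ((ENNReal.add_left_inj ?_).1 h1).symm
    rw [← Finset.sum_congr rfl hsub]
    exact ENNReal.sum_ne_top.2 fun _ _ => measure_ne_top _ _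

end RandomSet

/-! ### The synchronous protocol: Markov property and restarts -/

section Sync

variable {V : Type*}

/-- The vertices informed after `r` rounds of the synchronous protocol started from `I`. -/
def syncFrom (I : Set V) (c : SyncOutcome V) : ℕ → Set V
  | 0 => I
  | r + 1 => syncFrom I c r ∪ {y | ∃ x ∈ syncFrom I c r, c (r, x) = y ∨ c (r, y) = x}

theorem syncInformed_eq_syncFrom (s : V) (c : SyncOutcome V) (r : ℕ) :
    syncInformed s c r = syncFrom {s} c r := by
  induction r with
  | zero => rfl
  | succ r ih => simp only [syncInformed, syncFrom, ih]

theorem syncFrom_monotone (I : Set V) (c : SyncOutcome V) : Monotone (syncFrom I c) :=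
  monotone_nat_of_le_succ fun _ => Set.subset_union_left

theorem syncFrom_mono {I J : Set V} (h : I ⊆ J) (c : SyncOutcome V) (r : ℕ) :
    syncFrom I c r ⊆ syncFrom J c r := by
  induction r with
  | zero => exact h
  | succ r ih =>
    exact Set.union_subset_union ih fun y ⟨x, hx, hy⟩ => ⟨x, ih hx, hy⟩

/-- The choices made after the first `a` rounds. -/
def laterRounds (a : ℕ) (c : SyncOutcome V) : SyncOutcome V := fun p => c (a + p.1, p.2)

theorem syncFrom_add (I : Set V) (c : SyncOutcome V) (a r : ℕ) :
    syncFrom I c (a + r) = syncFrom (syncFrom I c a) (laterRounds a c) r := by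
  induction r with
  | zero => rfl
  | succ r ih => rw [← add_assoc, syncFrom, syncFrom, ih]; rfl

theorem syncFrom_congr {c c' : SyncOutcome V} (I : Set V) (a : ℕ)
    (h : ∀ p : ℕ × V, p.1 < a → c p = c' p) : syncFrom I c a = syncFrom I c' a := by
  induction a with
  | zero => rfl
  | succ a ih =>
    have h1 : ∀ x, c (a, x) = c' (a, x) := fun x => h (a, x) (Nat.lt_succ_self a)
    simp only [syncFrom, ih fun p hp => h p (hp.trans (Nat.lt_succ_self a)), h1]

variable [Fintype V] [MeasurableSpace V] [MeasurableSingletonClass V] {G : SimpleGraph V}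

instance isProbabilityMeasure_syncLaw (G : SimpleGraph V) : IsProbabilityMeasure (syncLaw G) := by
  unfold syncLaw; infer_instance

theorem measurableSet_mem_syncFrom (I : Set V) (r : ℕ) (y : V) :
    MeasurableSet {c | y ∈ syncFrom I c r} := by
  induction r generalizing y with
  | zero => exact .const _
  | succ r ih =>
    have hc : ∀ p : ℕ × V, ∀ v : V, MeasurableSet {c : SyncOutcome V | c p = v} := fun p v =>
      measurableSet_eq_fun (measurable_pi_apply p) measurable_const
    have : {c : SyncOutcome V | y ∈ syncFrom I c (r + 1)} = {c | y ∈ syncFrom I c r} ∪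
        ⋃ x, {c | x ∈ syncFrom I c r} ∩ ({c | c (r, x) = y} ∪ {c | c (r, y) = x}) := by
      ext; simp [syncFrom]
    rw [this]
    exact (ih y).union (.iUnion fun x => (ih x).inter ((hc _ _).union (hc _ _)))

/-- The Markov property of the synchronous protocol. -/
theorem syncLaw_syncFrom_add (G : SimpleGraph V) (I : Set V) (a r : ℕ) (𝒜 : Set (Set V)) :
    syncLaw G {c | syncFrom I c (a + r) ∈ 𝒜} =
      ∑ J, syncLaw G {c | syncFrom I c a = J} * syncLaw G {c | syncFrom J c r ∈ 𝒜} := by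
  classical
  have hm : ∀ J r, MeasurableSet {c : SyncOutcome V | syncFrom J c r ∈ 𝒜} := by
    intro J r
    have : {c : SyncOutcome V | syncFrom J c r ∈ 𝒜} = ⋃ K ∈ 𝒜, {c | syncFrom J c r = K} := by
      ext; simp
    rw [this]
    exact .biUnion (Set.to_countable _) fun K _ =>
      measurableSet_randomSet_eq (measurableSet_mem_syncFrom J r) K
  have hlater : Measurable (laterRounds a : SyncOutcome V → SyncOutcome V) :=
    measurable_pi_iff.2 fun p => measurable_pi_apply _
  have hdecomp : {c : SyncOutcome V | syncFrom I c (a + r) ∈ 𝒜} =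
      ⋃ J ∈ (Finset.univ : Finset (Set V)),
        {c | syncFrom I c a = J} ∩ laterRounds a ⁻¹' {c | syncFrom J c r ∈ 𝒜} := by
    ext c
    simp [syncFrom_add]
  rw [hdecomp, measure_biUnion_finset]
  · refine Finset.sum_congr rfl fun J _ => ?_
    have h1 := infinitePi_inter (fun p : ℕ × V => callLaw G p.2) {p | p.1 < a}
      (measurableSet_randomSet_eq (measurableSet_mem_syncFrom I a) J) (hlater (hm J r))
      (fun c c' h hc => (syncFrom_congr I a h).symm.trans hc)
      (fun c c' h hc => by
        have : laterRounds a c' = laterRounds a c := funext fun p => (h _ (by simp)).symm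
        rw [Set.mem_preimage, this]
        exact hc)
    have h2 := map_comp_infinitePi (fun p : ℕ × V => callLaw G p.2)
      (ρ := fun p : ℕ × V => (a + p.1, p.2)) (fun p q h => by
        simp only [Prod.mk.injEq, add_right_inj] at h
        exact Prod.ext h.1 h.2)
    rw [syncLaw, h1]
    congr 1
    conv_rhs => rw [show (Measure.infinitePi fun p : ℕ × V => callLaw G p.2) = _ from h2.symm,
      Measure.map_apply (measurable_precomp _) (hm J r)]
    rfl
  · intro J _ K _ hJK
    refine Set.disjoint_left.2 fun c h1 h2 => hJK ?_
    exact (show syncFrom I c a = J from h1.1).symm.trans h2.1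
  · exact fun J _ => (measurableSet_randomSet_eq (measurableSet_mem_syncFrom I a) J).inter
      (hlater (hm J r))

/-- The probability that the synchronous protocol started from `I` informs everyone within `r`
rounds. -/
noncomputable def syncProb (G : SimpleGraph V) (I : Set V) (r : ℕ) : ℝ≥0∞ :=
  syncLaw G {c | syncFrom I c r = Set.univ}

theorem syncProb_mono (G : SimpleGraph V) (r : ℕ) : Monotone fun I => syncProb G I r :=
  fun _ _ h => measure_mono fun c hc => Set.eq_univ_of_univ_subset
    ((show syncFrom _ c r = Set.univ from hc).symm.subset.trans (syncFrom_mono h c r))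

theorem syncProb_le_one (G : SimpleGraph V) (I : Set V) (r : ℕ) : syncProb G I r ≤ 1 := prob_le_one

theorem syncProb_add (G : SimpleGraph V) (I : Set V) (a r : ℕ) :
    syncProb G I (a + r) = ∑ J, syncLaw G {c | syncFrom I c a = J} * syncProb G J r :=
  syncLaw_syncFrom_add G I a r {Set.univ}

theorem syncLaw_compl (G : SimpleGraph V) (I : Set V) (r : ℕ) :
    syncLaw G {c | syncFrom I c r ≠ Set.univ} = 1 - syncProb G I r :=
  prob_compl_eq_one_sub (measurableSet_randomSet_eq (measurableSet_mem_syncFrom I r) _)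

/-- After any number of rounds the informed set still contains `s`, so by monotonicity a new block
of `r` rounds succeeds at least as likely as one from `s` alone. -/
theorem syncLaw_compl_add_le (G : SimpleGraph V) (s : V) (a r : ℕ) :
    syncLaw G {c | syncFrom {s} c (a + r) ≠ Set.univ} ≤
      syncLaw G {c | syncFrom {s} c a ≠ Set.univ} * (1 - syncProb G {s} r) := by
  classical
  have h1 := syncLaw_syncFrom_add G {s} a r {Set.univ}ᶜ
  have h2 := measure_randomSet_mem (syncLaw G) (measurableSet_mem_syncFrom {s} a)
    (Finset.univ.erase Set.univ)
  simp only [Finset.mem_erase, Finset.mem_univ, and_true] at h2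
  simp only [Set.mem_compl_iff, Set.mem_singleton_iff] at h1
  have huniv : syncLaw G {c | syncFrom (Set.univ : Set V) c r ≠ Set.univ} = 0 := by
    have : {c : SyncOutcome V | syncFrom Set.univ c r ≠ Set.univ} = ∅ := by
      refine Set.eq_empty_of_forall_notMem fun c hc => hc (Set.eq_univ_of_univ_subset ?_)
      exact syncFrom_monotone Set.univ c (Nat.zero_le r)
    rw [this, measure_empty]
  refine h1.le.trans ?_
  rw [h2, Finset.sum_mul, ← Finset.add_sum_erase _ _ (Finset.mem_univ (Set.univ : Set V))]
  refine le_trans (le_of_eq ?_) (Finset.sum_le_sum (f := fun J =>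
    syncLaw G {c | syncFrom {s} c a = J} * syncLaw G {c | syncFrom J c r ≠ Set.univ})
      fun J _ => ?_)
  · rw [show syncLaw G {c | ¬ syncFrom (Set.univ : Set V) c r = Set.univ} = 0 from huniv, mul_zero,
      zero_add]
  · by_cases hs : s ∈ J
    · rw [syncLaw_compl]
      exact mul_le_mul_right (tsub_le_tsub_left
        (syncProb_mono G r (Set.singleton_subset_iff.2 hs)) 1) _
    · have : {c : SyncOutcome V | syncFrom {s} c a = J} = ∅ := by
        refine Set.eq_empty_of_forall_notMem fun c hc => hs ?_
        rw [← show syncFrom {s} c a = J from hc]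
        exact syncFrom_monotone {s} c (Nat.zero_le a) rfl
      rw [this, measure_empty, zero_mul]
      exact zero_le

/-- If `K` is the first number of blocks of `T` rounds after which everyone is informed, exactly the
terms `k < K` contribute `T` each, and the spread time is at most `K * T`. -/
theorem syncSpreadTime_le (s : V) (c : SyncOutcome V) {T : ℕ} (hT : 0 < T) :
    syncSpreadTime s c ≤
      ∑' k : ℕ, {c | syncFrom {s} c (k * T) ≠ Set.univ}.indicator (fun _ => (T : ℝ≥0∞)) c := by
  classical
  by_cases h : ∃ k : ℕ, syncFrom {s} c (k * T) = Set.univ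
  · have h1 := Nat.find_spec h
    set K := Nat.find h
    calc syncSpreadTime s c ≤ ((K * T : ℕ) : ℝ≥0∞) := iInf₂_le _ fun v => by
          rw [syncInformed_eq_syncFrom, h1]; trivial
      _ = ∑ k ∈ Finset.range K,
          {c | syncFrom {s} c (k * T) ≠ Set.univ}.indicator (fun _ => (T : ℝ≥0∞)) c := by
          rw [Finset.sum_congr rfl fun k hk => Set.indicator_of_mem
            (show c ∈ {c | syncFrom {s} c (k * T) ≠ Set.univ} from
              Nat.find_min h (Finset.mem_range.1 hk)) _]
          simp [K]
      _ ≤ _ := ENNReal.sum_le_tsum _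
  · push Not at h
    have h1 : ∀ k : ℕ, {c | syncFrom {s} c (k * T) ≠ Set.univ}.indicator
        (fun _ => (T : ℝ≥0∞)) c = T := fun k => Set.indicator_of_mem (h k) _
    simp only [h1]
    rw [ENNReal.tsum_const_eq_top_of_ne_zero (by exact_mod_cast hT.ne')]
    exact le_top

/-- Each block of `T` rounds fails with conditional probability at most `3/4`, and the geometric
series of ratio `3/4` sums to 4. -/
theorem expectedSync_le {s : V} {T : ℕ} (hT : 0 < T)
    (h : ENNReal.ofReal (1 / 4) ≤ syncProb G {s} T) : expectedSync G s ≤ 4 * T := by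
  have hgeom : ∀ k : ℕ, syncLaw G {c | syncFrom {s} c (k * T) ≠ Set.univ} ≤
      ENNReal.ofReal (3 / 4) ^ k := by
    intro k
    induction k with
    | zero => simpa using prob_le_one
    | succ k ih =>
      rw [add_mul, one_mul, pow_succ]
      refine (syncLaw_compl_add_le G s (k * T) T).trans (mul_le_mul' ih ?_)
      refine (tsub_le_tsub_left h 1).trans (le_of_eq ?_)
      rw [← ENNReal.ofReal_one, ← ENNReal.ofReal_sub _ (by norm_num)]
      norm_num
  have hm : ∀ k : ℕ, MeasurableSet {c : SyncOutcome V | syncFrom {s} c (k * T) ≠ Set.univ} :=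
    fun k => (measurableSet_randomSet_eq (measurableSet_mem_syncFrom {s} (k * T)) _).compl
  calc expectedSync G s ≤ ∫⁻ c, ∑' k : ℕ,
        {c | syncFrom {s} c (k * T) ≠ Set.univ}.indicator (fun _ => (T : ℝ≥0∞)) c ∂(syncLaw G) :=
        lintegral_mono fun c => syncSpreadTime_le s c hT
    _ = ∑' k : ℕ, T * syncLaw G {c | syncFrom {s} c (k * T) ≠ Set.univ} := by
        rw [lintegral_tsum fun k => (measurable_const.indicator (hm k)).aemeasurable]
        exact tsum_congr fun k => lintegral_indicator_const (hm k) _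
    _ ≤ ∑' k : ℕ, T * ENNReal.ofReal (3 / 4) ^ k :=
        ENNReal.tsum_le_tsum fun k => mul_le_mul_right (hgeom k) _
    _ = 4 * T := by
        rw [ENNReal.tsum_mul_left, ENNReal.tsum_geometric, mul_comm]
        congr 1
        rw [← ENNReal.ofReal_one, ← ENNReal.ofReal_sub _ (by norm_num),
          ← ENNReal.ofReal_inv_of_pos (by norm_num)]
        norm_num

end Sync

/-! ### Poisson variables -/

section Poisson

/-- With `a` the probability that one call avoids a given set, this is the probability that a
Poisson number of calls all avoid it; it matches the survival of exponential clocks. -/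
theorem lintegral_pow_poissonMeasure (R : ℕ) {a : ℝ} (ha : 0 ≤ a) :
    ∫⁻ k, ENNReal.ofReal a ^ k ∂(poissonMeasure R) =
      ENNReal.ofReal (Real.exp (-((1 - a) * R))) := by
  have hr : 0 ≤ (R : ℝ) * a := by positivity
  have h1 := (hasSum_one_poissonMeasure ⟨R * a, hr⟩).mul_left (Real.exp (-((1 - a) * R)))
  rw [lintegral_countable', mul_one] at *
  rw [← h1.tsum_eq, ENNReal.ofReal_tsum_of_nonneg (fun k => by positivity) h1.summable]
  refine tsum_congr fun k => ?_
  rw [poissonMeasure_singleton, ← ENNReal.ofReal_pow ha, ← ENNReal.ofReal_mul (by positivity)]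
  congr 1
  change a ^ k * (Real.exp (-(R : ℝ)) * (R : ℝ) ^ k / _) =
    Real.exp (-((1 - a) * R)) * (Real.exp (-(R * a)) * (R * a) ^ k / _)
  rw [show -(R : ℝ) = -((1 - a) * R) + -(R * a) by ring, Real.exp_add]
  ring

/-- Markov's inequality for `4 ^ k`, whose mean is `exp (3R)`, gives `exp (3R) / 256 ^ R`; the
stated form follows from `exp 5 ≤ 256`. -/
theorem poissonMeasure_lt_le (R : ℕ) :
    poissonMeasure R {k | 4 * R < k} ≤ ENNReal.ofReal (Real.exp (-(2 * R))) := by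
  have h1 := mul_meas_ge_le_lintegral (μ := poissonMeasure R) (f := fun k => ENNReal.ofReal 4 ^ k)
    (measurable_of_countable _) (ENNReal.ofReal 4 ^ (4 * R))
  rw [lintegral_pow_poissonMeasure R (by norm_num)] at h1
  have hsub : {k | 4 * R < k} ⊆ {k : ℕ | ENNReal.ofReal 4 ^ (4 * R) ≤ ENNReal.ofReal 4 ^ k} := by
    intro k hk
    have h0 : (1 : ℝ≥0∞) ≤ ENNReal.ofReal 4 := by
      rw [← ENNReal.ofReal_one]
      exact ENNReal.ofReal_le_ofReal (by norm_num)
    exact pow_le_pow_right₀ h0 (le_of_lt hk)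
  have h4 : ENNReal.ofReal 4 ^ (4 * R) = ENNReal.ofReal (256 ^ R) := by
    rw [← ENNReal.ofReal_pow (by norm_num), pow_mul]; norm_num
  rw [h4] at h1 hsub
  have h2 := (mul_le_mul_right (measure_mono hsub) (ENNReal.ofReal (256 ^ R))).trans h1
  have h3 := mul_le_mul_right h2 (ENNReal.ofReal ((256 ^ R)⁻¹))
  rw [← mul_assoc, ← ENNReal.ofReal_mul (by positivity), inv_mul_cancel₀ (by positivity),
    ENNReal.ofReal_one, one_mul, ← ENNReal.ofReal_mul (by positivity)] at h3
  refine h3.trans (ENNReal.ofReal_le_ofReal ?_)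
  have he : Real.exp 1 < 2.7182818286 := Real.exp_one_lt_d9
  have he5 : Real.exp 5 ≤ 256 := by
    calc Real.exp 5 = Real.exp 1 ^ 5 := by rw [← Real.exp_nat_mul]; norm_num
      _ ≤ (2.7182818286 : ℝ) ^ 5 := by gcongr
      _ ≤ 256 := by norm_num
  have h5 : Real.exp (5 * R) ≤ 256 ^ R := by
    rw [mul_comm, Real.exp_nat_mul]
    gcongr
  rw [inv_mul_le_iff₀ (by positivity)]
  calc Real.exp (-((1 - 4) * R)) = Real.exp (5 * R) * Real.exp (-(2 * R)) := by
        rw [← Real.exp_add]; ring_nf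
    _ ≤ _ := mul_le_mul_of_nonneg_right h5 (Real.exp_pos _).le

theorem lintegral_infinitePi_prod {ι α : Type*} [MeasurableSpace α] [DecidableEq ι]
    (μ : ι → Measure α) [∀ i, IsProbabilityMeasure (μ i)] {f : ι → α → ℝ≥0∞}
    (hf : ∀ i, Measurable (f i)) (s : Finset ι) :
    ∫⁻ ω, ∏ i ∈ s, f i (ω i) ∂(Measure.infinitePi μ) = ∏ i ∈ s, ∫⁻ x, f i x ∂(μ i) := by
  induction s using Finset.induction_on with
  | empty => simp
  | insert i s hi ih =>
    simp only [Finset.prod_insert hi]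
    have hm : ∀ j, Measurable fun ω : ι → α => f j (ω j) := fun j =>
      (hf j).comp (measurable_pi_apply j)
    rw [lintegral_infinitePi_mul μ {i} (f := fun ω => f i (ω i)) (g := fun ω => ∏ j ∈ s, f j (ω j))
      (hm i) (Finset.measurable_prod _ fun j _ => hm j)
      (fun ω ω' h => congrArg (f i) (h i rfl))
      (fun ω ω' h => Finset.prod_congr rfl fun j hj => by
        rw [h j fun h' => hi ((Set.mem_singleton_iff.1 h') ▸ hj)]), ih]
    exact congrArg (· * _) ((measurePreserving_eval_infinitePi μ i).lintegral_comp (hf i))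

end Poisson

/-! ### One window of percolation against `4R` synchronous rounds -/

section Window

variable {V : Type*} [Fintype V]

/-- The vertices that communicate with `I` when the vertex `x` makes `N x` calls. -/
def poissonEnlarge (I : Set V) (ω : (V → ℕ) × SyncOutcome V) : Set V :=
  I ∪ {y | ∃ x ∈ I, (∃ r < ω.1 x, ω.2 (r, x) = y) ∨ ∃ r < ω.1 y, ω.2 (r, y) = x}

theorem poissonEnlarge_subset_iff {I J : Set V} {ω : (V → ℕ) × SyncOutcome V} :
    poissonEnlarge I ω ⊆ J ↔ I ⊆ J ∧ ∀ x, ∀ r < ω.1 x,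
      ω.2 (r, x) ∈ {y | ¬ ((x ∈ I ∧ y ∉ J) ∨ (x ∉ J ∧ y ∈ I))} := by
  constructor
  · intro h
    refine ⟨Set.subset_union_left.trans h, fun x r hr => ?_⟩
    rintro (⟨h1, h2⟩ | ⟨h1, h2⟩)
    · exact h2 (h (Or.inr ⟨x, h1, Or.inl ⟨r, hr, rfl⟩⟩))
    · exact h1 (h (Or.inr ⟨_, h2, Or.inr ⟨r, hr, rfl⟩⟩))
  · rintro ⟨h1, h2⟩ y (hy | ⟨x, hx, ⟨r, hr, rfl⟩ | ⟨r, hr, rfl⟩⟩)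
    · exact h1 hy
    · by_contra hJ
      exact h2 x r hr (Or.inl ⟨hx, hJ⟩)
    · by_contra hJ
      exact h2 y r hr (Or.inr ⟨hJ, hx⟩)

/-- Vertices of `I` stay informed, so every counted call that links a vertex to `I` is effective in
its own round if not before. -/
theorem poissonEnlarge_subset_syncFrom {I : Set V} {ω : (V → ℕ) × SyncOutcome V} {a : ℕ}
    (h : ∀ x, ω.1 x ≤ a) : poissonEnlarge I ω ⊆ syncFrom I ω.2 a := by
  have hmono : ∀ r < a, syncFrom I ω.2 (r + 1) ⊆ syncFrom I ω.2 a := fun r hr =>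
    syncFrom_monotone I ω.2 hr
  rintro y (hy | ⟨x, hx, ⟨r, hr, h1⟩ | ⟨r, hr, h1⟩⟩)
  · exact syncFrom_monotone I ω.2 (Nat.zero_le a) hy
  · exact hmono r (hr.trans_le (h x))
      (Or.inr ⟨x, syncFrom_monotone I ω.2 (Nat.zero_le r) hx, Or.inl h1⟩)
  · exact hmono r (hr.trans_le (h y))
      (Or.inr ⟨x, syncFrom_monotone I ω.2 (Nat.zero_le r) hx, Or.inr h1⟩)

variable [MeasurableSpace V] [MeasurableSingletonClass V] {G : SimpleGraph V}

/-- The calls of the synchronous protocol with independent Poisson numbers of calls per vertex. -/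
noncomputable def poissonSyncLaw (G : SimpleGraph V) (R : ℕ) :
    Measure ((V → ℕ) × SyncOutcome V) :=
  (Measure.infinitePi fun _ : V => poissonMeasure R).prod (syncLaw G)

instance (G : SimpleGraph V) (R : ℕ) : IsProbabilityMeasure (poissonSyncLaw G R) := by
  unfold poissonSyncLaw; infer_instance

theorem measurableSet_call_eq (r : ℕ) (x y : V) :
    MeasurableSet {ω : (V → ℕ) × SyncOutcome V | r < ω.1 x ∧ ω.2 (r, x) = y} := by
  have h1 : Measurable fun ω : (V → ℕ) × SyncOutcome V => ω.1 x := by fun_prop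
  have h2 : Measurable fun ω : (V → ℕ) × SyncOutcome V => ω.2 (r, x) := by fun_prop
  exact (measurableSet_lt measurable_const h1).inter (h2 (measurableSet_singleton y))

theorem measurableSet_mem_poissonEnlarge (I : Set V) (y : V) :
    MeasurableSet {ω | y ∈ poissonEnlarge I ω} := by
  have : {ω | y ∈ poissonEnlarge I ω} = {_ω | y ∈ I} ∪ ⋃ x ∈ I,
      ((⋃ r : ℕ, {ω : (V → ℕ) × SyncOutcome V | r < ω.1 x ∧ ω.2 (r, x) = y}) ∪
        ⋃ r : ℕ, {ω : (V → ℕ) × SyncOutcome V | r < ω.1 y ∧ ω.2 (r, y) = x}) := by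
    ext; simp [poissonEnlarge]
  rw [this]
  exact (MeasurableSet.const _).union (.biUnion (Set.to_countable _) fun x _ =>
    (MeasurableSet.iUnion fun r => measurableSet_call_eq r x y).union
      (MeasurableSet.iUnion fun r => measurableSet_call_eq r y x))

theorem syncLaw_forall_lt (G : SimpleGraph V) (N : V → ℕ) (S : V → Set V) :
    syncLaw G {c | ∀ x, ∀ r < N x, c (r, x) ∈ S x} = ∏ x, callLaw G x (S x) ^ N x := by
  classical
  set s : Finset (ℕ × V) := Finset.univ.biUnion fun x => Finset.range (N x) ×ˢ {x} with hs
  have hmem : ∀ p : ℕ × V, p ∈ s ↔ p.2 ∈ (Finset.univ : Finset V) ∧ p.1 ∈ Finset.range (N p.2) := by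
    rintro ⟨r, x⟩
    simp [hs]
  have hset : {c : SyncOutcome V | ∀ x, ∀ r < N x, c (r, x) ∈ S x} =
      Set.pi (s : Set (ℕ × V)) fun p => S p.2 := by
    ext c
    simp only [Set.mem_pi, Finset.mem_coe, hmem, Finset.mem_univ, true_and, Finset.mem_range,
      Prod.forall]
    exact forall_comm
  rw [hset, syncLaw, Measure.infinitePi_pi _ fun p _ => (S p.2).toFinite.measurableSet,
    Finset.prod_finset_product_right s Finset.univ (fun x => Finset.range (N x)) hmem]
  simp

theorem callLaw_eq_ofReal (hG : ∀ x, (G.neighborSet x).Nonempty) (x : V) (S : Set V)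
    [DecidablePred (· ∈ S)] :
    callLaw G x S = ENNReal.ofReal (1 - ∑ y, if y ∈ S then 0 else callProb G x y) := by
  have h1 : callLaw G x S = ∑ y, if y ∈ S then ENNReal.ofReal (callProb G x y) else 0 := by
    rw [← lintegral_indicator_one S.toFinite.measurableSet, lintegral_callLaw (hG x)]
    exact Finset.sum_congr rfl fun y _ => by by_cases h : y ∈ S <;> simp [h]
  have h2 : 1 - (∑ y, if y ∈ S then 0 else callProb G x y) =
      ∑ y, if y ∈ S then callProb G x y else 0 := by
    rw [← sum_callProb G (hG x), ← Finset.sum_sub_distrib]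
    exact Finset.sum_congr rfl fun y _ => by split_ifs <;> simp
  rw [h1, h2, ENNReal.ofReal_sum_of_nonneg]
  · exact Finset.sum_congr rfl fun y _ => by split_ifs <;> simp
  · intro y _
    split_ifs
    · exact callProb_nonneg G x y
    · exact le_rfl

/-- The rate of an edge from `I` to the complement of `J` is split between the two callers, which
regroups the sum by caller, as the Poisson computation requires. -/
theorem sum_edgeRate_outEdges {I J : Set V} (hIJ : I ⊆ J)
    [∀ x y, Decidable ((x ∈ I ∧ y ∉ J) ∨ (x ∉ J ∧ y ∈ I))] :
    ∑ e ∈ outEdges G I J, edgeRate G e =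
      ∑ x, ∑ y, if (x ∈ I ∧ y ∉ J) ∨ (x ∉ J ∧ y ∈ I) then callProb G x y else 0 := by
  classical
  have h1 : ∀ x y, (if (x ∈ I ∧ y ∉ J) ∨ (x ∉ J ∧ y ∈ I) then callProb G x y else 0) =
      (if x ∈ I ∧ y ∉ J then callProb G x y else 0) +
        if y ∈ I ∧ x ∉ J then callProb G x y else 0 := by
    intro x y
    by_cases hx : x ∈ I
    · have := hIJ hx
      by_cases hy : y ∈ J <;> simp [hx, hy, this]
    · by_cases hy : y ∈ I <;> simp [hx, hy]
  simp only [h1, Finset.sum_add_distrib]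
  rw [Finset.sum_comm (f := fun x y => if y ∈ I ∧ x ∉ J then callProb G x y else 0),
    ← Finset.sum_add_distrib]
  simp only [← Finset.sum_add_distrib]
  rw [← Fintype.sum_prod_type' (f := fun x y => (if x ∈ I ∧ y ∉ J then callProb G x y else 0) +
    if x ∈ I ∧ y ∉ J then callProb G y x else 0), outEdges, Finset.sum_filter]
  refine Finset.sum_congr rfl fun e _ => ?_
  by_cases hadj : G.Adj e.1 e.2
  · by_cases h2 : e.1 ∈ I <;> by_cases h3 : e.2 ∈ J <;> simp [h2, h3, hadj, edgeRate]
  · have h4 : ¬ G.Adj e.2 e.1 := fun h => hadj h.symm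
    simp [hadj, callProb_of_not_adj hadj, callProb_of_not_adj h4]

/-- Both sides are the probability that nothing passes from `I` to the complement of `J`, namely
`exp (-R * rate)` with the total rate of the edges between them. For percolation this is survival of
the edges up to `R`; for the calls it is the product over callers of Poisson generating functions.
-/
theorem poissonSyncLaw_subset (hG : ∀ x, (G.neighborSet x).Nonempty) (R : ℕ) (I J : Set V) :
    poissonSyncLaw G R {ω | poissonEnlarge I ω ⊆ J} = fppLaw G {w | enlarge G R I w ⊆ J} := by
  classical
  by_cases hIJ : I ⊆ J
  · have h1 : fppLaw G {w | enlarge G R I w ⊆ J} =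
        ENNReal.ofReal (Real.exp (-((∑ e ∈ outEdges G I J, edgeRate G e) * R))) := by
      have := fppLaw_shiftOn G (outEdges G I J) (u := R) (Nat.cast_nonneg R) MeasurableSet.univ
      rw [measure_univ, mul_one] at this
      rw [← this]
      congr 1
      ext w
      simp only [Set.mem_ofPred_eq, Set.mem_univ, and_true]
      constructor
      · intro h e he
        obtain ⟨h1, h2, h3⟩ := mem_outEdges.1 he
        exact not_le.1 fun hle => h2 (h (Or.inr ⟨e.1, h1, h3, hle⟩))
      · rintro h y (hy | ⟨x, hx, hadj, hle⟩)
        · exact hIJ hy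
        · by_contra hyJ
          exact absurd (h (x, y) (mem_outEdges.2 ⟨hx, hyJ, hadj⟩)) (not_lt.2 hle)
    set S : V → Set V := fun x => {y | ¬ ((x ∈ I ∧ y ∉ J) ∨ (x ∉ J ∧ y ∈ I))} with hS
    have hm : MeasurableSet {ω | poissonEnlarge I ω ⊆ J} := by
      have : {ω | poissonEnlarge I ω ⊆ J} = ⋂ y ∈ Jᶜ, {ω | y ∈ poissonEnlarge I ω}ᶜ := by
        ext ω
        simp only [Set.mem_iInter, Set.mem_compl_iff, Set.mem_ofPred_eq]
        exact ⟨fun h y hy h' => hy (h h'), fun h y hy => by_contra fun h' => h y h' hy⟩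
      rw [this]
      exact .biInter (Set.to_countable _) fun y _ => (measurableSet_mem_poissonEnlarge I y).compl
    rw [h1, poissonSyncLaw, Measure.prod_apply hm]
    have h2 : ∀ N : V → ℕ, syncLaw G (Prod.mk N ⁻¹' {ω | poissonEnlarge I ω ⊆ J}) =
        ∏ x, callLaw G x (S x) ^ N x := by
      intro N
      rw [← syncLaw_forall_lt]
      congr 1
      ext c
      simp only [Set.mem_preimage, Set.mem_ofPred_eq, poissonEnlarge_subset_iff, hIJ, true_and]
      rfl
    simp only [h2]
    rw [lintegral_infinitePi_prod (fun _ : V => poissonMeasure R)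
      (f := fun x k => callLaw G x (S x) ^ k) (fun x => measurable_of_countable _)]
    have h3 : ∀ x, ∫⁻ k, callLaw G x (S x) ^ k ∂(poissonMeasure R) = ENNReal.ofReal (Real.exp
        (-((∑ y, if (x ∈ I ∧ y ∉ J) ∨ (x ∉ J ∧ y ∈ I) then callProb G x y else 0) * R))) := by
      intro x
      have h4 : ∑ y, (if (x ∈ I ∧ y ∉ J) ∨ (x ∉ J ∧ y ∈ I) then callProb G x y else 0) =
          ∑ y, if y ∈ S x then 0 else callProb G x y := by
        refine Finset.sum_congr rfl fun y _ => ?_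
        by_cases h : (x ∈ I ∧ y ∉ J) ∨ (x ∉ J ∧ y ∈ I)
        · rw [if_pos h, if_neg (fun h' : y ∈ S x => h' h)]
        · rw [if_neg h, if_pos (show y ∈ S x from h)]
      rw [callLaw_eq_ofReal hG, lintegral_pow_poissonMeasure, h4]
      · congr 4; ring
      · rw [sub_nonneg, ← sum_callProb G (hG x)]
        refine Finset.sum_le_sum fun y _ => ?_
        split_ifs
        · exact callProb_nonneg G x y
        · exact le_rfl
    simp only [h3]
    rw [← ENNReal.ofReal_prod_of_nonneg fun x _ => (Real.exp_pos _).le, ← Real.exp_sum,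
      sum_edgeRate_outEdges hIJ, Finset.sum_neg_distrib, Finset.sum_mul]
  · have h1 : {ω : (V → ℕ) × SyncOutcome V | poissonEnlarge I ω ⊆ J} = ∅ :=
      Set.eq_empty_of_forall_notMem fun ω h => hIJ (Set.subset_union_left.trans h)
    have h2 : {w | enlarge G R I w ⊆ J} = ∅ :=
      Set.eq_empty_of_forall_notMem fun w h => hIJ ((subset_enlarge _).trans h)
    rw [h1, h2, measure_empty, measure_empty]

theorem measurableSet_mem_enlarge (R : ℝ) (I : Set V) (y : V) :
    MeasurableSet {w | y ∈ enlarge G R I w} := by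
  have : {w | y ∈ enlarge G R I w} = ⋃ J ∈ {J : Set V | y ∈ J}, {w | enlarge G R I w = J} := by
    ext; simp
  rw [this]
  exact .biUnion (Set.to_countable _) fun J _ => measurableSet_enlarge_eq G R I J

/-- One window of first-passage percolation is dominated by `4 * R` synchronous rounds. -/
theorem sum_enlarge_le (hG : ∀ x, (G.neighborSet x).Nonempty) (R : ℕ) (I : Set V)
    {h : Set V → ℝ≥0∞} (hmono : Monotone h) (h1 : ∀ J, h J ≤ 1) :
    ∑ J, fppLaw G {w | enlarge G R I w = J} * h J ≤
      ∑ J, syncLaw G {c | syncFrom I c (4 * R) = J} * h J +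
        ENNReal.ofReal (Fintype.card V * Real.exp (-(2 * R))) := by
  classical
  have hK := measurableSet_mem_poissonEnlarge I
  have hbad : ∀ x, MeasurableSet {ω : (V → ℕ) × SyncOutcome V | 4 * R < ω.1 x} := fun x => by
    have : Measurable fun ω : (V → ℕ) × SyncOutcome V => ω.1 x := by fun_prop
    exact measurableSet_lt measurable_const this
  set bad : Set ((V → ℕ) × SyncOutcome V) := ⋃ x, {ω | 4 * R < ω.1 x}
  have hF : ∀ y, MeasurableSet {ω : (V → ℕ) × SyncOutcome V | y ∈ syncFrom I ω.2 (4 * R)} :=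
    fun y => measurable_snd (measurableSet_mem_syncFrom I (4 * R) y)
  have hbadle : poissonSyncLaw G R bad ≤ ENNReal.ofReal (Fintype.card V * Real.exp (-(2 * R))) := by
    refine (measure_iUnion_fintype_le _ _).trans ?_
    have h2 : ∀ x, poissonSyncLaw G R {ω | 4 * R < ω.1 x} ≤
        ENNReal.ofReal (Real.exp (-(2 * R))) := by
      intro x
      have h3 : MeasurePreserving (fun ω : (V → ℕ) × SyncOutcome V => ω.1 x)
          (poissonSyncLaw G R) (poissonMeasure R) :=
        (measurePreserving_eval_infinitePi (fun _ : V => poissonMeasure R) x).comp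
          measurePreserving_fst
      rw [show {ω : (V → ℕ) × SyncOutcome V | 4 * R < ω.1 x} =
        (fun ω : (V → ℕ) × SyncOutcome V => ω.1 x) ⁻¹' {k | 4 * R < k} from rfl,
        h3.measure_preimage (MeasurableSet.of_discrete).nullMeasurableSet]
      exact poissonMeasure_lt_le R
    refine (Finset.sum_le_sum fun x _ => h2 x).trans (le_of_eq ?_)
    rw [Finset.sum_const, Finset.card_univ, nsmul_eq_mul, ENNReal.ofReal_mul (Nat.cast_nonneg _),
      ENNReal.ofReal_natCast]
  calc ∑ J, fppLaw G {w | enlarge G R I w = J} * h J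
      = ∑ J, poissonSyncLaw G R {ω | poissonEnlarge I ω = J} * h J :=
        Finset.sum_congr rfl fun J _ => by
          rw [measure_randomSet_eq hK (measurableSet_mem_enlarge (G := G) R I)
            (poissonSyncLaw_subset hG R I) J]
    _ = ∫⁻ ω, h (poissonEnlarge I ω) ∂(poissonSyncLaw G R) := (lintegral_randomSet _ hK h).symm
    _ ≤ ∫⁻ ω, h (syncFrom I ω.2 (4 * R)) + bad.indicator 1 ω ∂(poissonSyncLaw G R) := by
        refine lintegral_mono fun ω => ?_
        by_cases hω : ω ∈ bad
        · rw [Set.indicator_of_mem hω]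
          exact (h1 _).trans le_add_self
        · refine le_trans (hmono (poissonEnlarge_subset_syncFrom fun x => ?_)) le_self_add
          exact not_lt.1 fun hlt => hω (Set.mem_iUnion.2 ⟨x, hlt⟩)
    _ = (∫⁻ ω, h (syncFrom I ω.2 (4 * R)) ∂(poissonSyncLaw G R)) + poissonSyncLaw G R bad := by
        rw [lintegral_add_right _ (measurable_one.indicator (.iUnion hbad)),
          lintegral_indicator_one (.iUnion hbad)]
    _ ≤ _ := by
        rw [lintegral_randomSet _ hF h]
        refine add_le_add (Finset.sum_le_sum fun J _ => ?_) hbadle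
        refine mul_le_mul_left (le_of_eq ?_) _
        have h3 : MeasurePreserving Prod.snd (poissonSyncLaw G R) (syncLaw G) :=
          measurePreserving_snd
        exact h3.measure_preimage (measurableSet_randomSet_eq
          (measurableSet_mem_syncFrom I (4 * R)) J).nullMeasurableSet

/-- Induction over windows: the Markov properties of the two processes are combined with the
one-window domination, each window adding an error `ε`. -/
theorem roundedProb_le_syncProb (hG : ∀ x, (G.neighborSet x).Nonempty) {R : ℕ} (hR : 0 < R)
    (m : ℕ) (I : Set V) : roundedProb G R I m ≤ syncProb G I (4 * R * m) +
      m * ENNReal.ofReal (Fintype.card V * Real.exp (-(2 * R))) := by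
  classical
  have hR' : (0 : ℝ) < R := by exact_mod_cast hR
  set ε := ENNReal.ofReal (Fintype.card V * Real.exp (-(2 * R)))
  induction m generalizing I with
  | zero =>
    by_cases hI : I = Set.univ
    · refine prob_le_one.trans (le_of_eq ?_)
      simp [syncProb, syncFrom, hI]
    -- Rounded passage times are at least one, so at time 0 only `I` itself is reached.
    · have : {w | Covers G (rounded R w) I ((0 : ℕ) : ℝ)} = ∅ := by
        refine Set.eq_empty_of_forall_notMem fun w hw => hI (Set.eq_univ_of_forall fun v => ?_)
        have hv : Passage G (rounded R w) I v ((0 : ℕ) : ℝ) := hw v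
        cases hv with
        | start _ _ h _ => exact h
        | step x _ t _ hx _ _ hle =>
          have h1 := hx.nonneg
          have h2 := one_le_rounded (R : ℝ) w (x, v)
          push_cast at hle
          linarith
      rw [roundedProb, this, measure_empty]
      exact zero_le
  | succ m ih =>
    calc roundedProb G R I ((m + 1 : ℕ) : ℝ) ≤
          ∑ J, fppLaw G {w | enlarge G R I w = J} * roundedProb G R J m := by
          push_cast
          exact roundedProb_succ_le G hR' I (Nat.cast_nonneg m)
      _ ≤ ∑ J, fppLaw G {w | enlarge G R I w = J} * (syncProb G J (4 * R * m) + m * ε) :=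
          Finset.sum_le_sum fun J _ => mul_le_mul_right (ih J) _
      _ = ∑ J, fppLaw G {w | enlarge G R I w = J} * syncProb G J (4 * R * m) + m * ε := by
          simp only [mul_add, Finset.sum_add_distrib, ← Finset.sum_mul]
          have h1 := measure_randomSet_mem (fppLaw G)
            (measurableSet_mem_enlarge (G := G) (R : ℝ) I) Finset.univ
          simp only [Finset.mem_univ] at h1
          rw [← h1, show {w : V × V → ℝ | True} = Set.univ from Set.ofPred_true, measure_univ,
            one_mul]
      _ ≤ ∑ J, syncLaw G {c | syncFrom I c (4 * R) = J} * syncProb G J (4 * R * m) + ε + m * ε :=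
          add_le_add_left (sum_enlarge_le hG R I (syncProb_mono G _)
            fun J => syncProb_le_one G J _) _
      _ = _ := by
          rw [← syncProb_add, show 4 * R + 4 * R * m = 4 * R * (m + 1) by ring, add_assoc]
          push_cast
          ring

end Window

/-! ### Choice of parameters and conclusion -/

section Assembly

/-- With `z = t^(2/3) n^(1/3)` the choices are `R = ⌈10 log n⌉`, `L = ⌈20 z⌉` and `m = ⌈t/R + 2L⌉`.
The constant `8000` is `20³`. The factor 10 in `R` makes `exp (-2R) ≤ n^(-20)`, which beats the
polynomial bound on `m * n`. The upper bound on `t` ensures `t/R ≤ z`. -/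
theorem exists_parameters {n t : ℝ} (hn : 2 ≤ n) (ht : 1 / 3 ≤ t)
    (htn : t ≤ 2 * n * (Real.log n + 5)) :
    ∃ L R m : ℕ, 1 ≤ L ∧ 0 < R ∧ 8000 * (t ^ 2 * n) ≤ L ^ 3 ∧ t / R + 2 * L ≤ m ∧
      0 < m ∧ m * (n * Real.exp (-(2 * R))) ≤ 1 / 4 ∧
      16 * (R * m : ℝ) ≤ 9100 * (t ^ (2 / 3 : ℝ) * n ^ (1 / 3 : ℝ) * Real.log n) := by
  have hn0 : 0 < n := by linarith
  have ht0 : 0 < t := by linarith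
  set l := Real.log n with hl
  have hl2 : (0.69 : ℝ) ≤ l := by
    have := Real.log_two_gt_d9
    have h2 := Real.log_le_log (by norm_num) hn
    linarith
  have hln : l ≤ n := (Real.log_le_sub_one_of_pos hn0).trans (by linarith)
  set z := t ^ (2 / 3 : ℝ) * n ^ (1 / 3 : ℝ) with hz
  have hz0 : 0 < z := mul_pos (Real.rpow_pos_of_pos ht0 _) (Real.rpow_pos_of_pos hn0 _)
  have hz3 : z ^ 3 = t ^ 2 * n := by
    rw [hz, mul_pow, ← Real.rpow_natCast, ← Real.rpow_natCast (n ^ (1 / 3 : ℝ)),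
      ← Real.rpow_mul ht0.le, ← Real.rpow_mul hn0.le, ← Real.rpow_natCast t]
    norm_num
  -- From `l ≥ 0.69` one has `2l + 10 ≤ 18l`.
  have ht18 : t ≤ 18 * (n * l) := by nlinarith
  have hz12 : 1 / 2 ≤ z := by
    refine le_of_pow_le_pow_left₀ three_ne_zero hz0.le ?_
    rw [hz3]
    nlinarith
  have hzn : z ≤ 7 * n ^ 2 := by
    refine le_of_pow_le_pow_left₀ three_ne_zero (by positivity) ?_
    have h1 : t ≤ 18 * n ^ 2 := ht18.trans (by nlinarith)
    calc z ^ 3 = t ^ 2 * n := hz3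
      _ ≤ (18 * n ^ 2) ^ 2 * n := by gcongr
      _ = 324 * n ^ 5 * 1 := by ring
      _ ≤ 324 * n ^ 5 * n := by gcongr; linarith
      _ ≤ (7 * n ^ 2) ^ 3 := by
        have : 0 ≤ n ^ 6 := by positivity
        nlinarith
  set R := ⌈10 * l⌉₊ with hR
  have hRl : 10 * l ≤ R := Nat.le_ceil _
  have hRu : (R : ℝ) < 10 * l + 1 := Nat.ceil_lt_add_one (by linarith)
  have hR0 : (0 : ℝ) < R := by linarith
  have htR : t / R ≤ z := by
    refine le_of_pow_le_pow_left₀ three_ne_zero hz0.le ?_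
    rw [div_pow, div_le_iff₀ (by positivity), hz3]
    have h1 : (18 : ℝ) * l ≤ R ^ 3 := by
      have h2 : 0 ≤ l ^ 2 - 0.69 ^ 2 := by nlinarith
      calc 18 * l ≤ (10 * l) ^ 3 := by nlinarith [mul_nonneg (by linarith : 0 ≤ l) h2]
        _ ≤ R ^ 3 := by gcongr
    calc t ^ 3 = t ^ 2 * t := by ring
      _ ≤ t ^ 2 * (18 * (n * l)) := by gcongr
      _ = t ^ 2 * n * (18 * l) := by ring
      _ ≤ _ := by gcongr
  set L := ⌈20 * z⌉₊ with hL
  have hLl : 20 * z ≤ L := Nat.le_ceil _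
  have hLu : (L : ℝ) < 20 * z + 1 := Nat.ceil_lt_add_one (by linarith)
  have hL0 : (0 : ℝ) < L := by linarith
  set m := ⌈t / R + 2 * L⌉₊ with hm
  have hpos : 0 < t / R + 2 * L := by positivity
  have hml : t / R + 2 * L ≤ m := Nat.le_ceil _
  have hmu : (m : ℝ) < t / R + 2 * L + 1 := Nat.ceil_lt_add_one hpos.le
  have hm0 : (0 : ℝ) < m := by linarith
  -- The bounds add up to `z + 2 (20z + 1) + 1 = 41z + 3`, and `3 ≤ 6z` since `z ≥ 1/2`.
  have hm47 : (m : ℝ) ≤ 47 * z := by linarith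
  refine ⟨L, R, m, by exact_mod_cast hL0, by exact_mod_cast hR0, ?_, hml, by exact_mod_cast hm0,
    ?_, ?_⟩
  · calc 8000 * (t ^ 2 * n) = (20 * z) ^ 3 := by rw [← hz3]; ring
      _ ≤ _ := by gcongr
  · have h1 : Real.exp (-(2 * R)) ≤ (n ^ 20)⁻¹ := by
      rw [← Real.exp_log (by positivity : 0 < n ^ 20), ← Real.exp_neg, Real.log_pow]
      refine Real.exp_le_exp.2 ?_
      push_cast
      linarith
    calc m * (n * Real.exp (-(2 * R))) ≤ (47 * (7 * n ^ 2)) * (n * (n ^ 20)⁻¹) := by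
          gcongr
          exact hm47.trans (by linarith)
      _ = 329 * (n ^ 17)⁻¹ := by field_simp; norm_num
      _ ≤ 329 * ((2 : ℝ) ^ 17)⁻¹ := by gcongr
      _ ≤ _ := by norm_num
  · have h1 : (R : ℝ) ≤ 12 * l := by linarith
    calc 16 * (R * m : ℝ) ≤ 16 * (12 * l * (47 * z)) := by gcongr
      _ = 9024 * (z * l) := by ring
      _ ≤ _ := mul_le_mul_of_nonneg_right (by norm_num) (mul_nonneg hz0.le (by linarith))

variable {V : Type*} [Fintype V] [MeasurableSpace V] [MeasurableSingletonClass V]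
  {G : SimpleGraph V}

/-- By time `1/6` everyone is informed with probability at most `3 * (1/6) = 1/2`, so the mean is at
least `(1/6) * (1/2)`. -/
theorem one_div_twelve_le_expectedAsync (hG : G.Connected) (hn : 1 < Fintype.card V) (s : V) :
    ENNReal.ofReal (1 / 12) ≤ expectedAsync G s := by
  have : Nonempty V := ⟨s⟩
  have hN := neighborSet_nonempty hG hn
  refine le_trans ?_ (mul_informedProb_compl_le G s (1 / 6))
  have h1 : informedProb G {s} (1 / 6) ≤ ENNReal.ofReal (1 / 2) :=
    (informedProb_le_coverProb hN {s} (1 / 6)).trans ((coverProb_le hN hn s (by norm_num)).trans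
      (ENNReal.ofReal_le_ofReal (by norm_num)))
  refine le_trans (le_of_eq ?_) (mul_le_mul_right (tsub_le_tsub_left h1 1) _)
  rw [← ENNReal.ofReal_one, ← ENNReal.ofReal_sub _ (by norm_num),
    ← ENNReal.ofReal_mul (by norm_num)]
  norm_num

/-- Markov's inequality for the asynchronous spread time at four times its mean, transferred to
percolation. -/
theorem coverProb_four_mul_ge (hG : G.Connected) (hn : 1 < Fintype.card V) (s : V) :
    ENNReal.ofReal (3 / 4) ≤ coverProb G {s} (4 * (expectedAsync G s).toReal) := by
  have : Nonempty V := ⟨s⟩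
  have hfin := (expectedAsync_lt_top hG hn s).ne
  have hlow := one_div_twelve_le_expectedAsync hG hn s
  refine le_trans ?_ (informedProb_le_coverProb (neighborSet_nonempty hG hn) {s} _)
  set a := (expectedAsync G s).toReal with ha
  have ha0 : 0 < a := ENNReal.toReal_pos
    ((ENNReal.ofReal_pos.2 (by norm_num)).trans_le hlow).ne' hfin
  set P := informedProb G {s} (4 * a)
  have h1 : ENNReal.ofReal (4 * a) * (1 - P) ≤ ENNReal.ofReal a :=
    (mul_informedProb_compl_le G s (4 * a)).trans (ENNReal.ofReal_toReal hfin).ge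
  have h2 := mul_le_mul_right h1 (ENNReal.ofReal (4 * a)⁻¹)
  rw [← mul_assoc, ← ENNReal.ofReal_mul (by positivity), inv_mul_cancel₀ (by positivity),
    ENNReal.ofReal_one, one_mul, ← ENNReal.ofReal_mul (by positivity),
    show (4 * a)⁻¹ * a = 1 / 4 by field_simp] at h2
  have h3 : (1 : ℝ≥0∞) ≤ ENNReal.ofReal (1 / 4) + P := tsub_le_iff_right.1 h2
  have h4 : (1 : ℝ≥0∞) = ENNReal.ofReal (1 / 4) + ENNReal.ofReal (3 / 4) := by
    rw [← ENNReal.ofReal_add (by norm_num) (by norm_num)]; norm_num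
  rw [h4] at h3
  exact (ENNReal.add_le_add_iff_left ENNReal.ofReal_ne_top).1 h3

theorem expectedSync_le_of_one_lt_card (hG : G.Connected) (hn : 1 < Fintype.card V) (s : V) :
    expectedSync G s ≤ ((36400 : ℝ≥0) : ℝ≥0∞) * expectedAsync G s ^ (2 / 3 : ℝ) *
      (Fintype.card V : ℝ≥0∞) ^ (1 / 3 : ℝ) * ENNReal.ofReal (Real.log (Fintype.card V)) := by
  classical
  have hN := neighborSet_nonempty hG hn
  have hfin := (expectedAsync_lt_top hG hn s).ne
  have hlow := one_div_twelve_le_expectedAsync hG hn s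
  have hcov := coverProb_four_mul_ge hG hn s
  rw [← ENNReal.ofReal_toReal hfin] at hlow ⊢
  set a := (expectedAsync G s).toReal
  have ha : 1 / 12 ≤ a := by
    have : 0 ≤ a := ENNReal.toReal_nonneg
    exact (ENNReal.ofReal_le_ofReal_iff this).1 hlow
  set n : ℝ := (Fintype.card V : ℝ) with hndef
  have hn2 : 2 ≤ n := by rw [hndef]; exact_mod_cast hn
  have hl0 : 0 ≤ Real.log n := Real.log_nonneg (by linarith)
  -- Either time gives covering probability at least `3/4`; the cap supplies the upper bound on `t`
  -- demanded by the choice of parameters.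
  set t := min (4 * a) (2 * n * (Real.log n + 5)) with ht
  have ht3 : 1 / 3 ≤ t := le_min (by linarith) (by nlinarith)
  have hcovt : ENNReal.ofReal (3 / 4) ≤ coverProb G {s} t := by
    rcases min_choice (4 * a) (2 * n * (Real.log n + 5)) with h | h
    · rw [ht, h]; exact hcov
    · rw [ht, h]; exact coverProb_ge_of_le hG s le_rfl
  obtain ⟨L, R, m, hL, hR, hL3, hm, hm0, herr, hT⟩ := exists_parameters hn2 ht3 (min_le_right _ _)
  have h1 := (roundedProb_ge hN (R := R) hcovt ht3 hL hL3 (by exact_mod_cast hR) hm).trans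
    (roundedProb_le_syncProb hN hR m {s})
  have h2 : ENNReal.ofReal (1 / 4) ≤ syncProb G {s} (4 * R * m) := by
    have h3 : (m : ℝ≥0∞) * ENNReal.ofReal (Fintype.card V * Real.exp (-(2 * R))) ≤
        ENNReal.ofReal (1 / 4) := by
      rw [← ENNReal.ofReal_natCast, ← ENNReal.ofReal_mul (Nat.cast_nonneg _)]
      exact ENNReal.ofReal_le_ofReal herr
    have h4 := h1.trans (add_le_add_right h3 _)
    rw [show (1 / 2 : ℝ) = 1 / 4 + 1 / 4 by norm_num,
      ENNReal.ofReal_add (by norm_num) (by norm_num)] at h4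
    exact (ENNReal.add_le_add_iff_right ENNReal.ofReal_ne_top).1 h4
  -- Blocks of `4Rm` rounds give the bound `16Rm`. Replacing `t` by `4a` costs `4^(2/3) ≤ 4`, and
  -- `36400 = 4 * 9100`.
  refine (expectedSync_le (by positivity) h2).trans ?_
  have hrhs : ((36400 : ℝ≥0) : ℝ≥0∞) * ENNReal.ofReal a ^ (2 / 3 : ℝ) *
      (Fintype.card V : ℝ≥0∞) ^ (1 / 3 : ℝ) * ENNReal.ofReal (Real.log n) =
      ENNReal.ofReal (36400 * a ^ (2 / 3 : ℝ) * n ^ (1 / 3 : ℝ) * Real.log n) := by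
    rw [ENNReal.ofReal_rpow_of_pos (by linarith), ← ENNReal.ofReal_natCast, ← hndef,
      ENNReal.ofReal_rpow_of_pos (by linarith), ENNReal.ofReal_mul (by positivity),
      ENNReal.ofReal_mul (by positivity), ENNReal.ofReal_mul (by positivity)]
    congr 3
    norm_num
  have hlhs : (4 : ℝ≥0∞) * ((4 * R * m : ℕ) : ℝ≥0∞) = ENNReal.ofReal (16 * (R * m)) := by
    rw [show 16 * ((R : ℝ) * m) = ((4 * (4 * R * m) : ℕ) : ℝ) by push_cast; ring,
      ENNReal.ofReal_natCast]
    push_cast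
    rfl
  rw [hrhs, hlhs]
  refine ENNReal.ofReal_le_ofReal (hT.trans ?_)
  have h5 : t ^ (2 / 3 : ℝ) ≤ 4 * a ^ (2 / 3 : ℝ) := by
    calc t ^ (2 / 3 : ℝ) ≤ (4 * a) ^ (2 / 3 : ℝ) :=
          Real.rpow_le_rpow (by linarith) (min_le_left _ _) (by norm_num)
      _ = 4 ^ (2 / 3 : ℝ) * a ^ (2 / 3 : ℝ) := Real.mul_rpow (by norm_num) (by linarith)
      _ ≤ 4 ^ (1 : ℝ) * a ^ (2 / 3 : ℝ) := by
          gcongr <;> norm_num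
      _ = _ := by rw [Real.rpow_one]
  calc 9100 * (t ^ (2 / 3 : ℝ) * n ^ (1 / 3 : ℝ) * Real.log n) ≤
        9100 * (4 * a ^ (2 / 3 : ℝ) * n ^ (1 / 3 : ℝ) * Real.log n) := by gcongr
    _ = _ := by ring

theorem expectedSync_eq_zero_of_subsingleton [Subsingleton V] (G : SimpleGraph V) (s : V) :
    expectedSync G s = 0 := by
  refine (lintegral_congr fun c => ?_).trans lintegral_zero
  refine le_antisymm ((iInf₂_le 0 fun v => ?_).trans (by simp)) zero_le
  exact Subsingleton.elim v s

theorem expectedAsync_eq_zero_of_subsingleton [Subsingleton V] (G : SimpleGraph V) (s : V) :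
    expectedAsync G s = 0 := by
  refine (lintegral_congr fun ω => ?_).trans lintegral_zero
  refine le_antisymm ((iInf₂_le (0 : ℝ) fun v => ?_).trans (by simp)) zero_le
  rw [Subsingleton.elim v s]
  exact .start

end Assembly

end Rumour

theorem corollary1 :
    ∃ C : ℝ≥0, ∀ (V : Type*) [Fintype V] [MeasurableSpace V] [MeasurableSingletonClass V]
      (G : SimpleGraph V), G.Connected → ∀ s : V,
        Rumour.expectedAsync G s < ∞ ∧
        Rumour.expectedSync G s ≤
          (C : ℝ≥0∞) * Rumour.expectedAsync G s ^ (2 / 3 : ℝ) *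
            (Fintype.card V : ℝ≥0∞) ^ (1 / 3 : ℝ) *
              ENNReal.ofReal (Real.log (Fintype.card V)) := by
  refine ⟨36400, fun V _ _ _ G hG s => ?_⟩
  by_cases hn : 1 < Fintype.card V
  · exact ⟨Rumour.expectedAsync_lt_top hG hn s, Rumour.expectedSync_le_of_one_lt_card hG hn s⟩
  · have : Subsingleton V := Fintype.card_le_one_iff_subsingleton.1 (not_lt.1 hn)
    rw [Rumour.expectedAsync_eq_zero_of_subsingleton, Rumour.expectedSync_eq_zero_of_subsingleton]
    exact ⟨ENNReal.zero_lt_top, zero_le⟩
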